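/- Conventions. A Petri net $\mathcal N=(P,T,W^-,W^+)$ consists of finite sets $P$ (places), $T$ (transitions) and matrices $W^\pm\in\mathbb N^{P\times T}$ with columns $W^\pm(t)$, such that $W^-(t)\ne W^+(t)$ for all $t$, and $W^-(t)\neq W^-(t')$ or $W^+(t)\neq W^+(t')$ for all $t\ne t'$. A marking $m\in\mathbb N^P$ enables $t$ if $m\ge W^-(t)$; firing $t$ then leads to $m-W^-(t)+W^+(t)$. $\mathcal R(m_0)$ is the set of markings reachable from $m_0$, and $(\mathcal N,m_0)$ is live if for every $t\in T$ and $m\in\mathcal R(m_0)$ some marking reachable from $m$ enables $t$. A marked stochastic net $(\mathcal N,\lambda,m_0)$ has in addition firing rates $\lambda:T\to\mathbb R_{>0}$. It defines the continuous-time Markov chain on $\mathcal R(m_0)$ with generator $\mathbf Q(m,m')=\sum_{t:\,m\xrightarrow{t}m'}\lambda(t)$ for $m\ne m'$ and $\mathbf Q(m,m)=-\sum_{m'\ne m}\mathbf Q(m,m')$. The net is ergodic if this chain has a steady-state distribution, i.e. if there is a probability distribution $\pi$ on $\mathcal R(m_0)$ with $\pi\cdot\mathbf Q=0$. The bag graph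 of $\mathcal N$ has the vertex set $V=\{W^-(t),W^+(t)\mid t\in T\}$ (the bags) and the edges $W^-(t)\xrightarrow{t}W^+(t)$. $\mathcal N$ is an $N$-closed $\Pi^3$-net if (i) there is a bijection $p\mapsto b_p$ from $P$ to $V$ with $b_p(p)=1$; the potential of $p$ is $\mathsf{pot}(p)=\sum_q b_p(q)-1$; (ii) the bag graph has exactly $N$ connected components $V_1,\dots,V_N$ (numbered suitably), all of them strongly connected; let $P_i=\{p\mid b_p\in V_i\}$, let $P_i^{\max}$ be the set of places of maximal potential in $P_i$, and $P_0^{\max}=\emptyset$; (iii) if $b_p\in V_i$, $q\ne p$ and $b_p(q)>0$, then $q\in P_{i-1}^{\max}$. An open $\Pi^3$-net is a net obtained from an $N$-closed $\Pi^3$-net, for some $N$, by deleting one place of $P_N$ together with its input and output edges. Computations are carried out by a random access machine over the ordered field $\mathbb R$ (Blum–Shub–Smale model): the operations $+,-,\times,/$ and comparisons of real numbers, as well as addition, cut-off subtraction and comparison of natural numbers (which also serve as memory addresses), cost one step each; the only constants are natural numbers. The size of an input $(\mathcal N,\lambda,m_0)$ is the total length of its description, in which the numbers $W^\pm(p,t)$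 and $m_0(p)$ are written in binary and each real number $\lambda(t)$ has length one. Statement. Ergodicity of a marked, live, open stochastic $\Pi^3$-net can be decided in polynomial time. That is, there are a single program and a polynomial $B$ such that for every marked stochastic net $(\mathcal N,\lambda,m_0)$ for which $\mathcal N$ is an open $\Pi^3$-net and $(\mathcal N,m_0)$ is live, the program, started with $|P|$, $|T|$, $W^-$, $W^+$, $m_0$ and $\lambda$ in its memory, halts after at most $B(s)$ steps, where $s$ is the size of the input, with output $1$ if $(\mathcal N,\lambda,m_0)$ is ergodic and with output $0$ if it is not. -/

import Mathlib

/-! ### Petri nets and their Markov chains -/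

/-- A Petri net with places `P` and transitions `T`. The column `W⁻(t)` of the backward incidence
matrix is `pre t`, the column `W⁺(t)` of the forward incidence matrix is `post t`. There are no
useless and no duplicated transitions. -/
structure PetriNet (P T : Type) where
  pre : T → P → ℕ
  post : T → P → ℕ
  no_useless : ∀ t, pre t ≠ post t
  no_duplicate : ∀ t t', t ≠ t' → pre t ≠ pre t' ∨ post t ≠ post t'

namespace PetriNet

variable {P T : Type}

/-- `t` is enabled in the marking `m`. -/
def Enabled (𝒩 : PetriNet P T) (t : T) (m : P → ℕ) : Prop := ∀ p, 𝒩.pre t p ≤ m p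

/-- The firing `m →ᵗ m'`. -/
def Fires (𝒩 : PetriNet P T) (t : T) (m m' : P → ℕ) : Prop :=
  𝒩.Enabled t m ∧ ∀ p, m' p = m p - 𝒩.pre t p + 𝒩.post t p

/-- The set of markings reachable from `m₀`. -/
def ReachSet (𝒩 : PetriNet P T) (m₀ : P → ℕ) : Set (P → ℕ) :=
  {m | Relation.ReflTransGen (fun m₁ m₂ => ∃ t, 𝒩.Fires t m₁ m₂) m₀ m}

/-- Liveness of the marked net `(𝒩, m₀)`. -/
def Live (𝒩 : PetriNet P T) (m₀ : P → ℕ) : Prop :=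
  ∀ t, ∀ m ∈ 𝒩.ReachSet m₀, ∃ m' ∈ 𝒩.ReachSet m, 𝒩.Enabled t m'

open scoped Classical in
/-- The rate at which the chain of the net with firing rates `rate` jumps from `m` to `m'`:
the sum of the rates of the transitions `t` with `m →ᵗ m'`. -/
noncomputable def jumpRate [Fintype T] (𝒩 : PetriNet P T) (rate : T → ℝ) (m m' : P → ℕ) : ℝ :=
  ∑ t, if 𝒩.Fires t m m' then rate t else 0

open scoped Classical in
/-- The infinitesimal generator `Q` of the continuous time Markov chain on the reachability set.
In the diagonal entry only finitely many summands are non-zero. -/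
noncomputable def generator [Fintype T] (𝒩 : PetriNet P T) (rate : T → ℝ) (m₀ : P → ℕ)
    (m m' : 𝒩.ReachSet m₀) : ℝ :=
  if m = m' then -∑' m'' : 𝒩.ReachSet m₀, (if m'' = m then 0 else 𝒩.jumpRate rate m m'')
  else 𝒩.jumpRate rate m m'

/-- Ergodicity: there is a steady-state distribution, i.e. a probability distribution `π` on the
reachability set with `π · Q = 0`. (The exit rates are bounded by the sum of all firing rates, so
the chain does not explode.) -/
def Ergodic [Fintype T] (𝒩 : PetriNet P T) (rate : T → ℝ) (m₀ : P → ℕ) : Prop :=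
  ∃ π : 𝒩.ReachSet m₀ → ℝ, (∀ m, 0 ≤ π m) ∧ HasSum π 1 ∧
    ∀ m', HasSum (fun m => π m * 𝒩.generator rate m₀ m m') 0

/-! ### Π³-nets -/

/-- The bags of a net, i.e. the vertices of its bag graph. -/
def bags (𝒩 : PetriNet P T) : Set (P → ℕ) := {b | ∃ t, b = 𝒩.pre t ∨ b = 𝒩.post t}

/-- The edges of the bag graph. -/
def BagEdge (𝒩 : PetriNet P T) (b b' : P → ℕ) : Prop := ∃ t, 𝒩.pre t = b ∧ 𝒩.post t = b'

/-- The structure of an `N`-closed Π³-net. The layer `P_{i+1}` of the mathematical notation is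
`{p | layer p = i}` (layers are numbered from `0` here). -/
structure ClosedPi3 [Fintype P] (𝒩 : PetriNet P T) (N : ℕ) where
  /-- The bijection between places and bags. -/
  bag : P ≃ 𝒩.bags
  bag_self : ∀ p, (bag p).1 p = 1
  layer : P → Fin N
  layer_surjective : Function.Surjective layer
  /-- The layers are the connected components of the bag graph, and are strongly connected. -/
  reach_iff : ∀ p q, Relation.ReflTransGen 𝒩.BagEdge (bag p).1 (bag q).1 ↔ layer p = layer q
  /-- The other places of a bag lie in the layer below and have maximal potential there; the
  potential of a place `r` is `‖b_r‖ - 1`. -/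
  resource : ∀ p q, q ≠ p → 0 < (bag p).1 q →
    (layer q : ℕ) + 1 = layer p ∧
      ∀ r, layer r = layer q → ∑ s, (bag r).1 s - 1 ≤ ∑ s, (bag q).1 s - 1

/-- `𝒩` is an `N`-open Π³-net: it is obtained from an `N`-closed Π³-net, whose places are those of
`𝒩` and one more place `none`, by deleting the place `none`, which lies in the last layer. -/
def IsOpenPi3 [Fintype P] (𝒩 : PetriNet P T) (N : ℕ) : Prop :=
  ∃ (𝒩' : PetriNet (Option P) T) (S : 𝒩'.ClosedPi3 N), (S.layer none : ℕ) + 1 = N ∧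
    ∀ t p, 𝒩.pre t p = 𝒩'.pre t (some p) ∧ 𝒩.post t p = 𝒩'.post t (some p)

end PetriNet

/-! ### Programs over the reals and their running time

A random access machine over the ordered field of real numbers (the Blum–Shub–Smale model), given
by while-programs. It has variables and memory banks for natural numbers, used for indices and
integer data, and variables and memory banks for real numbers. A cell of a bank is addressed by two
natural numbers. Natural numbers can only be added, subtracted (with cut-off at `0`) and compared,
so that within `t` steps they grow by at most `O(t)` bits. Real numbers can be added, subtracted,
multiplied, divided and compared; there is no rounding, and no constant but natural numbers.
Every operation and every test costs one step. -/

namespace RealRAM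

/-- Memory contents. -/
structure State where
  nvar : ℕ → ℕ
  nmem : ℕ → ℕ → ℕ → ℕ
  rvar : ℕ → ℝ
  rmem : ℕ → ℕ → ℕ → ℝ

/-- Expressions for natural numbers. `get a i j` reads the cell `(i, j)` of the bank `a`. -/
inductive NExpr where
  | lit (c : ℕ)
  | var (x : ℕ)
  | get (a : ℕ) (i j : NExpr)
  | add (e f : NExpr)
  | sub (e f : NExpr)

/-- Expressions for real numbers. -/
inductive RExpr where
  | lit (c : ℕ)
  | var (x : ℕ)
  | get (a : ℕ) (i j : NExpr)
  | add (e f : RExpr)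
  | sub (e f : RExpr)
  | mul (e f : RExpr)
  | div (e f : RExpr)

/-- Tests `e < f` between natural numbers or between real numbers. -/
inductive Test where
  | nlt (e f : NExpr)
  | rlt (e f : RExpr)

/-- Programs. `nput a i j e` writes the value of `e` into the cell `(i, j)` of the bank `a`. -/
inductive Prog where
  | skip
  | nset (x : ℕ) (e : NExpr)
  | nput (a : ℕ) (i j e : NExpr)
  | rset (x : ℕ) (e : RExpr)
  | rput (a : ℕ) (i j : NExpr) (e : RExpr)
  | seq (c d : Prog)
  | ite (b : Test) (c d : Prog)
  | loop (b : Test) (c : Prog)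

/-- The value of an expression. -/
def NExpr.eval (s : State) : NExpr → ℕ
  | lit c => c
  | var x => s.nvar x
  | get a i j => s.nmem a (i.eval s) (j.eval s)
  | add e f => e.eval s + f.eval s
  | sub e f => e.eval s - f.eval s

/-- The number of steps for evaluating an expression. -/
def NExpr.cost : NExpr → ℕ
  | lit _ => 1
  | var _ => 1
  | get _ i j => i.cost + j.cost + 1
  | add e f => e.cost + f.cost + 1
  | sub e f => e.cost + f.cost + 1

/-- The value of an expression (with `x / 0 = 0`). -/
noncomputable def RExpr.eval (s : State) : RExpr → ℝ
  | lit c => (c : ℝ)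
  | var x => s.rvar x
  | get a i j => s.rmem a (i.eval s) (j.eval s)
  | add e f => e.eval s + f.eval s
  | sub e f => e.eval s - f.eval s
  | mul e f => e.eval s * f.eval s
  | div e f => e.eval s / f.eval s

/-- The number of steps for evaluating an expression. -/
def RExpr.cost : RExpr → ℕ
  | lit _ => 1
  | var _ => 1
  | get _ i j => i.cost + j.cost + 1
  | add e f => e.cost + f.cost + 1
  | sub e f => e.cost + f.cost + 1
  | mul e f => e.cost + f.cost + 1
  | div e f => e.cost + f.cost + 1

/-- The test `b` succeeds in the state `s`. -/
def Test.Holds (s : State) : Test → Prop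
  | nlt e f => e.eval s < f.eval s
  | rlt e f => e.eval s < f.eval s

/-- The number of steps for a test. -/
def Test.cost : Test → ℕ
  | nlt e f => e.cost + f.cost + 1
  | rlt e f => e.cost + f.cost + 1

/-- Writing one cell of a memory. -/
def write {α : Type} (M : ℕ → ℕ → ℕ → α) (a i j : ℕ) (v : α) : ℕ → ℕ → ℕ → α :=
  fun a' i' j' => if a' = a ∧ i' = i ∧ j' = j then v else M a' i' j'

/-- `Exec c s n s'`: started in the state `s`, the program `c` halts in the state `s'` after exactly
`n` steps. -/
inductive Exec : Prog → State → ℕ → State → Prop where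
  | skip (s : State) : Exec .skip s 1 s
  | nset (s : State) (x : ℕ) (e : NExpr) :
      Exec (.nset x e) s (e.cost + 1) { s with nvar := Function.update s.nvar x (e.eval s) }
  | nput (s : State) (a : ℕ) (i j e : NExpr) :
      Exec (.nput a i j e) s (i.cost + j.cost + e.cost + 1)
        { s with nmem := write s.nmem a (i.eval s) (j.eval s) (e.eval s) }
  | rset (s : State) (x : ℕ) (e : RExpr) :
      Exec (.rset x e) s (e.cost + 1) { s with rvar := Function.update s.rvar x (e.eval s) }
  | rput (s : State) (a : ℕ) (i j : NExpr) (e : RExpr) :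
      Exec (.rput a i j e) s (i.cost + j.cost + e.cost + 1)
        { s with rmem := write s.rmem a (i.eval s) (j.eval s) (e.eval s) }
  | seq {c d : Prog} {s s' s'' : State} {n n' : ℕ} :
      Exec c s n s' → Exec d s' n' s'' → Exec (.seq c d) s (n + n') s''
  | ite_true {b : Test} {c d : Prog} {s s' : State} {n : ℕ} :
      b.Holds s → Exec c s n s' → Exec (.ite b c d) s (b.cost + n) s'
  | ite_false {b : Test} {c d : Prog} {s s' : State} {n : ℕ} :
      ¬ b.Holds s → Exec d s n s' → Exec (.ite b c d) s (b.cost + n) s'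
  | loop_true {b : Test} {c : Prog} {s s' s'' : State} {n n' : ℕ} :
      b.Holds s → Exec c s n s' → Exec (.loop b c) s' n' s'' →
        Exec (.loop b c) s (b.cost + n + n') s''
  | loop_false {b : Test} {c : Prog} {s : State} :
      ¬ b.Holds s → Exec (.loop b c) s b.cost s

end RealRAM

/-! ### Marked stochastic Petri nets as inputs -/

/-- A marked stochastic Petri net with `n` places and `k` transitions. -/
structure MarkedSPN (n k : ℕ) where
  net : PetriNet (Fin n) (Fin k)
  rate : Fin k → ℝ
  rate_pos : ∀ t, 0 < rate t
  init : Fin n → ℕ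

namespace MarkedSPN

variable {n k : ℕ}

/-- The size of the input: natural numbers count with their binary length, real numbers (the `k`
firing rates) count one each. -/
def size (I : MarkedSPN n k) : ℕ :=
  n + k + ∑ t, ∑ p, ((I.net.pre t p).size + 1 + ((I.net.post t p).size + 1)) +
    ∑ p, ((I.init p).size + 1)

/-- The initial memory. Variables `0` and `1` contain the numbers of places and of transitions, the
banks `0` and `1` for natural numbers contain the incidence matrices, row `0` of bank `2` contains
the initial marking, row `0` of bank `0` for real numbers contains the firing rates. Everything else
is `0`. -/
noncomputable def initState (I : MarkedSPN n k) : RealRAM.State where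
  nvar x := if x = 0 then n else if x = 1 then k else 0
  nmem a i j :=
    if a = 0 then (if h : i < k ∧ j < n then I.net.pre ⟨i, h.1⟩ ⟨j, h.2⟩ else 0)
    else if a = 1 then (if h : i < k ∧ j < n then I.net.post ⟨i, h.1⟩ ⟨j, h.2⟩ else 0)
    else if a = 2 ∧ i = 0 then (if h : j < n then I.init ⟨j, h⟩ else 0)
    else 0
  rvar _ := 0
  rmem a i j := if a = 0 ∧ i = 0 then (if h : j < k then I.rate ⟨j, h⟩ else 0) else 0

end MarkedSPN

/-! Since the components of the bag graph are strongly connected, every firing can be undone, and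
the chain is irreducible on the reachability set. Let `w` be a positive solution of the traffic
equations, that is, a stationary vector of the walk on the bag graph. If a functional `ξ` on the
places satisfies `ξ · b = log w(b)` up to a constant on each component (`Valid`), then `m ↦ exp (ξ ·
m)` satisfies global balance (`bagBalance`, `BagBalance.balanced`). Such a `ξ` exists because the
bags are triangular with respect to the layers (`exists_valid`). Invariant measures being unique up
to a factor in the presence of a steady state, the net is ergodic iff this product form is summable
over the reachable markings (`Balanced.ergodic_iff`).

Let `p₀` be the deleted place, and call the places of maximal potential in the layer below the top
the supply. Place invariants may be added to `ξ`. The invariant `lowerInv` is non-negative and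
vanishes exactly on the top layer and the supply, so only these places matter. The invariant
`topInv` is `1` on the supply and `pot p₀ - pot p` on a top place `p`. Some `ξ + τ · topInv` is
negative on all these places iff `ξ · r < 0` for the extreme rays `r` of the cone `r ≥ 0`, `topInv ·
r = 0`. These are `p + (pot p - pot p₀) u` for `pot p ≥ pot p₀` and `u` in the supply, and `(pot p₀
- pot p') p + (pot p - pot p₀) p'` for `pot p' < pot p₀ < pot p`. If the inequalities hold, a
geometric series in several variables converges (`ergodic_of_neg`). Conversely, liveness leads to a
marking with a stock of tokens that makes the top layer freely movable (`exists_good`). Then every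
`r` in the cone can be produced again and again (`Good.absorb`), and the geometric series along
these markings forces `ξ · r < 0` (`neg_of_ergodic`).

The numbers `exp (ξ · r)` are computed from `w` by multiplication and division. The quotient of the
weights of two bags is corrected by ratios `exp (ξ q - ξ u)` between places of maximal potential of
one layer, and these ratios come recursively from the layer below (`compare`). The program does not
determine layers, potentials or the deleted place. It uses every combination of bags that formally
fits: each of them is sound, because the certified value is the same for all valid `ξ`
(`sound_compare`, `pass_of_ergodic`), and the genuine ones are among them (`compare_pos`,
`ergodic_of_pass`).

The vector `w` is found by state elimination without subtractions (`Solves.backTab`). Token numbers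
have polynomially many bits, so that powers are computed by repeated squaring, and all other loops
run over places, transitions or half-edges (`Ex.compiles`). -/

namespace RealRAM

/-! ### Runs with a bound on the running time -/

/-- Started in `s`, the program `c` halts within `T` steps in a state satisfying `Q`. -/
def Run (c : Prog) (s : State) (T : ℕ) (Q : State → Prop) : Prop :=
  ∃ t s', Exec c s t s' ∧ t ≤ T ∧ Q s'

theorem Run.mono {c : Prog} {s : State} {T T' : ℕ} {Q Q' : State → Prop} (h : Run c s T Q)
    (hT : T ≤ T') (hQ : ∀ s', Q s' → Q' s') : Run c s T' Q' := by
  obtain ⟨t, s', h1, h2, h3⟩ := h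
  exact ⟨t, s', h1, h2.trans hT, hQ _ h3⟩

theorem Run.seq {c d : Prog} {s : State} {T T' : ℕ} {Q Q' : State → Prop} (h : Run c s T Q)
    (h' : ∀ s', Q s' → Run d s' T' Q') : Run (.seq c d) s (T + T') Q' := by
  obtain ⟨t, s', h1, h2, h3⟩ := h
  obtain ⟨t', s'', h4, h5, h6⟩ := h' s' h3
  exact ⟨_, _, .seq h1 h4, Nat.add_le_add h2 h5, h6⟩

theorem Run.nset {s : State} {x : ℕ} {e : NExpr} {Q : State → Prop}
    (h : Q { s with nvar := Function.update s.nvar x (e.eval s) }) :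
    Run (.nset x e) s (e.cost + 1) Q := ⟨_, _, .nset s x e, le_rfl, h⟩

theorem Run.rset {s : State} {x : ℕ} {e : RExpr} {Q : State → Prop}
    (h : Q { s with rvar := Function.update s.rvar x (e.eval s) }) :
    Run (.rset x e) s (e.cost + 1) Q := ⟨_, _, .rset s x e, le_rfl, h⟩

theorem Run.rput {s : State} {a : ℕ} {i j : NExpr} {e : RExpr} {Q : State → Prop}
    (h : Q { s with rmem := write s.rmem a (i.eval s) (j.eval s) (e.eval s) }) :
    Run (.rput a i j e) s (i.cost + j.cost + e.cost + 1) Q := ⟨_, _, .rput s a i j e, le_rfl, h⟩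

theorem Run.ite {b : Test} {c d : Prog} {s : State} {T : ℕ} {Q : State → Prop}
    (h1 : b.Holds s → Run c s T Q) (h2 : ¬ b.Holds s → Run d s T Q) :
    Run (.ite b c d) s (b.cost + T) Q := by
  by_cases hb : b.Holds s
  · obtain ⟨t, s', h, h', h''⟩ := h1 hb
    exact ⟨_, _, .ite_true hb h, by omega, h''⟩
  · obtain ⟨t, s', h, h', h''⟩ := h2 hb
    exact ⟨_, _, .ite_false hb h, by omega, h''⟩

/-- A loop with an invariant that is indexed by a bound for the number of remaining rounds. -/
theorem Run.loop {b : Test} {c : Prog} {T : ℕ} {Inv : ℕ → State → Prop}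
    (step : ∀ i s, Inv i s → b.Holds s → Run c s T (fun s' => ∃ j < i, Inv j s')) :
    ∀ i s, Inv i s → Run (.loop b c) s (i * (b.cost + T) + b.cost)
      (fun s' => (∃ j ≤ i, Inv j s') ∧ ¬ b.Holds s') := by
  intro i
  induction i using Nat.strong_induction_on with
  | _ i ih =>
    intro s hs
    by_cases hb : b.Holds s
    · obtain ⟨t, s', h1, h2, j, hj, h3⟩ := step i s hs hb
      obtain ⟨t', s'', h4, h5, ⟨l, hl, h6⟩, h7⟩ := ih j hj s' h3
      refine ⟨_, _, .loop_true hb h1 h4, ?_, ⟨l, by omega, h6⟩, h7⟩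
      have : (j + 1) * (b.cost + T) ≤ i * (b.cost + T) := Nat.mul_le_mul_right _ hj
      rw [Nat.succ_mul] at this
      omega
    · exact ⟨_, _, .loop_false hb, Nat.le_add_left _ _, ⟨i, le_rfl, hs⟩, hb⟩

/-! ### Expressions with bounded big operators and powers -/

inductive Kind where
  | nat
  | real

abbrev Kind.Val : Kind → Type
  | .nat => ℕ
  | .real => ℝ

/-- Subtraction of reals is absent: the whole algorithm is subtraction-free, which also keeps all
computed reals non-negative. -/
inductive Op : Kind → Type where
  | addN : Op .nat
  | subN : Op .nat
  | addR : Op .real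
  | mulR : Op .real
  | divR : Op .real

noncomputable def Op.app : {κ : Kind} → Op κ → κ.Val → κ.Val → κ.Val
  | _, addN => fun (a b : ℕ) => (a + b : ℕ)
  | _, subN => fun (a b : ℕ) => (a - b : ℕ)
  | _, addR => fun (a b : ℝ) => (a + b : ℝ)
  | _, mulR => fun (a b : ℝ) => (a * b : ℝ)
  | _, divR => fun (a b : ℝ) => (a / b : ℝ)

def Kind.lit : (κ : Kind) → ℕ → κ.Val
  | .nat, c => c
  | .real, c => ((c : ℝ) : ℝ)

/-- Expressions of either kind. The loop variable `x` of `big o z x y f` runs over the numbers that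
are smaller than the value of the variable `y`. Numbers `0` and `≠ 0` serve as truth values. -/
inductive Ex : Kind → Type where
  | lit (κ : Kind) (c : ℕ) : Ex κ
  | var (x : Fin 40) : Ex .nat
  | getN (a : ℕ) (i j : Ex .nat) : Ex .nat
  | getR (a : ℕ) (i j : Ex .nat) : Ex .real
  | bin {κ : Kind} (o : Op κ) (e f : Ex κ) : Ex κ
  | ltN (e f : Ex .nat) : Ex .nat
  | ltR (e f : Ex .real) : Ex .nat
  | ite {κ : Kind} (c : Ex .nat) (e f : Ex κ) : Ex κ
  | big {κ : Kind} (o : Op κ) (z : ℕ) (x y : Fin 40) (f : Ex κ) : Ex κ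
  | pow (r : Ex .real) (e : Ex .nat) : Ex .real

/-- Iterated application of an operation. -/
noncomputable def Op.fold {κ : Kind} (o : Op κ) (z : κ.Val) (f : ℕ → κ.Val) : ℕ → κ.Val
  | 0 => z
  | n + 1 => o.app (o.fold z f n) (f n)

open scoped Classical in
/-- The truth value of a proposition. -/
noncomputable def truth (p : Prop) : ℕ := if p then 1 else 0

noncomputable def Ex.eval (nm : ℕ → ℕ → ℕ → ℕ) (rm : ℕ → ℕ → ℕ → ℝ) :
    {κ : Kind} → Ex κ → (Fin 40 → ℕ) → κ.Val
  | κ, .lit _ c, _ => κ.lit c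
  | _, .var x, ν => ν x
  | _, .getN a i j, ν => nm a (i.eval nm rm ν) (j.eval nm rm ν)
  | _, .getR a i j, ν => rm a (i.eval nm rm ν) (j.eval nm rm ν)
  | _, .bin o e f, ν => o.app (e.eval nm rm ν) (f.eval nm rm ν)
  | _, .ltN e f, ν => truth (e.eval nm rm ν < f.eval nm rm ν)
  | _, .ltR e f, ν => truth (e.eval nm rm ν < f.eval nm rm ν)
  | _, .ite c e f, ν => if 0 < (c.eval nm rm ν : ℕ) then e.eval nm rm ν else f.eval nm rm ν
  | κ, .big o z x y f, ν =>
    o.fold (κ.lit z) (fun i => f.eval nm rm (Function.update ν x i)) (ν y)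
  | _, .pow r e, ν => ((r.eval nm rm ν : ℝ) ^ (e.eval nm rm ν : ℕ) : ℝ)

/-! ### Compilation -/

/-- The operation `x := y o z` on variables. -/
def Op.prog : {κ : Kind} → Op κ → (x y z : ℕ) → Prog
  | _, addN, x, y, z => .nset x (.add (.var y) (.var z))
  | _, subN, x, y, z => .nset x (.sub (.var y) (.var z))
  | _, addR, x, y, z => .rset x (.add (.var y) (.var z))
  | _, mulR, x, y, z => .rset x (.mul (.var y) (.var z))
  | _, divR, x, y, z => .rset x (.div (.var y) (.var z))

def Kind.setLit : Kind → (x c : ℕ) → Prog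
  | .nat, x, c => .nset x (.lit c)
  | .real, x, c => .rset x (.lit c)

def Kind.move : Kind → (x y : ℕ) → Prog
  | .nat, x, y => .nset x (.var y)
  | .real, x, y => .rset x (.var y)

/-- The program that computes the value of an expression into the variable `b`, using variables
from `b` on as scratch. -/
def Ex.comp : {κ : Kind} → Ex κ → ℕ → Prog
  | κ, .lit _ c, b => κ.setLit b c
  | _, .var x, b => .nset b (.var x)
  | _, .getN a i j, b => .seq (i.comp b) (.seq (j.comp (b + 1))
      (.nset b (.get a (.var b) (.var (b + 1)))))
  | _, .getR a i j, b => .seq (i.comp b) (.seq (j.comp (b + 1))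
      (.rset b (.get a (.var b) (.var (b + 1)))))
  | _, .bin o e f, b => .seq (e.comp b) (.seq (f.comp (b + 1)) (o.prog b b (b + 1)))
  | _, .ltN e f, b => .seq (e.comp b) (.seq (f.comp (b + 1))
      (.ite (.nlt (.var b) (.var (b + 1))) (.nset b (.lit 1)) (.nset b (.lit 0))))
  | _, .ltR e f, b => .seq (e.comp b) (.seq (f.comp (b + 1))
      (.ite (.rlt (.var b) (.var (b + 1))) (.nset b (.lit 1)) (.nset b (.lit 0))))
  | _, .ite c e f, b => .seq (c.comp b) (.ite (.nlt (.lit 0) (.var b)) (e.comp b) (f.comp b))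
  -- The loop variable `x` itself is the counter. Its old value is kept in `b`, the bound in `b +
  -- 1`, and `b + 2` accumulates the result.
  | κ, .big o z x y f, b =>
    .seq (.nset b (.var x)) (.seq (.nset (b + 1) (.var y)) (.seq (κ.setLit (b + 2) z)
      (.seq (.nset x (.lit 0))
        (.seq (.loop (.nlt (.var x) (.var (b + 1)))
          (.seq (f.comp (b + 3)) (.seq (o.prog (b + 2) (b + 2) (b + 3))
            (.nset x (.add (.var x) (.lit 1))))))
          (.seq (.nset x (.var b)) (κ.move b (b + 2)))))))
  -- Natural numbers cannot be halved, so the exponent is consumed from its leading bit. The natural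
  -- variable `b + 2` is doubled while its double does not exceed the remaining exponent in `b + 1`,
  -- and the real variable `b + 2` is squared along with it. Then the power is multiplied into the
  -- real variable `b + 1` and its exponent subtracted.
  | _, .pow r e, b =>
    .seq (r.comp b) (.seq (e.comp (b + 1)) (.seq (.rset (b + 1) (.lit 1))
      (.seq (.loop (.nlt (.lit 0) (.var (b + 1)))
        (.seq (.nset (b + 2) (.lit 1)) (.seq (.rset (b + 2) (.var b))
          (.seq (.loop (.nlt (.add (.var (b + 2)) (.var (b + 2))) (.add (.var (b + 1)) (.lit 1)))
            (.seq (.nset (b + 2) (.add (.var (b + 2)) (.var (b + 2))))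
              (.rset (b + 2) (.mul (.var (b + 2)) (.var (b + 2))))))
            (.seq (.rset (b + 1) (.mul (.var (b + 1)) (.var (b + 2))))
              (.nset (b + 1) (.sub (.var (b + 1)) (.var (b + 2)))))))))
        (.rset b (.var (b + 1))))))

/-! ### What compiled code leaves unchanged and what it computes. -/

/-- The content of a variable of either kind. -/
def State.out (s : State) : (κ : Kind) → ℕ → κ.Val
  | .nat, x => s.nvar x
  | .real, x => s.rvar x

/-- `s'` differs from `s` at most in variables from `b` on. -/
structure Frame (b : ℕ) (s s' : State) : Prop where
  nmem : s'.nmem = s.nmem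
  rmem : s'.rmem = s.rmem
  nvar : ∀ x < b, s'.nvar x = s.nvar x
  rvar : ∀ x < b, s'.rvar x = s.rvar x

theorem Frame.trans {b : ℕ} {s s' s'' : State} (h : Frame b s s') (h' : Frame b s' s'') :
    Frame b s s'' :=
  ⟨h'.nmem.trans h.nmem, h'.rmem.trans h.rmem, fun x hx => (h'.nvar x hx).trans (h.nvar x hx),
    fun x hx => (h'.rvar x hx).trans (h.rvar x hx)⟩

theorem Frame.mono {b b' : ℕ} {s s' : State} (h : Frame b' s s') (hb : b ≤ b') : Frame b s s' :=
  ⟨h.nmem, h.rmem, fun x hx => h.nvar x (hx.trans_le hb), fun x hx => h.rvar x (hx.trans_le hb)⟩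

theorem Frame.out {b : ℕ} {s s' : State} (h : Frame b s s') (κ : Kind) {x : ℕ} (hx : x < b) :
    s'.out κ x = s.out κ x := by
  cases κ
  · exact h.nvar x hx
  · exact h.rvar x hx

/-- The values of the named variables. -/
def State.env (s : State) : Fin 40 → ℕ := fun x => s.nvar x

theorem Frame.env {b : ℕ} (hb : 40 ≤ b) {s s' : State} (h : Frame b s s') : s'.env = s.env :=
  funext fun x => h.nvar x (x.2.trans_le hb)

/-- The state carries the integer data of the input, and the named variables are small. -/
structure Ok {n k : ℕ} (I : MarkedSPN n k) (s : State) : Prop where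
  nmem : s.nmem = I.initState.nmem
  -- The factor `2` makes room for `k + k`, the number of half-edges.
  env : ∀ x, s.env x ≤ 2 * I.size

theorem Frame.ok {b : ℕ} (hb : 40 ≤ b) {n k : ℕ} {I : MarkedSPN n k} {s s' : State}
    (h : Frame b s s') (hs : Ok I s) : Ok I s' :=
  ⟨h.nmem.trans hs.nmem, by rw [h.env hb]; exact hs.env⟩

/-- The specification of a compiled expression. -/
def Post {κ : Kind} (e : Ex κ) (b : ℕ) (s s' : State) : Prop :=
  Frame b s s' ∧ s'.out κ b = e.eval s.nmem s.rmem s.env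

/-- The bound `T` depends on the expression and on `b`, but neither on the input nor on the real
memory. Hence it survives being repeated in a loop of polynomial length. -/
def Compiles {κ : Kind} (e : Ex κ) : Prop :=
  ∀ b, 40 ≤ b → ∃ T : Polynomial ℕ, ∀ (n k : ℕ) (I : MarkedSPN n k) (s : State), Ok I s →
    Run (e.comp b) s (T.eval I.size) (Post e b s)

theorem frame_nset {b x v : ℕ} (hx : b ≤ x) (s : State) :
    Frame b s { s with nvar := Function.update s.nvar x v } :=
  ⟨rfl, rfl, fun y hy => Function.update_of_ne (by omega) _ _, fun _ _ => rfl⟩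

theorem frame_rset {b x : ℕ} {v : ℝ} (hx : b ≤ x) (s : State) :
    Frame b s { s with rvar := Function.update s.rvar x v } :=
  ⟨rfl, rfl, fun _ _ => rfl, fun y hy => Function.update_of_ne (by omega) _ _⟩

theorem Op.run_prog {κ : Kind} (o : Op κ) (x y z : ℕ) (s : State) :
    Run (o.prog x y z) s 4 (fun s' => Frame x s s' ∧
      s'.out κ x = o.app (s.out κ y) (s.out κ z) ∧ ∀ w, w ≠ x → s'.nvar w = s.nvar w) := by
  cases o
  · exact Run.nset ⟨frame_nset le_rfl s, Function.update_self _ _ _,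
      fun w hw => Function.update_of_ne hw _ _⟩
  · exact Run.nset ⟨frame_nset le_rfl s, Function.update_self _ _ _,
      fun w hw => Function.update_of_ne hw _ _⟩
  all_goals exact Run.rset ⟨frame_rset le_rfl s, Function.update_self _ _ _, fun w hw => rfl⟩

theorem Kind.run_setLit (κ : Kind) (x c : ℕ) (s : State) :
    Run (κ.setLit x c) s 2 (fun s' => Frame x s s' ∧ s'.out κ x = κ.lit c) := by
  cases κ
  · exact Run.nset ⟨frame_nset le_rfl s, Function.update_self _ _ _⟩
  · exact Run.rset ⟨frame_rset le_rfl s, Function.update_self _ _ _⟩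

theorem Kind.run_move (κ : Kind) (x y : ℕ) (s : State) :
    Run (κ.move x y) s 2 (fun s' => Frame x s s' ∧ s'.out κ x = s.out κ y) := by
  cases κ
  · exact Run.nset ⟨frame_nset le_rfl s, Function.update_self _ _ _⟩
  · exact Run.rset ⟨frame_rset le_rfl s, Function.update_self _ _ _⟩

/-- Running two compiled expressions one after the other. -/
theorem Compiles.pair {κ μ : Kind} {e : Ex κ} {f : Ex μ} (he : Compiles e) (hf : Compiles f)
    (b : ℕ) (hb : 40 ≤ b) : ∃ T : Polynomial ℕ, ∀ (n k : ℕ) (I : MarkedSPN n k) (s : State),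
      Ok I s → ∀ (d : Prog) (D : ℕ) (Q : State → Prop),
        (∀ s', Frame b s s' → s'.out κ b = e.eval s.nmem s.rmem s.env →
          s'.out μ (b + 1) = f.eval s.nmem s.rmem s.env → Run d s' D Q) →
        Run (.seq (e.comp b) (.seq (f.comp (b + 1)) d)) s (T.eval I.size + D) Q := by
  obtain ⟨T, hT⟩ := he b hb
  obtain ⟨T', hT'⟩ := hf (b + 1) (by omega)
  refine ⟨T + T', fun n k I s hs d D Q h => ?_⟩
  rw [Polynomial.eval_add, Nat.add_assoc]
  refine (hT n k I s hs).seq fun s1 h1 => ?_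
  refine (hT' n k I s1 (h1.1.ok hb hs)).seq fun s2 h2 => ?_
  have hfr := h1.1.trans (h2.1.mono (Nat.le_succ b))
  refine h s2 hfr ?_ ?_
  · rw [h2.1.out κ (Nat.lt_succ_self b), h1.2]
  · rw [h2.2, h1.1.nmem, h1.1.rmem, h1.1.env hb]

theorem compiles_lit (κ : Kind) (c : ℕ) : Compiles (.lit κ c) := fun b hb =>
  ⟨2, fun n k I s hs => (κ.run_setLit b c s).mono (by simp) fun s' h => ⟨h.1, h.2⟩⟩

theorem compiles_var (x : Fin 40) : Compiles (.var x) := fun b hb =>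
  ⟨2, fun n k I s hs => by
    refine (Run.nset ?_).mono (by simp [NExpr.cost]) fun _ h => h
    exact ⟨frame_nset le_rfl s, Function.update_self _ _ _⟩⟩

theorem Compiles.getN {i j : Ex .nat} (hi : Compiles i) (hj : Compiles j) (a : ℕ) :
    Compiles (.getN a i j) := fun b hb => by
  obtain ⟨T, hT⟩ := hi.pair hj b hb
  refine ⟨T + 4, fun n k I s hs => ?_⟩
  refine (hT n k I s hs _ 4 _ fun s' h1 h2 h3 => Run.nset ?_).mono (by simp) fun _ h => h
  refine ⟨h1.trans (frame_nset le_rfl _), (Function.update_self _ _ _).trans ?_⟩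
  change s'.nmem a (s'.out .nat b) (s'.out .nat (b + 1)) = _
  rw [h2, h3, h1.nmem]
  rfl

theorem Compiles.getR {i j : Ex .nat} (hi : Compiles i) (hj : Compiles j) (a : ℕ) :
    Compiles (.getR a i j) := fun b hb => by
  obtain ⟨T, hT⟩ := hi.pair hj b hb
  refine ⟨T + 4, fun n k I s hs => ?_⟩
  refine (hT n k I s hs _ 4 _ fun s' h1 h2 h3 => Run.rset ?_).mono (by simp) fun _ h => h
  refine ⟨h1.trans (frame_rset le_rfl _), (Function.update_self _ _ _).trans ?_⟩
  change s'.rmem a (s'.out .nat b) (s'.out .nat (b + 1)) = _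
  rw [h2, h3, h1.rmem]
  rfl

theorem Compiles.bin {κ : Kind} {e f : Ex κ} (he : Compiles e) (hf : Compiles f) (o : Op κ) :
    Compiles (.bin o e f) := fun b hb => by
  obtain ⟨T, hT⟩ := he.pair hf b hb
  refine ⟨T + 4, fun n k I s hs => ?_⟩
  refine (hT n k I s hs _ 4 _ fun s' h1 h2 h3 => (o.run_prog b b (b + 1) s').mono le_rfl
    fun s'' h => ⟨h1.trans h.1, ?_⟩).mono (by simp) fun _ h => h
  rw [h.2.1, h2, h3]
  rfl

theorem Compiles.ltN {e f : Ex .nat} (he : Compiles e) (hf : Compiles f) :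
    Compiles (.ltN e f) := fun b hb => by
  obtain ⟨T, hT⟩ := he.pair hf b hb
  refine ⟨T + 5, fun n k I s hs => ?_⟩
  refine (hT n k I s hs _ 5 _ fun s' h1 h2 h3 => Run.ite (T := 2) ?_ ?_).mono (by simp) fun _ h => h
  · intro hlt
    refine Run.nset ⟨h1.trans (frame_nset le_rfl _), (Function.update_self _ _ _).trans ?_⟩
    change s'.out .nat b < s'.out .nat (b + 1) at hlt
    rw [h2, h3] at hlt
    exact (if_pos hlt).symm
  · intro hlt
    refine Run.nset ⟨h1.trans (frame_nset le_rfl _), (Function.update_self _ _ _).trans ?_⟩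
    change ¬ s'.out .nat b < s'.out .nat (b + 1) at hlt
    rw [h2, h3] at hlt
    exact (if_neg hlt).symm

theorem Compiles.ltR {e f : Ex .real} (he : Compiles e) (hf : Compiles f) :
    Compiles (.ltR e f) := fun b hb => by
  obtain ⟨T, hT⟩ := he.pair hf b hb
  refine ⟨T + 5, fun n k I s hs => ?_⟩
  refine (hT n k I s hs _ 5 _ fun s' h1 h2 h3 => Run.ite (T := 2) ?_ ?_).mono (by simp) fun _ h => h
  · intro hlt
    refine Run.nset ⟨h1.trans (frame_nset le_rfl _), (Function.update_self _ _ _).trans ?_⟩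
    change s'.out .real b < s'.out .real (b + 1) at hlt
    rw [h2, h3] at hlt
    exact (if_pos hlt).symm
  · intro hlt
    refine Run.nset ⟨h1.trans (frame_nset le_rfl _), (Function.update_self _ _ _).trans ?_⟩
    change ¬ s'.out .real b < s'.out .real (b + 1) at hlt
    rw [h2, h3] at hlt
    exact (if_neg hlt).symm

theorem Compiles.ite {κ : Kind} {c : Ex .nat} {e f : Ex κ} (hc : Compiles c) (he : Compiles e)
    (hf : Compiles f) : Compiles (.ite c e f) := fun b hb => by
  obtain ⟨T, hT⟩ := hc b hb
  obtain ⟨T1, hT1⟩ := he b hb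
  obtain ⟨T2, hT2⟩ := hf b hb
  refine ⟨T + (3 + (T1 + T2)), fun n k I s hs => ?_⟩
  rw [Polynomial.eval_add]
  refine (hT n k I s hs).seq fun s1 h1 => ?_
  have ok1 := h1.1.ok hb hs
  have hv : s1.nvar b = c.eval s.nmem s.rmem s.env := h1.2
  refine (Run.ite (T := T1.eval I.size + T2.eval I.size) (fun h => ?_) (fun h => ?_)).mono
    (by simp [Test.cost, NExpr.cost]) fun _ h => h
  · change 0 < s1.nvar b at h
    refine (hT1 n k I s1 ok1).mono (Nat.le_add_right _ _) fun s2 h2 => ⟨h1.1.trans h2.1, ?_⟩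
    rw [h2.2, h1.1.nmem, h1.1.rmem, h1.1.env hb]
    rw [hv] at h
    exact (if_pos h).symm
  · change ¬ 0 < s1.nvar b at h
    refine (hT2 n k I s1 ok1).mono (Nat.le_add_left _ _) fun s2 h2 => ⟨h1.1.trans h2.1, ?_⟩
    rw [h2.2, h1.1.nmem, h1.1.rmem, h1.1.env hb]
    rw [hv] at h
    exact (if_neg h).symm

/-- The variable `y` is bounded by `2 * I.size`, so there are linearly many rounds, each with the
polynomial bound for `f`. -/
theorem Compiles.big {κ : Kind} {f : Ex κ} (hf : Compiles f) (o : Op κ) (z : ℕ) (x y : Fin 40) :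
    Compiles (.big o z x y f) := fun b hb => by
  obtain ⟨T, hT⟩ := hf (b + 3) (by omega)
  refine ⟨2 + (2 + (2 + (2 + ((2 * Polynomial.X) * (3 + (T + 8)) + 3 + (2 + 2))))),
    fun n k I s hs => ?_⟩
  simp only [Polynomial.eval_add, Polynomial.eval_mul, Polynomial.eval_X, Polynomial.eval_ofNat]
  have hx : (x : ℕ) < b := x.2.trans_le hb
  have hy : (y : ℕ) < b := y.2.trans_le hb
  refine (Run.nset (Q := fun s' => Frame b s s' ∧ s'.nvar b = s.nvar x)
    ⟨frame_nset le_rfl s, Function.update_self _ _ _⟩).seq fun s1 ⟨f1, v1⟩ => ?_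
  refine (Run.nset (Q := fun s' => Frame (b + 1) s1 s' ∧ s'.nvar (b + 1) = s1.nvar y)
    ⟨frame_nset le_rfl s1, Function.update_self _ _ _⟩).seq fun s2 ⟨f2, v2⟩ => ?_
  refine (κ.run_setLit (b + 2) z s2).seq fun s3 ⟨f3, v3⟩ => ?_
  have f03 := (f1.trans (f2.mono (by omega))).trans (f3.mono (by omega))
  have hb3 : s3.nvar b = s.nvar x := by
    rw [f3.nvar b (by omega), f2.nvar b (by omega), v1]
  have hb3' : s3.nvar (b + 1) = s.nvar y := by
    rw [f3.nvar (b + 1) (by omega), v2, f1.nvar y hy]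
  let g : ℕ → κ.Val := fun i => f.eval s.nmem s.rmem (Function.update s.env x i)
  -- The counter `x` lies below `b`, so the frame condition holds only after its old value has been
  -- put back. The index `r` is the number of remaining rounds.
  let Inv : ℕ → State → Prop := fun r s' =>
    Frame b s { s' with nvar := Function.update s'.nvar x (s.nvar x) } ∧
    s'.nvar b = s.nvar x ∧ s'.nvar (b + 1) = s.nvar y ∧ s'.nvar x + r = s.nvar y ∧
    s'.out κ (b + 2) = o.fold (κ.lit z) g (s'.nvar x)
  have hupd : ∀ (s' : State), Frame b s { s' with nvar := Function.update s'.nvar x (s.nvar x) } →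
      s'.env = Function.update s.env x (s'.nvar x) := by
    intro s' h
    funext w
    by_cases hw : w = x
    · subst hw; simp [State.env]
    · rw [Function.update_of_ne hw]
      have := h.nvar w (w.2.trans_le hb)
      change Function.update s'.nvar x (s.nvar x) w = _ at this
      rwa [Function.update_of_ne (fun h => hw (Fin.ext h))] at this
  have step : ∀ r s', Inv r s' → (Test.nlt (.var x) (.var (b + 1))).Holds s' →
      Run (.seq (f.comp (b + 3)) (.seq (o.prog (b + 2) (b + 2) (b + 3))
            (.nset x (.add (.var x) (.lit 1))))) s' (T.eval I.size + 8)
        (fun s'' => ∃ j < r, Inv j s'') := by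
    rintro r s' ⟨i1, i2, i3, i4, i5⟩ hlt
    change s'.nvar x < s'.nvar (b + 1) at hlt
    have henv := hupd s' i1
    have ok' : Ok I s' := by
      refine ⟨i1.nmem.trans hs.nmem, fun w => ?_⟩
      rw [henv]
      by_cases hw : w = x
      · subst hw
        rw [Function.update_self]
        have := hs.env y
        simp only [State.env] at this
        omega
      · rw [Function.update_of_ne hw]
        exact hs.env w
    refine (hT n k I s' ok').seq (T' := 4 + 4) fun s1' h1 => ?_
    refine (o.run_prog (b + 2) (b + 2) (b + 3) s1').seq fun s2' ⟨g1, g2, _⟩ => ?_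
    have g02 := (h1.1.mono (show b + 2 ≤ b + 3 by omega)).trans g1
    have ex : s2'.nvar x = s'.nvar x := g02.nvar x (by omega)
    refine (Run.nset ?_).mono (by simp [NExpr.cost]) fun _ h => h
    refine ⟨r - 1, by omega, ?_, ?_, ?_, ?_, ?_⟩
    · refine ⟨g02.nmem.trans i1.nmem, g02.rmem.trans i1.rmem, fun w hw => ?_, fun w hw => ?_⟩
      · have := i1.nvar w hw
        by_cases hwx : w = x
        · subst hwx; simp
        · simp only [Function.update_of_ne hwx] at this ⊢
          rw [g02.nvar w (by omega), this]
      · exact (g02.rvar w (by omega)).trans (i1.rvar w hw)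
    · change Function.update s2'.nvar x _ b = _
      rw [Function.update_of_ne (by omega), g02.nvar b (by omega), i2]
    · change Function.update s2'.nvar x _ (b + 1) = _
      rw [Function.update_of_ne (by omega), g02.nvar (b + 1) (by omega), i3]
    · change Function.update s2'.nvar x (s2'.nvar x + 1) x + _ = _
      rw [Function.update_self, ex]
      omega
    · have e1 : ({ s2' with nvar := Function.update s2'.nvar x (s2'.nvar x + 1) } : State).out κ
          (b + 2) = s2'.out κ (b + 2) := by
        cases κ
        · exact Function.update_of_ne (by omega) _ _
        · rfl
      change ({ s2' with nvar := Function.update s2'.nvar x (s2'.nvar x + 1) } : State).out κ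
          (b + 2) = o.fold (κ.lit z) g (Function.update s2'.nvar x (s2'.nvar x + 1) x)
      rw [e1, Function.update_self, ex, g2, h1.1.out κ (by omega), h1.2, i5, henv, i1.nmem, i1.rmem]
      rfl
  have hsz := hs.env y
  refine (Run.nset (Q := Inv (s.nvar y)) ?_).seq fun s4 h4 => ?_
  · refine ⟨⟨f03.nmem, f03.rmem, fun w hw => ?_, f03.rvar⟩, ?_, ?_, ?_, ?_⟩
    · by_cases hwx : w = x
      · subst hwx; simp
      · simp [Function.update_of_ne hwx, f03.nvar w hw]
    · change Function.update s3.nvar x _ b = _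
      rw [Function.update_of_ne (by omega), hb3]
    · change Function.update s3.nvar x _ (b + 1) = _
      rw [Function.update_of_ne (by omega), hb3']
    · change Function.update s3.nvar x 0 x + _ = _
      simp
    · have e1 : ({ s3 with nvar := Function.update s3.nvar x 0 } : State).out κ (b + 2)
          = s3.out κ (b + 2) := by
        cases κ
        · exact Function.update_of_ne (by omega) _ _
        · rfl
      change ({ s3 with nvar := Function.update s3.nvar x 0 } : State).out κ (b + 2)
        = o.fold (κ.lit z) g (Function.update s3.nvar x 0 x)
      rw [e1, v3, Function.update_self]
      rfl
  refine Run.seq (T' := 2 + 2) ((Run.loop step _ s4 h4).mono ?_ fun _ h => h)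
    fun s5 ⟨⟨r, hr, i1, i2, i3, i4, i5⟩, hlt⟩ => ?_
  · simp only [Test.cost, NExpr.cost]
    exact Nat.add_le_add_right (Nat.mul_le_mul_right _ hsz) _
  change ¬ s5.nvar x < s5.nvar (b + 1) at hlt
  have hend : s5.nvar x = s.nvar y := by omega
  refine (Run.nset (Q := fun s' => Frame b s s' ∧ s'.out κ (b + 2) = s5.out κ (b + 2))
    ⟨?_, ?_⟩).seq fun s6 ⟨f6, v6⟩ => ?_
  · change Frame b s { s5 with nvar := Function.update s5.nvar x (s5.nvar b) }
    rw [i2]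
    exact i1
  · cases κ
    · exact Function.update_of_ne (by omega) _ _
    · rfl
  refine (κ.run_move b (b + 2) s6).mono le_rfl fun s7 ⟨f7, v7⟩ => ⟨f6.trans f7, ?_⟩
  rw [v7, v6, i5, hend]
  rfl

/-! ### Bit lengths of natural values, and powers with large exponents. -/

/-- A value is at most `m` bits long; no condition on real values. -/
def Kind.Short : (κ : Kind) → κ.Val → ℕ → Prop
  | .nat, v, m => v < 2 ^ m
  | .real, _, _ => True

theorem Kind.Short.mono {κ : Kind} {v : κ.Val} {m m' : ℕ} (h : κ.Short v m) (hm : m ≤ m') :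
    κ.Short v m' := by
  cases κ
  · exact lt_of_lt_of_le h (Nat.pow_le_pow_right two_pos hm)
  · trivial

theorem Op.short_app {κ : Kind} (o : Op κ) {a b : κ.Val} {m : ℕ} (ha : κ.Short a m)
    (hb : κ.Short b m) : κ.Short (o.app a b) (m + 1) := by
  cases o
  · have := Nat.add_lt_add (show Nat.lt a (2 ^ m) from ha) (show Nat.lt b (2 ^ m) from hb)
    rwa [← mul_two, ← pow_succ] at this
  · exact ((Nat.sub_le (show ℕ from a) b).trans_lt ha).trans_le
      (Nat.pow_le_pow_right two_pos (Nat.le_succ m))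
  all_goals trivial

theorem Op.short_fold {κ : Kind} (o : Op κ) {z : κ.Val} {f : ℕ → κ.Val} {m N : ℕ}
    (hz : κ.Short z m) (hf : ∀ i < N, κ.Short (f i) m) : κ.Short (o.fold z f N) (m + N) := by
  induction N with
  | zero => exact hz
  | succ N ih =>
    exact o.short_app (ih fun i hi => hf i (by omega)) ((hf N (by omega)).mono (Nat.le_add_right m N))

theorem initState_nmem_lt {n k : ℕ} (I : MarkedSPN n k) (a i j : ℕ) :
    I.initState.nmem a i j < 2 ^ I.size := by
  have key : ∀ v : ℕ, v.size ≤ I.size → v < 2 ^ I.size := fun v hv =>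
    (Nat.lt_size_self v).trans_le (Nat.pow_le_pow_right two_pos hv)
  have hzero : (0 : ℕ) < 2 ^ I.size := by positivity
  have hentry : ∀ (t : Fin k) (p : Fin n), (I.net.pre t p).size + 1 + ((I.net.post t p).size + 1) ≤
      ∑ t, ∑ p, ((I.net.pre t p).size + 1 + ((I.net.post t p).size + 1)) := fun t p =>
    (Finset.single_le_sum (f := fun p => (I.net.pre t p).size + 1 + ((I.net.post t p).size + 1))
      (fun _ _ => Nat.zero_le _) (Finset.mem_univ p)).trans
    (Finset.single_le_sum
      (f := fun t => ∑ p, ((I.net.pre t p).size + 1 + ((I.net.post t p).size + 1)))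
      (fun _ _ => Nat.zero_le _) (Finset.mem_univ t))
  have hinit : ∀ p : Fin n, (I.init p).size + 1 ≤ ∑ p, ((I.init p).size + 1) := fun p =>
    Finset.single_le_sum (f := fun p => (I.init p).size + 1) (fun _ _ => Nat.zero_le _)
      (Finset.mem_univ p)
  unfold MarkedSPN.initState
  dsimp only
  split_ifs
  · rename_i h
    apply key
    have := hentry ⟨i, h.1⟩ ⟨j, h.2⟩
    simp only [MarkedSPN.size]; omega
  · exact hzero
  · rename_i h
    apply key
    have := hentry ⟨i, h.1⟩ ⟨j, h.2⟩
    simp only [MarkedSPN.size]; omega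
  · exact hzero
  · rename_i h
    apply key
    have := hinit ⟨j, h⟩
    simp only [MarkedSPN.size]; omega
  · exact hzero
  · exact hzero

theorem truth_lt (p : Prop) : truth p < 2 ^ 1 := by
  unfold truth
  split_ifs <;> norm_num

/-- The values of expressions of natural kind have polynomially many bits. -/
theorem Ex.short {κ : Kind} (e : Ex κ) : ∃ p : Polynomial ℕ, ∀ (n k : ℕ) (I : MarkedSPN n k)
    (rm : ℕ → ℕ → ℕ → ℝ) (ν : Fin 40 → ℕ), (∀ x, ν x ≤ 2 * I.size) →
      κ.Short (e.eval I.initState.nmem rm ν) (p.eval I.size) := by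
  induction e with
  | lit κ c =>
    refine ⟨Polynomial.C c, fun n k I rm ν hν => ?_⟩
    cases κ
    · rw [Polynomial.eval_C]; exact Nat.lt_two_pow_self
    · trivial
  | var x =>
    refine ⟨2 * Polynomial.X, fun n k I rm ν hν => ?_⟩
    simp only [Polynomial.eval_mul, Polynomial.eval_X, Polynomial.eval_ofNat]
    exact (hν x).trans_lt Nat.lt_two_pow_self
  | getN a i j _ _ =>
    refine ⟨Polynomial.X, fun n k I rm ν hν => ?_⟩
    rw [Polynomial.eval_X]
    exact initState_nmem_lt I _ _ _
  | getR a i j _ _ => exact ⟨0, fun _ _ _ _ _ _ => trivial⟩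
  | bin o e f he hf =>
    obtain ⟨p, hp⟩ := he
    obtain ⟨q, hq⟩ := hf
    refine ⟨p + q + 1, fun n k I rm ν hν => ?_⟩
    simp only [Polynomial.eval_add, Polynomial.eval_one]
    exact o.short_app ((hp n k I rm ν hν).mono (by omega)) ((hq n k I rm ν hν).mono (by omega))
  | ltN e f _ _ =>
    exact ⟨1, fun _ _ _ _ _ _ => by rw [Polynomial.eval_one]; exact truth_lt _⟩
  | ltR e f _ _ =>
    exact ⟨1, fun _ _ _ _ _ _ => by rw [Polynomial.eval_one]; exact truth_lt _⟩
  | ite c e f _ he hf =>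
    obtain ⟨p, hp⟩ := he
    obtain ⟨q, hq⟩ := hf
    refine ⟨p + q, fun n k I rm ν hν => ?_⟩
    rw [Polynomial.eval_add, Ex.eval]
    split_ifs
    · exact (hp n k I rm ν hν).mono (by omega)
    · exact (hq n k I rm ν hν).mono (by omega)
  | @big κ o z x y f hf =>
    obtain ⟨p, hp⟩ := hf
    -- Each of the at most `2 * I.size` operations lengthens the accumulator by at most one bit.
    refine ⟨Polynomial.C z + p + 2 * Polynomial.X, fun n k I rm ν hν => ?_⟩
    simp only [Polynomial.eval_add, Polynomial.eval_mul, Polynomial.eval_X, Polynomial.eval_ofNat,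
      Polynomial.eval_C]
    refine (o.short_fold (m := z + p.eval I.size) (N := ν y) ?_ ?_).mono
      (Nat.add_le_add_left (hν y) _)
    · cases κ
      · exact (Nat.lt_two_pow_self (n := z)).trans_le (Nat.pow_le_pow_right two_pos (by omega))
      · trivial
    · intro i hi
      refine (hp n k I rm _ fun w => ?_).mono (by omega)
      by_cases hw : w = x
      · subst hw
        rw [Function.update_self]
        have := hν y
        omega
      · rw [Function.update_of_ne hw]
        exact hν w
  | pow r e _ _ => exact ⟨0, fun _ _ _ _ _ _ => trivial⟩

/-- The exponent is below `2 ^ m` with `m` polynomial by `Ex.short`. Every outer round removes the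
leading bit and every inner loop has at most `m` doublings. Squaring a real number costs one step,
however large it is. -/
theorem Compiles.pow {r : Ex .real} {e : Ex .nat} (hr : Compiles r) (he : Compiles e) :
    Compiles (.pow r e) := fun b hb => by
  obtain ⟨T, hT⟩ := hr.pair he b hb
  obtain ⟨p, hp⟩ := e.short
  refine ⟨T + (2 + (p * (3 + (2 + (2 + (p * (7 + 8) + 7 + (4 + 4))))) + 3 + 2)),
    fun n k I s hs => ?_⟩
  simp only [Polynomial.eval_add, Polynomial.eval_mul, Polynomial.eval_ofNat]
  set m := p.eval I.size with hm
  have hshort := hp n k I s.rmem s.env hs.env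
  rw [← hs.nmem] at hshort
  refine hT n k I s hs _ _ _ fun s0 f0 v0 w0 => ?_
  set x : ℝ := r.eval s.nmem s.rmem s.env with hx
  set N : ℕ := e.eval s.nmem s.rmem s.env with hN
  change s0.rvar b = x at v0
  change s0.nvar (b + 1) = N at w0
  have hNm : N < 2 ^ m := hshort
  let Inv : ℕ → State → Prop := fun i s' =>
    Frame b s s' ∧ s'.rvar b = x ∧ s'.nvar (b + 1) < 2 ^ i ∧ i ≤ m ∧
      s'.rvar (b + 1) * x ^ s'.nvar (b + 1) = x ^ N
  -- While the remaining exponent is below `2 ^ i`, the doubled number is `2 ^ (i - 1 - j)` with `j`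
  -- doublings still possible.
  let Inv' : ℕ → State → ℕ → State → Prop := fun i s1 j s' =>
    Frame b s s' ∧ s'.rvar b = x ∧ s'.nvar (b + 1) = s1.nvar (b + 1) ∧
      s'.rvar (b + 1) = s1.rvar (b + 1) ∧ j < i ∧ s'.nvar (b + 2) = 2 ^ (i - 1 - j) ∧
      s'.nvar (b + 2) ≤ s'.nvar (b + 1) ∧ s'.rvar (b + 2) = x ^ s'.nvar (b + 2)
  have step' : ∀ i s1, Inv i s1 → ∀ j s', Inv' i s1 j s' →
      (Test.nlt (.add (.var (b + 2)) (.var (b + 2))) (.add (.var (b + 1)) (.lit 1))).Holds s' →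
      Run (.seq (.nset (b + 2) (.add (.var (b + 2)) (.var (b + 2))))
              (.rset (b + 2) (.mul (.var (b + 2)) (.var (b + 2))))) s' 8
        (fun s'' => ∃ l < j, Inv' i s1 l s'') := by
    rintro i s1 ⟨i1, i2, i3, i4, i5⟩ j s' ⟨h1, h2, h3, h4, h5, h6, h7, h8⟩ hlt
    change s'.nvar (b + 2) + s'.nvar (b + 2) < s'.nvar (b + 1) + 1 at hlt
    refine Run.seq (T := 4) (T' := 4) (Q := fun s'' => s'' = { s' with
      nvar := Function.update s'.nvar (b + 2) (s'.nvar (b + 2) + s'.nvar (b + 2)) })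
      (Run.nset rfl) ?_
    rintro _ rfl
    refine Run.rset ?_
    have hj : 0 < j := by
      rcases Nat.eq_zero_or_pos j with rfl | hj
      · exfalso
        rw [h3] at hlt
        have e2 : 2 ^ (i - 1 - 0) + 2 ^ (i - 1 - 0) = 2 ^ i := by
          rw [Nat.sub_zero, ← two_mul, ← pow_succ', Nat.sub_add_cancel (by omega)]
        omega
      · exact hj
    refine ⟨j - 1, by omega, h1.trans ((frame_nset (by omega) _).trans (frame_rset (by omega) _)),
      ?_, ?_, ?_, by omega, ?_, ?_, ?_⟩
    · exact (Function.update_of_ne (by omega) _ _).trans h2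
    · exact (Function.update_of_ne (by omega) _ _).trans h3
    · exact (Function.update_of_ne (by omega) _ _).trans h4
    · refine (Function.update_self _ _ _).trans ?_
      rw [h6, ← two_mul, ← pow_succ']
      congr 1
      omega
    · change Function.update s'.nvar (b + 2) _ (b + 2) ≤ Function.update s'.nvar (b + 2) _ (b + 1)
      rw [Function.update_self, Function.update_of_ne (by omega)]
      omega
    · change Function.update s'.rvar (b + 2) _ (b + 2)
        = x ^ (Function.update s'.nvar (b + 2) _ (b + 2))
      rw [Function.update_self, Function.update_self]
      change s'.rvar (b + 2) * s'.rvar (b + 2) = _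
      rw [h8, pow_add]
  have step : ∀ i s1, Inv i s1 → (Test.nlt (.lit 0) (.var (b + 1))).Holds s1 →
      Run (.seq (.nset (b + 2) (.lit 1)) (.seq (.rset (b + 2) (.var b))
          (.seq (.loop (.nlt (.add (.var (b + 2)) (.var (b + 2))) (.add (.var (b + 1)) (.lit 1)))
            (.seq (.nset (b + 2) (.add (.var (b + 2)) (.var (b + 2))))
              (.rset (b + 2) (.mul (.var (b + 2)) (.var (b + 2))))))
            (.seq (.rset (b + 1) (.mul (.var (b + 1)) (.var (b + 2))))
              (.nset (b + 1) (.sub (.var (b + 1)) (.var (b + 2)))))))) s1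
        (2 + (2 + (m * (7 + 8) + 7 + (4 + 4)))) (fun s' => ∃ j < i, Inv j s') := by
    rintro i s1 hI hlt
    have ⟨i1, i2, i3, i4, i5⟩ := hI
    change 0 < s1.nvar (b + 1) at hlt
    have hi : 0 < i := by
      rcases Nat.eq_zero_or_pos i with rfl | hi
      · simp at i3; omega
      · exact hi
    refine Run.seq (T := 2) (Q := fun s'' => s'' = { s1 with
      nvar := Function.update s1.nvar (b + 2) 1 }) (Run.nset rfl) ?_
    rintro _ rfl
    refine Run.seq (T := 2) (Q := fun s'' => s'' = { s1 with
      nvar := Function.update s1.nvar (b + 2) 1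
      rvar := Function.update s1.rvar (b + 2) (s1.rvar b) }) (Run.rset rfl) ?_
    rintro _ rfl
    refine Run.seq (T' := 4 + 4) ((Run.loop (step' i s1 hI) (i - 1) _ ?_).mono ?_ fun _ h => h) ?_
    · refine ⟨i1.trans ((frame_nset (by omega) _).trans (frame_rset (by omega) _)),
        (Function.update_of_ne (by omega) _ _).trans i2, Function.update_of_ne (by omega) _ _,
        Function.update_of_ne (by omega) _ _, by omega, ?_, ?_, ?_⟩
      · simp
      · simp; omega
      · simp [i2]
    · simp only [Test.cost, NExpr.cost]
      exact Nat.add_le_add_right (Nat.mul_le_mul_right _ (by omega)) _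
    rintro s2 ⟨⟨j, hj, h1, h2, h3, h4, h5, h6, h7, h8⟩, hge⟩
    change ¬ s2.nvar (b + 2) + s2.nvar (b + 2) < s2.nvar (b + 1) + 1 at hge
    refine Run.seq (T := 4) (Q := fun s'' => s'' = { s2 with
      rvar := Function.update s2.rvar (b + 1) (s2.rvar (b + 1) * s2.rvar (b + 2)) })
      (Run.rset rfl) ?_
    rintro _ rfl
    refine Run.nset ?_
    -- The inner loop stopped because twice `2 ^ (i - 1 - j)` exceeds the exponent, so less than `2
    -- ^ (i - 1 - j)` is left after the subtraction.
    refine ⟨i - 1 - j, by omega,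
      h1.trans ((frame_rset (by omega) _).trans (frame_nset (by omega) _)),
      (Function.update_of_ne (by omega) _ _).trans h2, ?_, by omega, ?_⟩
    · change Function.update s2.nvar (b + 1) (s2.nvar (b + 1) - s2.nvar (b + 2)) (b + 1) < _
      rw [Function.update_self, ← h6]
      omega
    · change Function.update s2.rvar (b + 1) _ (b + 1) * x ^ (Function.update s2.nvar (b + 1)
        (s2.nvar (b + 1) - s2.nvar (b + 2)) (b + 1)) = _
      rw [Function.update_self, Function.update_self, h8, mul_assoc, ← pow_add,
        Nat.add_sub_cancel' h7, h4, h3, i5]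
  refine Run.seq (T := 2) (Q := Inv m) (Run.rset ?_) fun s1 h1 => ?_
  · refine ⟨f0.trans (frame_rset (by omega) _), (Function.update_of_ne (by omega) _ _).trans v0, ?_,
      le_rfl, ?_⟩
    · change s0.nvar (b + 1) < _
      rw [w0]; exact hNm
    · change Function.update s0.rvar (b + 1) _ (b + 1) * x ^ s0.nvar (b + 1) = _
      rw [Function.update_self, w0]
      simp [RExpr.eval]
  refine Run.seq (T' := 2) (Run.loop step m s1 h1) ?_
  rintro s2 ⟨⟨i, -, i1, i2, i3, i4, i5⟩, hge⟩
  change ¬ 0 < s2.nvar (b + 1) at hge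
  refine Run.rset ⟨i1.trans (frame_rset le_rfl _), (Function.update_self _ _ _).trans ?_⟩
  have h0 : s2.nvar (b + 1) = 0 := by omega
  rw [h0, pow_zero, mul_one] at i5
  exact i5

theorem Ex.compiles {κ : Kind} (e : Ex κ) : Compiles e := by
  induction e with
  | lit κ c => exact compiles_lit κ c
  | var x => exact compiles_var x
  | getN a i j hi hj => exact hi.getN hj a
  | getR a i j hi hj => exact hi.getR hj a
  | bin o e f he hf => exact he.bin hf o
  | ltN e f he hf => exact he.ltN hf
  | ltR e f he hf => exact he.ltR hf
  | ite c e f hc he hf => exact hc.ite he hf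
  | big o z x y f hf => exact hf.big o z x y
  | pow r e hr he => exact hr.pow he

end RealRAM

/-! ### Stationary vectors of weakly reversible rate matrices by state elimination -/

namespace Elimination

open Finset Relation

/-- Replace the entries with indices below `M`. -/
def updTab (M : ℕ) (f A : ℕ → ℕ → ℝ) : ℕ → ℕ → ℝ :=
  fun a b => if a < M ∧ b < M then f a b else A a b

/-- The rate from `i` to smaller states. -/
def outSum (R : ℕ → ℕ → ℝ) (i : ℕ) : ℝ := ∑ j ∈ range i, R i j

/-- Elimination of the state `i`: the remaining states are those below `i`. -/
noncomputable def elimStep (i : ℕ) (R : ℕ → ℕ → ℝ) : ℕ → ℕ → ℝ :=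
  updTab i (fun a b => R a b + R a i * R i b / outSum R i) R

/-- Elimination of the states `i - 1, …, 0`. -/
noncomputable def elim : ℕ → (ℕ → ℕ → ℝ) → ℕ → ℕ → ℝ
  | 0, R => R
  | i + 1, R => elim i (elimStep i R)

open scoped Classical in
/-- Back substitution: column `i` of the solution; the row `c` starts at the state `c`. -/
noncomputable def backStep (F : ℕ → ℕ → ℝ) (i : ℕ) (V : ℕ → ℕ → ℝ) : ℕ → ℕ → ℝ := fun c j =>
  if j = i then
    if 0 < outSum F i then (∑ l ∈ range i, V c l * F l i) / outSum F i else if c = i then 1 else 0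
  else V c j

noncomputable def backTab (F : ℕ → ℕ → ℝ) : ℕ → ℕ → ℕ → ℝ
  | 0 => fun _ _ => 0
  | i + 1 => backStep F i (backTab F i)

/-- The edges among the states below `M`. -/
def Edge (M : ℕ) (R : ℕ → ℕ → ℝ) (a b : ℕ) : Prop := a < M ∧ b < M ∧ 0 < R a b

/-- Along every edge one can return. -/
def WeakRev (M : ℕ) (R : ℕ → ℕ → ℝ) : Prop :=
  ∀ a b, Edge M R a b → ReflTransGen (Edge M R) b a

/-- `v` is stationary on the states below `M`. -/
def Stationary (M : ℕ) (R : ℕ → ℕ → ℝ) (v : ℕ → ℝ) : Prop :=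
  ∀ a < M, v a * ∑ b ∈ range M, R a b = ∑ b ∈ range M, v b * R b a

theorem WeakRev.symm {M : ℕ} {R : ℕ → ℕ → ℝ} (h : WeakRev M R) {a b : ℕ}
    (hab : ReflTransGen (Edge M R) a b) : ReflTransGen (Edge M R) b a := by
  induction hab with
  | refl => exact .refl
  | tail _ e ih => exact (h _ _ e).trans ih

/-- The final table keeps for every state the rates from and to smaller states at the moment of its
own elimination. These are what back substitution needs. -/
theorem elim_apply_of_le {i : ℕ} (R : ℕ → ℕ → ℝ) {a b : ℕ} (h : i ≤ a ∨ i ≤ b) :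
    elim i R a b = R a b := by
  induction i generalizing R with
  | zero => rfl
  | succ i ih =>
    rw [elim, ih _ (by omega), elimStep, updTab, if_neg (by omega)]

/-! ### A single elimination step: edges, paths and balance. -/

section Step

variable {i : ℕ} {R : ℕ → ℕ → ℝ}

theorem outSum_nonneg (h0 : ∀ a b, 0 ≤ R a b) : 0 ≤ outSum R i := sum_nonneg fun _ _ => h0 _ _

theorem elimStep_nonneg (h0 : ∀ a b, 0 ≤ R a b) (a b : ℕ) : 0 ≤ elimStep i R a b := by
  unfold elimStep updTab
  split_ifs
  · exact add_nonneg (h0 _ _) (div_nonneg (mul_nonneg (h0 _ _) (h0 _ _)) (outSum_nonneg h0))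
  · exact h0 _ _

theorem elimStep_apply {a b : ℕ} (ha : a < i) (hb : b < i) :
    elimStep i R a b = R a b + R a i * R i b / outSum R i := if_pos ⟨ha, hb⟩

theorem outSum_pos (h0 : ∀ a b, 0 ≤ R a b) {b : ℕ} (hb : b < i) (h : 0 < R i b) :
    0 < outSum R i :=
  h.trans_le (single_le_sum (f := fun j => R i j) (fun _ _ => h0 _ _) (mem_range.2 hb))

theorem edge_of_elimStep (h0 : ∀ a b, 0 ≤ R a b) {a b : ℕ} (h : Edge i (elimStep i R) a b) :
    Edge (i + 1) R a b ∨ (Edge (i + 1) R a i ∧ Edge (i + 1) R i b) := by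
  obtain ⟨ha, hb, h⟩ := h
  rw [elimStep_apply ha hb] at h
  by_cases hab : 0 < R a b
  · exact .inl ⟨by omega, by omega, hab⟩
  · right
    have e : R a b = 0 := le_antisymm (not_lt.1 hab) (h0 a b)
    rw [e, zero_add] at h
    have h1 : R a i ≠ 0 := by rintro h'; simp [h'] at h
    have h2 : R i b ≠ 0 := by rintro h'; simp [h'] at h
    exact ⟨⟨by omega, by omega, (h0 _ _).lt_of_ne' h1⟩, ⟨by omega, by omega, (h0 _ _).lt_of_ne' h2⟩⟩

theorem path_of_elimStep (h0 : ∀ a b, 0 ≤ R a b) {a b : ℕ}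
    (h : ReflTransGen (Edge i (elimStep i R)) a b) : ReflTransGen (Edge (i + 1) R) a b := by
  induction h with
  | refl => exact .refl
  | tail _ e ih =>
    rcases edge_of_elimStep h0 e with e | ⟨e, e'⟩
    · exact ih.tail e
    · exact (ih.tail e).tail e'

/-- A visit of a path to `i` is bypassed by the edge that the elimination creates. The second clause
remembers the last state before `i`, which the induction needs while the path rests in `i`. -/
theorem path_elimStep (h0 : ∀ a b, 0 ≤ R a b) {a b : ℕ} (ha : a < i)
    (h : ReflTransGen (Edge (i + 1) R) a b) :
    (b < i → ReflTransGen (Edge i (elimStep i R)) a b) ∧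
    (b = i → ∃ c < i, ReflTransGen (Edge i (elimStep i R)) a c ∧ 0 < R c i) := by
  induction h with
  | refl => exact ⟨fun _ => .refl, fun h => by omega⟩
  | @tail b d _ e ih =>
    obtain ⟨hb, hd, e⟩ := e
    rcases Nat.lt_succ_iff_lt_or_eq.1 hb with hb' | rfl
    · refine ⟨fun hd' => (ih.1 hb').tail ⟨hb', hd', ?_⟩, fun hd' => ⟨b, hb', ih.1 hb', hd' ▸ e⟩⟩
      rw [elimStep_apply hb' hd']
      exact add_pos_of_pos_of_nonneg e
        (div_nonneg (mul_nonneg (h0 _ _) (h0 _ _)) (outSum_nonneg h0))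
    · obtain ⟨c, hc, h1, h2⟩ := ih.2 rfl
      refine ⟨fun hd' => h1.tail ⟨hc, hd', ?_⟩, fun _ => ⟨c, hc, h1, h2⟩⟩
      rw [elimStep_apply hc hd']
      exact add_pos_of_nonneg_of_pos (h0 _ _)
        (div_pos (mul_pos h2 e) (outSum_pos h0 hd' e))

theorem WeakRev.elimStep (h0 : ∀ a b, 0 ≤ R a b) (h : WeakRev (i + 1) R) :
    WeakRev i (elimStep i R) := by
  intro a b e
  refine (path_elimStep h0 e.2.1 ?_).1 e.1
  rcases edge_of_elimStep h0 e with e | ⟨e, e'⟩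
  · exact h _ _ e
  · exact (h _ _ e').trans (h _ _ e)

/-- A state with outgoing rate `0` to the smaller ones has no incoming edges from them. -/
theorem WeakRev.eq_zero_of_outSum (h0 : ∀ a b, 0 ≤ R a b) (h : WeakRev (i + 1) R)
    (hS : outSum R i = 0) {a : ℕ} (ha : a < i) : R i a = 0 ∧ R a i = 0 := by
  have hz : ∀ b < i, R i b = 0 := fun b hb =>
    (sum_eq_zero_iff_of_nonneg fun _ _ => h0 _ _).1 hS b (mem_range.2 hb)
  refine ⟨hz a ha, ?_⟩
  by_contra hne
  have hp := h a i ⟨by omega, by omega, (h0 _ _).lt_of_ne' hne⟩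
  have : ∀ b, ReflTransGen (Edge (i + 1) R) i b → b = i := by
    intro b hb
    induction hb with
    | refl => rfl
    | @tail c d _ e ih =>
      obtain ⟨_, hd, e⟩ := e
      subst ih
      by_contra hne
      exact e.ne' (hz d (by omega))
  exact ha.ne (this a hp)

theorem Stationary.eq_of_lt {v : ℕ → ℝ} (hv : Stationary i (Elimination.elimStep i R) v) {a : ℕ}
    (ha : a < i) : v a * ∑ b ∈ range i, (R a b + R a i * R i b / outSum R i) =
      ∑ b ∈ range i, v b * (R b a + R b i * R i a / outSum R i) := by
  have e1 : ∀ b ∈ range i, Elimination.elimStep i R a b = R a b + R a i * R i b / outSum R i :=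
    fun b hb => elimStep_apply ha (mem_range.1 hb)
  have e2 : ∀ b ∈ range i, v b * Elimination.elimStep i R b a =
      v b * (R b a + R b i * R i a / outSum R i) :=
    fun b hb => by rw [elimStep_apply (mem_range.1 hb) ha]
  rw [← sum_congr rfl e1, ← sum_congr rfl e2]
  exact hv a ha

/-- The value `v i` is chosen to balance the state `i`; inserting it into the balance equations of
the other states gives exactly the reduced equations. If `outSum R i = 0`, weak reversibility
isolates `i`, and any value of `v i` will do. -/
theorem Stationary.of_elimStep (h0 : ∀ a b, 0 ≤ R a b) (h : WeakRev (i + 1) R) {v : ℕ → ℝ}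
    (hv : Stationary i (Elimination.elimStep i R) v)
    (hi : 0 < outSum R i → v i = (∑ l ∈ range i, v l * R l i) / outSum R i) :
    Stationary (i + 1) R v := by
  rcases (outSum_nonneg (i := i) h0).eq_or_lt with hS | hS
  · have hz := fun a (ha : a < i) => h.eq_zero_of_outSum h0 hS.symm ha
    intro a ha
    rw [sum_range_succ, sum_range_succ]
    rcases Nat.lt_succ_iff_lt_or_eq.1 ha with ha' | rfl
    · rw [(hz a ha').1, (hz a ha').2, mul_zero, add_zero, add_zero]
      have := hv.eq_of_lt ha'
      simpa [← hS] using this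
    · rw [sum_eq_zero fun b hb => (hz b (mem_range.1 hb)).1,
        sum_eq_zero fun b hb => by rw [(hz b (mem_range.1 hb)).2, mul_zero], zero_add, zero_add]
  · have hvi := hi hS
    rw [eq_div_iff hS.ne'] at hvi
    intro a ha
    rw [sum_range_succ, sum_range_succ]
    rcases Nat.lt_succ_iff_lt_or_eq.1 ha with ha' | rfl
    · have := hv.eq_of_lt ha'
      have e1 : ∑ b ∈ range i, (R a b + R a i * R i b / outSum R i)
          = ∑ b ∈ range i, R a b + R a i := by
        rw [sum_add_distrib, ← sum_div, ← mul_sum]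
        change _ + R a i * outSum R i / outSum R i = _
        rw [mul_div_cancel_right₀ _ hS.ne']
      have e2 : ∑ b ∈ range i, v b * (R b a + R b i * R i a / outSum R i)
          = ∑ b ∈ range i, v b * R b a + v i * R i a := by
        have : v i * R i a = ∑ b ∈ range i, v b * R b i * R i a / outSum R i := by
          rw [← sum_div, ← sum_mul, ← hvi]
          field_simp
        rw [this, ← sum_add_distrib]
        exact sum_congr rfl fun b _ => by ring
      rw [e1, e2] at this
      exact this
    -- Diagonal rates stand on both sides of a balance equation, so the self-loops created by
    -- elimination are harmless.
    · change v a * (outSum R a + R a a) = _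
      rw [mul_add, hvi]

end Step

/-- Positivity spreads along edges: a state with positive inflow has positive outflow, hence
positive mass. -/
theorem Stationary.pos {M : ℕ} {R : ℕ → ℕ → ℝ} {v : ℕ → ℝ} (h0 : ∀ a b, 0 ≤ R a b)
    (hv : Stationary M R v) (hv0 : ∀ a, 0 ≤ v a) {a b : ℕ} (hab : ReflTransGen (Edge M R) a b)
    (ha : 0 < v a) : 0 < v b := by
  induction hab with
  | refl => exact ha
  | @tail b d _ e ih =>
    obtain ⟨hb, hd, e⟩ := e
    have h1 : 0 < ∑ c ∈ range M, v c * R c d := (mul_pos ih e).trans_le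
      (single_le_sum (f := fun c => v c * R c d) (fun c _ => mul_nonneg (hv0 _) (h0 _ _))
        (mem_range.2 hb))
    rw [← hv d hd] at h1
    exact pos_of_mul_pos_left h1 (sum_nonneg fun _ _ => h0 _ _)

/-- What state elimination and back substitution achieve. -/
structure Solves (M : ℕ) (R V : ℕ → ℕ → ℝ) : Prop where
  nonneg : ∀ c a, 0 ≤ V c a
  stationary : ∀ c, Stationary M R (V c)
  path : ∀ c a, 0 < V c a → ReflTransGen (Edge M R) c a
  exists_pos : ∀ a < M, ∃ c < M, 0 < V c a

/-- A state without outgoing rate at its elimination is the smallest one of its component. It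
receives the value `1` in its own row and `0` in all others, and back substitution spreads it over
its component only. Thus the rows also reveal which states are connected, without a graph search. -/
theorem Solves.backTab {M : ℕ} {R : ℕ → ℕ → ℝ} (h0 : ∀ a b, 0 ≤ R a b) (h : WeakRev M R) :
    Solves M R (backTab (elim M R) M) := by
  induction M generalizing R with
  | zero => exact ⟨fun _ _ => le_rfl, fun _ _ h => by omega, fun c a h => by simp [Elimination.backTab] at h,
      fun a h => by omega⟩
  | succ i ih =>
    have hI := ih (elimStep_nonneg (i := i) h0) (h.elimStep h0)
    set F := elim i (elimStep i R) with hF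
    have hFR : elim (i + 1) R = F := rfl
    have eF : ∀ {a b : ℕ}, a = i ∨ b = i → F a b = R a b := by
      intro a b hab
      rw [hF, elim_apply_of_le _ (by omega), elimStep, updTab, if_neg (by omega)]
    have eS : outSum F i = outSum R i := sum_congr rfl fun j _ => eF (.inl rfl)
    rw [hFR]
    set W := Elimination.backTab F i with hW
    have eV : ∀ c a, Elimination.backTab F (i + 1) c a = if a = i then
        (if 0 < outSum R i then (∑ l ∈ range i, W c l * R l i) / outSum R i
          else if c = i then 1 else 0) else W c a := by
      intro c a
      change backStep F i W c a = _
      unfold backStep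
      rw [eS, sum_congr rfl fun l _ => by rw [eF (.inr rfl)]]
    have eVlt : ∀ c, ∀ a < i, Elimination.backTab F (i + 1) c a = W c a := fun c a ha => by
      rw [eV, if_neg ha.ne]
    have eVi : ∀ c, Elimination.backTab F (i + 1) c i = if 0 < outSum R i then
        (∑ l ∈ range i, W c l * R l i) / outSum R i else if c = i then 1 else 0 := fun c => by
      rw [eV, if_pos rfl]
    have hnn : ∀ c a, 0 ≤ Elimination.backTab F (i + 1) c a := by
      intro c a
      rw [eV]
      split_ifs
      · exact div_nonneg (sum_nonneg fun _ _ => mul_nonneg (hI.nonneg _ _) (h0 _ _))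
          (outSum_nonneg h0)
      · exact zero_le_one
      · exact le_rfl
      · exact hI.nonneg _ _
    refine ⟨hnn, fun c => ?_, fun c a hca => ?_, fun a ha => ?_⟩
    · refine Stationary.of_elimStep h0 h ?_ ?_
      · intro a ha
        rw [eVlt c a ha, hI.stationary c a ha]
        exact sum_congr rfl fun b hb => by rw [eVlt c b (mem_range.1 hb)]
      · intro hS
        rw [eVi, if_pos hS, sum_congr rfl fun l hl => by rw [← eVlt c l (mem_range.1 hl)]]
    · rw [eV] at hca
      split_ifs at hca with h1 h2 h3
      · subst h1
        have hne : ∑ l ∈ range a, W c l * R l a ≠ 0 := by rintro h'; simp [h'] at hca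
        obtain ⟨l, hl, hne⟩ := exists_ne_zero_of_sum_ne_zero hne
        have hl' := mem_range.1 hl
        refine (path_of_elimStep h0 (hI.path c l ?_)).tail ⟨by omega, by omega, ?_⟩
        · exact (hI.nonneg _ _).lt_of_ne' (left_ne_zero_of_mul hne)
        · exact (h0 _ _).lt_of_ne' (right_ne_zero_of_mul hne)
      · rw [h1, h3]
      · exact absurd hca (lt_irrefl _)
      · exact path_of_elimStep h0 (hI.path c a hca)
    · rcases Nat.lt_succ_iff_lt_or_eq.1 ha with ha' | rfl
      · obtain ⟨c, hc, h'⟩ := hI.exists_pos a ha'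
        exact ⟨c, by omega, by rwa [eVlt c a ha']⟩
      · by_cases hS : 0 < outSum R a
        -- Back substitution needs an incoming edge, whereas `outSum` only provides an outgoing one.
        -- By weak reversibility there is a way back, and it must enter `a` from a smaller state.
        · have : ∃ b < a, 0 < R b a := by
            obtain ⟨b, hb, hne⟩ := exists_ne_zero_of_sum_ne_zero hS.ne'
            have hb' := mem_range.1 hb
            have hp := h a b ⟨by omega, by omega, (h0 _ _).lt_of_ne' hne⟩
            by_contra hcon
            push Not at hcon
            have : ∀ d, ReflTransGen (Edge (a + 1) R) b d → d < a := by
              intro d hd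
              induction hd with
              | refl => exact hb'
              | @tail d e _ he ih =>
                obtain ⟨_, he1, he2⟩ := he
                by_contra hne
                obtain rfl : e = a := by omega
                exact absurd he2 (not_lt.2 (hcon d ih))
            exact lt_irrefl a (this a hp)
          obtain ⟨b, hb, hba⟩ := this
          obtain ⟨c, hc, h'⟩ := hI.exists_pos b hb
          refine ⟨c, by omega, ?_⟩
          rw [eVi, if_pos hS]
          exact div_pos ((mul_pos h' hba).trans_le (single_le_sum (f := fun l => W c l * R l a)
            (fun _ _ => mul_nonneg (hI.nonneg _ _) (h0 _ _)) (mem_range.2 hb))) hS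
        · exact ⟨a, ha, by rw [eVi, if_neg hS, if_pos rfl]; exact one_pos⟩

theorem Solves.pos_of_path {M : ℕ} {R V : ℕ → ℕ → ℝ} (hV : Solves M R V)
    (h0 : ∀ a b, 0 ≤ R a b) {c a b : ℕ} (hab : ReflTransGen (Edge M R) a b) (h : 0 < V c a) :
    0 < V c b := (hV.stationary c).pos h0 (hV.nonneg c) hab h

theorem Solves.path_of_pos {M : ℕ} {R V : ℕ → ℕ → ℝ} (hV : Solves M R V) (h : WeakRev M R)
    {c a b : ℕ} (ha : 0 < V c a) (hb : 0 < V c b) : ReflTransGen (Edge M R) a b :=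
  (h.symm (hV.path c a ha)).trans (hV.path c b hb)

/-- The sum of the rows of the solution. -/
theorem Solves.sum_stationary {M : ℕ} {R V : ℕ → ℕ → ℝ} (hV : Solves M R V) :
    Stationary M R (fun a => ∑ c ∈ range M, V c a) := by
  intro a ha
  simp only [sum_mul]
  rw [sum_comm]
  exact sum_congr rfl fun c _ => hV.stationary c a ha

theorem Solves.sum_pos {M : ℕ} {R V : ℕ → ℕ → ℝ} (hV : Solves M R V) {a : ℕ} (ha : a < M) :
    0 < ∑ c ∈ range M, V c a := by
  obtain ⟨c, hc, h⟩ := hV.exists_pos a ha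
  exact h.trans_le (single_le_sum (f := fun c => V c a) (fun _ _ => hV.nonneg _ _) (mem_range.2 hc))

end Elimination

/-! ### Reachability and stationary distributions -/

namespace PetriNet

variable {P T : Type} {𝒩 : PetriNet P T}

/-- Splitting off the tokens `u` that are not touched replaces truncated subtraction by addition in
a cancellative monoid. Later arguments about firings use this form. -/
theorem fires_iff {t : T} {m m' : P → ℕ} :
    𝒩.Fires t m m' ↔ ∃ u, m = 𝒩.pre t + u ∧ m' = 𝒩.post t + u := by
  constructor
  · rintro ⟨h1, h2⟩
    refine ⟨fun p => m p - 𝒩.pre t p, funext fun p => ?_, funext fun p => ?_⟩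
    · have := h1 p
      simp only [Pi.add_apply]; omega
    · have := h2 p
      simp only [Pi.add_apply]; omega
  · rintro ⟨u, rfl, rfl⟩
    exact ⟨fun p => Nat.le_add_right _ _, fun p => by simp only [Pi.add_apply]; omega⟩

theorem mem_reachSet_self (m : P → ℕ) : m ∈ 𝒩.ReachSet m := Relation.ReflTransGen.refl

theorem reach_trans {m m' m'' : P → ℕ} (h : m' ∈ 𝒩.ReachSet m) (h' : m'' ∈ 𝒩.ReachSet m') :
    m'' ∈ 𝒩.ReachSet m := Relation.ReflTransGen.trans h h'

theorem reach_fires {t : T} {m m' : P → ℕ} (h : 𝒩.Fires t m m') : m' ∈ 𝒩.ReachSet m :=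
  Relation.ReflTransGen.single ⟨t, h⟩

theorem reach_add {m m' : P → ℕ} (h : m' ∈ 𝒩.ReachSet m) (u : P → ℕ) :
    m' + u ∈ 𝒩.ReachSet (m + u) := by
  refine Relation.ReflTransGen.lift (fun m => m + u) (fun a b => ?_) _ _ h
  rintro ⟨t, hab⟩
  obtain ⟨w, rfl, rfl⟩ := fires_iff.1 hab
  exact ⟨t, fires_iff.2 ⟨w + u, add_assoc _ _ _, add_assoc _ _ _⟩⟩

/-- The effect of every transition can be undone. -/
def Reversible (𝒩 : PetriNet P T) : Prop := ∀ t, 𝒩.pre t ∈ 𝒩.ReachSet (𝒩.post t)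

theorem Reversible.symm (hr : 𝒩.Reversible) {m m' : P → ℕ} (h : m' ∈ 𝒩.ReachSet m) :
    m ∈ 𝒩.ReachSet m' := by
  induction h with
  | refl => exact mem_reachSet_self _
  | tail _ e ih =>
    obtain ⟨t, ht⟩ := e
    obtain ⟨u, rfl, rfl⟩ := fires_iff.1 ht
    exact reach_trans (reach_add (hr t) u) ih

theorem Reversible.mem_of_mem (hr : 𝒩.Reversible) {m₀ : P → ℕ} {t : T} {u : P → ℕ}
    (h : 𝒩.post t + u ∈ 𝒩.ReachSet m₀) : 𝒩.pre t + u ∈ 𝒩.ReachSet m₀ :=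
  reach_trans h (reach_add (hr t) u)

theorem mem_of_mem_pre {m₀ : P → ℕ} {t : T} {u : P → ℕ}
    (h : 𝒩.pre t + u ∈ 𝒩.ReachSet m₀) : 𝒩.post t + u ∈ 𝒩.ReachSet m₀ :=
  reach_trans h (reach_fires (fires_iff.2 ⟨u, rfl, rfl⟩))

/-! ### Global balance on all markings, and ergodicity as summability of a balanced measure. -/

section Chain

variable [Fintype T] (𝒩) (rate : T → ℝ)

open scoped Classical in
/-- The flow into the marking `m` under the measure `π`. -/
noncomputable def inflow (π : (P → ℕ) → ℝ) (m : P → ℕ) : ℝ :=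
  ∑ t, rate t * if 𝒩.post t ≤ m then π (m - 𝒩.post t + 𝒩.pre t) else 0

open scoped Classical in
/-- The exit rate of the marking `m`. -/
noncomputable def exitRate (m : P → ℕ) : ℝ :=
  ∑ t, rate t * if 𝒩.pre t ≤ m then 1 else 0

/-- Global balance. -/
def Balanced (π : (P → ℕ) → ℝ) : Prop := ∀ m, 𝒩.inflow rate π m = π m * 𝒩.exitRate rate m

variable {𝒩} {rate}

theorem jumpRate_self (m : P → ℕ) : 𝒩.jumpRate rate m m = 0 := by
  refine Finset.sum_eq_zero fun t _ => if_neg fun h => ?_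
  obtain ⟨u, h1, h2⟩ := fires_iff.1 h
  exact 𝒩.no_useless t (add_right_cancel (h1.symm.trans h2))

theorem hasSum_jumpRate {m₀ : P → ℕ} (m : 𝒩.ReachSet m₀) :
    HasSum (fun m' : 𝒩.ReachSet m₀ => 𝒩.jumpRate rate m m') (𝒩.exitRate rate m) := by
  classical
  refine hasSum_sum fun t _ => ?_
  by_cases h : 𝒩.pre t ≤ (m : P → ℕ)
  · obtain ⟨u, hu⟩ := exists_add_of_le h
    have hm : 𝒩.post t + u ∈ 𝒩.ReachSet m₀ := mem_of_mem_pre (hu ▸ m.2)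
    rw [if_pos h, mul_one]
    have := hasSum_single (f := fun m' : 𝒩.ReachSet m₀ => if 𝒩.Fires t m m' then rate t else 0)
      ⟨_, hm⟩ ?_
    · rwa [if_pos (fires_iff.2 ⟨u, hu, rfl⟩)] at this
    · intro m' hne
      refine if_neg fun hf => hne ?_
      obtain ⟨u', h1, h2⟩ := fires_iff.1 hf
      rw [hu] at h1
      have e := add_left_cancel h1
      subst e
      exact Subtype.ext h2
  · rw [if_neg h, mul_zero]
    convert hasSum_zero with m'
    refine if_neg fun hf => h ?_
    exact fun p => hf.1 p

theorem generator_eq {m₀ : P → ℕ} (m m' : 𝒩.ReachSet m₀) :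
    𝒩.generator rate m₀ m m' =
      𝒩.jumpRate rate m m' - by classical exact if m = m' then 𝒩.exitRate rate m else 0 := by
  classical
  unfold generator
  split_ifs with h
  · subst h
    rw [jumpRate_self, zero_sub, ← (hasSum_jumpRate (rate := rate) m).tsum_eq]
    congr 2
    funext m''
    split_ifs with h
    · rw [h, jumpRate_self]
    · rfl
  · rw [sub_zero]

/-- Reversibility enters because the sum runs over reachable markings only: the predecessor `pre t +
u` of a reachable marking `post t + u` is itself reachable, so no inflow is lost. -/
theorem Reversible.hasSum_generator (hr : 𝒩.Reversible) {m₀ : P → ℕ} (f : (P → ℕ) → ℝ)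
    (m' : 𝒩.ReachSet m₀) :
    HasSum (fun m : 𝒩.ReachSet m₀ => f m * 𝒩.generator rate m₀ m m')
      (𝒩.inflow rate f m' - f m' * 𝒩.exitRate rate m') := by
  classical
  simp only [generator_eq, mul_sub]
  refine HasSum.sub ?_ ?_
  · simp only [jumpRate, Finset.mul_sum]
    refine hasSum_sum fun t _ => ?_
    by_cases h : 𝒩.post t ≤ (m' : P → ℕ)
    · obtain ⟨u, hu⟩ := exists_add_of_le h
      have hm : 𝒩.pre t + u ∈ 𝒩.ReachSet m₀ := hr.mem_of_mem (hu ▸ m'.2)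
      have := hasSum_single (f := fun m : 𝒩.ReachSet m₀ =>
        f m * if 𝒩.Fires t m m' then rate t else 0) ⟨_, hm⟩ ?_
      · rw [if_pos (fires_iff.2 ⟨u, rfl, hu⟩)] at this
        have e : (m' : P → ℕ) - 𝒩.post t + 𝒩.pre t = 𝒩.pre t + u := by
          rw [hu, add_tsub_cancel_left, add_comm]
        rw [if_pos h, e, mul_comm]
        exact this
      · intro m hne
        rw [if_neg, mul_zero]
        intro hf
        refine hne ?_
        obtain ⟨u', h1, h2⟩ := fires_iff.1 hf
        rw [hu] at h2
        have e := add_left_cancel h2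
        subst e
        exact Subtype.ext h1
    · rw [if_neg h, mul_zero]
      convert hasSum_zero with m
      rw [if_neg, mul_zero]
      intro hf
      obtain ⟨u', h1, h2⟩ := fires_iff.1 hf
      exact h (h2 ▸ le_self_add)
  · have := hasSum_single (f := fun m : 𝒩.ReachSet m₀ =>
      f m * if m = m' then 𝒩.exitRate rate m else 0) m' fun m hne => by rw [if_neg hne, mul_zero]
    rwa [if_pos rfl] at this

theorem inflow_eq_zero {m₀ : P → ℕ} {π : (P → ℕ) → ℝ}
    (hπ : ∀ m, m ∉ 𝒩.ReachSet m₀ → π m = 0) {m : P → ℕ} (hm : m ∉ 𝒩.ReachSet m₀) :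
    𝒩.inflow rate π m = 0 := by
  refine Finset.sum_eq_zero fun t _ => ?_
  split_ifs with h
  · obtain ⟨u, rfl⟩ := exists_add_of_le h
    rw [hπ, mul_zero]
    rw [add_tsub_cancel_left, add_comm]
    exact fun h' => hm (mem_of_mem_pre h')
  · rw [mul_zero]

theorem Reversible.ergodic_iff (hr : 𝒩.Reversible) {m₀ : P → ℕ} :
    𝒩.Ergodic rate m₀ ↔ ∃ π : (P → ℕ) → ℝ, (∀ m, 0 ≤ π m) ∧
      (∀ m, m ∉ 𝒩.ReachSet m₀ → π m = 0) ∧ HasSum π 1 ∧ 𝒩.Balanced rate π := by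
  classical
  constructor
  · rintro ⟨π, h1, h2, h3⟩
    let f : (P → ℕ) → ℝ := fun m => if h : m ∈ 𝒩.ReachSet m₀ then π ⟨m, h⟩ else 0
    have hf : ∀ m : 𝒩.ReachSet m₀, f m = π m := fun m => dif_pos m.2
    have hf0 : ∀ m, m ∉ 𝒩.ReachSet m₀ → f m = 0 := fun m hm => dif_neg hm
    refine ⟨f, fun m => ?_, hf0, ?_, fun m => ?_⟩
    · by_cases hm : m ∈ 𝒩.ReachSet m₀
      · exact (hf ⟨m, hm⟩).symm ▸ h1 _
      · exact (hf0 m hm).ge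
    · refine (hasSum_subtype_iff_of_support_subset (s := 𝒩.ReachSet m₀) fun m hm => ?_).1 ?_
      · by_contra h
        exact hm (hf0 m h)
      · convert h2 using 1
        exact funext hf
    · by_cases hm : m ∈ 𝒩.ReachSet m₀
      · have e1 := hr.hasSum_generator (rate := rate) f ⟨m, hm⟩
        simp only [hf] at e1
        have := e1.unique (h3 ⟨m, hm⟩)
        exact sub_eq_zero.1 this
      · rw [inflow_eq_zero hf0 hm, hf0 m hm, zero_mul]
  · rintro ⟨π, h1, h2, h3, h4⟩
    refine ⟨fun m => π m, fun m => h1 m, ?_, fun m' => ?_⟩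
    · refine (hasSum_subtype_iff_of_support_subset (s := 𝒩.ReachSet m₀) fun m hm => ?_).2 h3
      by_contra h
      exact hm (h2 m h)
    · have := hr.hasSum_generator (rate := rate) π m'
      rwa [h4 m', sub_self] at this

/-- Conservation of mass: after the substitutions `m = post t + u` and `m = pre t + u`, both totals
become the sum over `t` and `u` of `rate t * ν (pre t + u)`. Summability of `ν` permits the
rearrangement. -/
theorem summable_exitRate {ν : (P → ℕ) → ℝ} (h : Summable ν) :
    Summable (fun m => 𝒩.inflow rate ν m) ∧
      Summable (fun m => ν m * 𝒩.exitRate rate m) ∧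
      ∑' m, 𝒩.inflow rate ν m = ∑' m, ν m * 𝒩.exitRate rate m := by
  classical
  have key : ∀ t, ∃ a, HasSum (fun m => if 𝒩.post t ≤ m then ν (m - 𝒩.post t + 𝒩.pre t) else 0) a ∧
      HasSum (fun m => ν m * if 𝒩.pre t ≤ m then 1 else 0) a := by
    intro t
    have hinj : Function.Injective (fun u : P → ℕ => 𝒩.pre t + u) := add_right_injective _
    have hinj' : Function.Injective (fun u : P → ℕ => 𝒩.post t + u) := add_right_injective _
    refine ⟨∑' u, ν (𝒩.pre t + u), ?_, ?_⟩
    · refine (hinj'.hasSum_iff fun m hm => ?_).1 ?_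
      · refine if_neg fun h => hm ?_
        obtain ⟨u, rfl⟩ := exists_add_of_le h
        exact ⟨u, rfl⟩
      · have e : (fun m => if 𝒩.post t ≤ m then ν (m - 𝒩.post t + 𝒩.pre t) else 0) ∘
            (fun u : P → ℕ => 𝒩.post t + u) = ν ∘ fun u => 𝒩.pre t + u :=
          funext fun u => by simp [add_comm]
        rw [e]
        exact (h.comp_injective hinj).hasSum
    · refine (hinj.hasSum_iff fun m hm => ?_).1 ?_
      · rw [if_neg, mul_zero]
        intro h
        obtain ⟨u, rfl⟩ := exists_add_of_le h
        exact hm ⟨u, rfl⟩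
      · have e : (fun m => ν m * if 𝒩.pre t ≤ m then 1 else 0) ∘ (fun u : P → ℕ => 𝒩.pre t + u) =
            ν ∘ fun u => 𝒩.pre t + u := funext fun u => by simp
        rw [e]
        exact (h.comp_injective hinj).hasSum
  choose a ha hb using key
  have h1 : HasSum (fun m => 𝒩.inflow rate ν m) (∑ t, rate t * a t) :=
    hasSum_sum fun t _ => (ha t).mul_left _
  have h2 : HasSum (fun m => ν m * 𝒩.exitRate rate m) (∑ t, rate t * a t) := by
    simp only [exitRate, Finset.mul_sum]
    refine hasSum_sum fun t _ => ?_
    have e : (fun m => ν m * (rate t * if 𝒩.pre t ≤ m then 1 else 0)) =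
        fun m => rate t * (ν m * if 𝒩.pre t ≤ m then 1 else 0) := funext fun m => by ring
    rw [e]
    exact (hb t).mul_left (rate t)
  exact ⟨h1.summable, h2.summable, h1.tsum_eq.trans h2.tsum_eq.symm⟩

theorem inflow_mono (hrate : ∀ t, 0 < rate t) {π π' : (P → ℕ) → ℝ} (h : ∀ m, π m ≤ π' m)
    (m : P → ℕ) : 𝒩.inflow rate π m ≤ 𝒩.inflow rate π' m := by
  refine Finset.sum_le_sum fun t _ => mul_le_mul_of_nonneg_left ?_ (hrate t).le
  split_ifs
  · exact h _
  · exact le_rfl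

theorem exitRate_nonneg (hrate : ∀ t, 0 < rate t) (m : P → ℕ) : 0 ≤ 𝒩.exitRate rate m := by
  refine Finset.sum_nonneg fun t _ => mul_nonneg (hrate t).le ?_
  split_ifs <;> norm_num

theorem inflow_const_mul (c : ℝ) (π : (P → ℕ) → ℝ) (m : P → ℕ) :
    𝒩.inflow rate (fun m => c * π m) m = c * 𝒩.inflow rate π m := by
  unfold inflow
  rw [Finset.mul_sum]
  refine Finset.sum_congr rfl fun t _ => ?_
  split_ifs <;> ring

theorem inflow_sub (π π' : (P → ℕ) → ℝ) (m : P → ℕ) :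
    𝒩.inflow rate (fun m => π m - π' m) m = 𝒩.inflow rate π m - 𝒩.inflow rate π' m := by
  unfold inflow
  rw [← Finset.sum_sub_distrib]
  refine Finset.sum_congr rfl fun t _ => ?_
  split_ifs <;> ring

/-- A non-negative balanced function that vanishes somewhere on the reachability set vanishes on
the whole of it. -/
theorem Balanced.eq_zero (hr : 𝒩.Reversible) (hrate : ∀ t, 0 < rate t) {δ : (P → ℕ) → ℝ}
    (hδ : 𝒩.Balanced rate δ) (h0 : ∀ m, 0 ≤ δ m) {m₀ m : P → ℕ} (hm₀ : δ m₀ = 0)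
    (hm : m ∈ 𝒩.ReachSet m₀) : δ m = 0 := by
  have step : ∀ m t u, m = 𝒩.post t + u → δ m = 0 → δ (𝒩.pre t + u) = 0 := by
    intro m t u hu h
    have hz := hδ m
    rw [h, zero_mul] at hz
    have := (Finset.sum_eq_zero_iff_of_nonneg fun t _ => mul_nonneg (hrate t).le ?_).1 hz t
      (Finset.mem_univ t)
    · rw [if_pos (hu ▸ le_self_add), hu, add_tsub_cancel_left, add_comm] at this
      exact (mul_eq_zero.1 this).resolve_left (hrate t).ne'
    · split_ifs
      · exact h0 _
      · exact le_rfl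
  have hm' := hr.symm hm
  induction hm' using Relation.ReflTransGen.head_induction_on with
  | refl => exact hm₀
  | head e _ ih =>
    obtain ⟨t, ht⟩ := e
    obtain ⟨u, rfl, rfl⟩ := fires_iff.1 ht
    exact step _ t u rfl (ih (mem_of_mem_pre hm))

/-- Scale `μ` by `c` so that it meets the steady state `π` in `m₀`. The minimum `ν` of `π` and `c *
μ` is summable, and its inflow nowhere exceeds its outflow; as the totals agree, `ν` is balanced.
Then `c * μ - ν` is balanced, non-negative and zero in `m₀`, hence zero on the reachability set, and
`μ` inherits the summability of `ν`. -/
theorem Balanced.summable (hr : 𝒩.Reversible) (hrate : ∀ t, 0 < rate t) {m₀ : P → ℕ}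
    {μ : (P → ℕ) → ℝ} (hμ : 𝒩.Balanced rate μ) (hpos : ∀ m ∈ 𝒩.ReachSet m₀, 0 < μ m)
    (hzero : ∀ m, m ∉ 𝒩.ReachSet m₀ → μ m = 0) (he : 𝒩.Ergodic rate m₀) : Summable μ := by
  obtain ⟨π, h1, h2, h3, h4⟩ := hr.ergodic_iff.1 he
  have self := mem_reachSet_self (𝒩 := 𝒩) m₀
  have hμ0 : ∀ m, 0 ≤ μ m := fun m => by
    by_cases hm : m ∈ 𝒩.ReachSet m₀
    · exact (hpos m hm).le
    · exact (hzero m hm).ge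
  have hπ0 : 0 < π m₀ := by
    refine (h1 m₀).lt_of_ne' fun h => ?_
    have : π = fun _ => 0 := funext fun m => by
      by_cases hm : m ∈ 𝒩.ReachSet m₀
      · exact h4.eq_zero hr hrate h1 h hm
      · exact h2 m hm
    rw [this] at h3
    exact zero_ne_one (hasSum_zero.unique h3)
  set c := π m₀ / μ m₀ with hc
  have hc0 : 0 < c := div_pos hπ0 (hpos m₀ self)
  let ν : (P → ℕ) → ℝ := fun m => min (π m) (c * μ m)
  have hν0 : ∀ m, 0 ≤ ν m := fun m => le_min (h1 m) (mul_nonneg hc0.le (hμ0 m))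
  have hνs : Summable ν := h3.summable.of_nonneg_of_le hν0 fun m => min_le_left _ _
  have hle : ∀ m, 𝒩.inflow rate ν m ≤ ν m * 𝒩.exitRate rate m := by
    intro m
    rw [min_mul_of_nonneg _ _ (exitRate_nonneg hrate m)]
    refine le_min ?_ ?_
    · rw [← h4 m]
      exact inflow_mono hrate (fun m => min_le_left _ _) m
    · rw [mul_assoc, ← hμ m, ← inflow_const_mul]
      exact inflow_mono hrate (fun m => min_le_right _ _) m
  obtain ⟨s1, s2, s3⟩ := summable_exitRate (𝒩 := 𝒩) (rate := rate) hνs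
  have hνb : 𝒩.Balanced rate ν := by
    have := (s2.hasSum.sub s1.hasSum)
    rw [s3, sub_self] at this
    have := (hasSum_zero_iff_of_nonneg fun m => sub_nonneg.2 (hle m)).1 this
    exact fun m => (sub_eq_zero.1 (congrFun this m)).symm
  have hcm : c * μ m₀ = π m₀ := div_mul_cancel₀ _ (hpos m₀ self).ne'
  have hν₀ : ν m₀ = π m₀ := by simp only [ν]; rw [hcm, min_self]
  have hd : 𝒩.Balanced rate (fun m => c * μ m - ν m) := fun m => by
    rw [inflow_sub, inflow_const_mul, hμ m, hνb m]
    ring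
  have heq : ∀ m, c * μ m = ν m := fun m => by
    by_cases hm : m ∈ 𝒩.ReachSet m₀
    · refine sub_eq_zero.1 (hd.eq_zero hr hrate (fun m => sub_nonneg.2 (min_le_right _ _)) ?_ hm)
      rw [hcm, hν₀, sub_self]
    · simp only [ν]
      rw [hzero m hm, h2 m hm, mul_zero, min_self]
  have := hνs.mul_left c⁻¹
  refine this.congr fun m => ?_
  rw [← heq, inv_mul_cancel_left₀ hc0.ne']

/-- The reachability set is closed under firing and, by reversibility, under undoing a firing, so
the restriction of `μ` to it is balanced again. If it is summable, normalizing gives a steady state.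
-/
theorem Balanced.ergodic_iff (hr : 𝒩.Reversible) (hrate : ∀ t, 0 < rate t) {m₀ : P → ℕ}
    {μ : (P → ℕ) → ℝ} (hμ : 𝒩.Balanced rate μ) (hpos : ∀ m, 0 < μ m) :
    𝒩.Ergodic rate m₀ ↔ Summable ((𝒩.ReachSet m₀).indicator μ) := by
  classical
  have hb : 𝒩.Balanced rate ((𝒩.ReachSet m₀).indicator μ) := by
    intro m
    by_cases hm : m ∈ 𝒩.ReachSet m₀
    · rw [Set.indicator_of_mem hm, ← hμ m]
      refine Finset.sum_congr rfl fun t _ => ?_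
      split_ifs with h
      · obtain ⟨u, rfl⟩ := exists_add_of_le h
        rw [add_tsub_cancel_left, add_comm, Set.indicator_of_mem (hr.mem_of_mem hm)]
      · rfl
    · rw [inflow_eq_zero (fun m hm => Set.indicator_of_notMem hm _) hm,
        Set.indicator_of_notMem hm, zero_mul]
  have hz : ∀ m, m ∉ 𝒩.ReachSet m₀ → (𝒩.ReachSet m₀).indicator μ m = 0 :=
    fun m hm => Set.indicator_of_notMem hm _
  have hnn : ∀ m, 0 ≤ (𝒩.ReachSet m₀).indicator μ m :=
    fun m => Set.indicator_nonneg (fun m _ => (hpos m).le) m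
  refine ⟨fun he => hb.summable hr hrate (fun m hm => ?_) hz he, fun hs => hr.ergodic_iff.2 ?_⟩
  · rw [Set.indicator_of_mem hm]; exact hpos m
  · set Z := ∑' m, (𝒩.ReachSet m₀).indicator μ m
    have hZ : 0 < Z := hs.tsum_pos hnn m₀
      (by rw [Set.indicator_of_mem (mem_reachSet_self m₀)]; exact hpos _)
    refine ⟨fun m => Z⁻¹ * (𝒩.ReachSet m₀).indicator μ m,
      fun m => mul_nonneg (inv_nonneg.2 hZ.le) (hnn m), fun m hm => by simp only [hz m hm, mul_zero], ?_,
      fun m => ?_⟩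
    · have := hs.hasSum.mul_left Z⁻¹
      rwa [inv_mul_cancel₀ hZ.ne'] at this
    · rw [inflow_const_mul, hb m, mul_assoc]

end Chain

end PetriNet

/-! ### The layers of an open Π³-net -/

open Relation

/-- The number of tokens. -/
def tot {P : Type} [Fintype P] (w : P → ℕ) : ℕ := ∑ q, w q

/-- The tokens on the places with the property `S`. -/
noncomputable def part {P : Type} (S : P → Prop) (m : P → ℕ) : P → ℕ :=
  fun q => by classical exact if S q then m q else 0

section Tokens

variable {P : Type}

theorem part_of {S : P → Prop} {m : P → ℕ} {q : P} (h : S q) : part S m q = m q := if_pos h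

theorem part_not {S : P → Prop} {m : P → ℕ} {q : P} (h : ¬ S q) : part S m q = 0 := if_neg h

theorem part_add_part_not (S : P → Prop) (m : P → ℕ) :
    part S m + part (fun q => ¬ S q) m = m := by
  funext q
  by_cases h : S q
  · rw [Pi.add_apply, part_of h, part_not (S := fun q => ¬ S q) (not_not.2 h), add_zero]
  · rw [Pi.add_apply, part_not h, part_of (S := fun q => ¬ S q) h, zero_add]

theorem part_add (S : P → Prop) (m m' : P → ℕ) : part S (m + m') = part S m + part S m' := by
  funext q
  by_cases h : S q
  · rw [Pi.add_apply, part_of h, part_of h, part_of h, Pi.add_apply]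
  · rw [Pi.add_apply, part_not h, part_not h, part_not h]

theorem part_mono (S : P → Prop) {m m' : P → ℕ} (h : m ≤ m') : part S m ≤ part S m' := by
  obtain ⟨u, rfl⟩ := exists_add_of_le h
  rw [part_add]
  exact le_self_add

/-- One token on the place `p`, none if there is no such place. -/
noncomputable def own (p : Option P) : P → ℕ := fun q => by classical exact if p = some q then 1 else 0

theorem own_none : own (none : Option P) = 0 := funext fun q => if_neg (by simp)

theorem own_some_self (q : P) : own (some q) q = 1 := if_pos rfl

theorem own_ne {p : Option P} {q : P} (h : p ≠ some q) : own p q = 0 := if_neg h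

theorem own_pos {p : Option P} {q : P} (h : 0 < own p q) : p = some q := by
  by_contra hne
  exact h.ne' (own_ne hne)

theorem own_le {q : P} {w : P → ℕ} (h : 0 < w q) : own (some q) ≤ w := by
  intro x
  by_cases hx : some q = some x
  · cases hx
    rw [own_some_self]
    exact h
  · rw [own_ne hx]
    exact Nat.zero_le _

variable [Fintype P]

theorem tot_add (w w' : P → ℕ) : tot (w + w') = tot w + tot w' := Finset.sum_add_distrib

theorem tot_zero : tot (0 : P → ℕ) = 0 := Finset.sum_const_zero

theorem tot_eq_zero {w : P → ℕ} : tot w = 0 ↔ w = 0 := by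
  simp [tot, Finset.sum_eq_zero_iff, funext_iff]

theorem exists_pos_of_tot {w : P → ℕ} (h : 0 < tot w) : ∃ q, 0 < w q := by
  by_contra hcon
  push Not at hcon
  exact h.ne' (tot_eq_zero.2 (funext fun q => Nat.le_zero.1 (hcon q)))

theorem tot_mono {w w' : P → ℕ} (h : w ≤ w') : tot w ≤ tot w' := Finset.sum_le_sum fun q _ => h q

theorem tot_own (q : P) : tot (own (some q)) = 1 := by
  classical
  unfold tot own
  rw [Finset.sum_eq_single q]
  · exact if_pos rfl
  · intro b _ hb
    exact if_neg fun h => hb (Option.some.inj h).symm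
  · simp

theorem token_induction {Q : (P → ℕ) → Prop} (h0 : Q 0)
    (h1 : ∀ q u, Q u → Q (own (some q) + u)) (u : P → ℕ) : Q u := by
  induction hn : tot u generalizing u with
  | zero => rwa [tot_eq_zero.1 hn]
  | succ n ih =>
    obtain ⟨q, hq⟩ := exists_pos_of_tot (w := u) (by omega)
    obtain ⟨w, rfl⟩ := exists_add_of_le (own_le hq)
    refine h1 q w (ih w ?_)
    rw [tot_add, tot_own] at hn
    omega

end Tokens

/-- The data of an open Π³-net in terms of its own places. -/
structure OpenData {P T : Type} [Fintype P] (𝒩 : PetriNet P T) where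
  lay : Option P → ℕ
  res : Option P → P → ℕ
  lower : ∀ p q, 0 < res p q → lay (some q) + 1 = lay p ∧
    ∀ r, lay r = lay (some q) → tot (res r) ≤ tot (res (some q))
  top : ∀ p, lay p ≤ lay none
  surj : ∀ i ≤ lay none, ∃ p, lay p = i
  trans : ∀ t, ∃ p p', lay p = lay p' ∧ 𝒩.pre t = own p + res p ∧ 𝒩.post t = own p' + res p'
  path : ∀ p p', lay p = lay p' → ReflTransGen 𝒩.BagEdge (own p + res p) (own p' + res p')
  used : ∀ p, ∃ t, 𝒩.pre t = own p + res p ∨ 𝒩.post t = own p + res p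

namespace PetriNet

/-- Resources lie one layer below their place, so a place of the last layer occurs in no bag but its
own. Deleting it therefore strips one token from a single bag and changes no potential. -/
theorem IsOpenPi3.exists_openData {P T : Type} [Fintype P] {𝒩 : PetriNet P T} {N : ℕ}
    (h : 𝒩.IsOpenPi3 N) : Nonempty (OpenData 𝒩) := by
  classical
  obtain ⟨𝒩', S, hN, hres⟩ := h
  let res : Option P → P → ℕ := fun p q => if p = some q then 0 else (S.bag p).1 (some q)
  have hbag : ∀ p, own p + res p = fun q => (S.bag p).1 (some q) := by
    intro p
    funext q
    by_cases hp : p = some q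
    · subst hp
      simp [own, res, S.bag_self]
    · simp [own, res, hp]
  have hnone : ∀ q, (S.bag (some q)).1 none = 0 := by
    intro q
    by_contra hne
    have := (S.resource (some q) none (by simp) (Nat.pos_of_ne_zero hne)).1
    have h2 := (S.layer (some q)).2
    omega
  have hpot : ∀ r, ∑ s, (S.bag r).1 s - 1 = tot (res r) := by
    intro r
    have e : ∑ q, (S.bag r).1 (some q) = tot (own r) + tot (res r) := by
      rw [← tot_add, hbag]; rfl
    rw [Fintype.sum_option, e]
    cases r with
    | none => rw [S.bag_self, own_none, tot_zero]; omega
    | some q => rw [hnone, tot_own]; omega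
  have hpre : ∀ t, 𝒩.pre t = fun q => 𝒩'.pre t (some q) := fun t => funext fun q => (hres t q).1
  have hpost : ∀ t, 𝒩.post t = fun q => 𝒩'.post t (some q) := fun t => funext fun q => (hres t q).2
  refine ⟨⟨fun p => S.layer p, res, ?_, ?_, ?_, ?_, ?_, ?_⟩⟩
  · intro p q hpq
    have hne : p ≠ some q := by rintro rfl; simp [res] at hpq
    have hpq' : 0 < (S.bag p).1 (some q) := by simpa [res, hne] using hpq
    obtain ⟨h1, h2⟩ := S.resource p (some q) hne.symm hpq'
    refine ⟨h1, fun r hr => ?_⟩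
    have := h2 r (Fin.ext hr)
    rwa [hpot, hpot] at this
  · intro p
    have := (S.layer p).2
    omega
  · intro i hi
    obtain ⟨p, hp⟩ := S.layer_surjective ⟨i, by omega⟩
    exact ⟨p, congrArg Fin.val hp⟩
  · intro t
    have e1 : (S.bag (S.bag.symm ⟨𝒩'.pre t, t, .inl rfl⟩)).1 = 𝒩'.pre t := by
      rw [Equiv.apply_symm_apply]
    have e2 : (S.bag (S.bag.symm ⟨𝒩'.post t, t, .inr rfl⟩)).1 = 𝒩'.post t := by
      rw [Equiv.apply_symm_apply]
    refine ⟨S.bag.symm ⟨𝒩'.pre t, t, .inl rfl⟩, S.bag.symm ⟨𝒩'.post t, t, .inr rfl⟩, ?_, ?_, ?_⟩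
    · refine congrArg Fin.val ((S.reach_iff _ _).1 (.single ⟨t, ?_, ?_⟩))
      · exact e1.symm
      · exact e2.symm
    · rw [hbag, e1, hpre]
    · rw [hbag, e2, hpost]
  · intro p p' hpp
    have := (S.reach_iff p p').2 (Fin.ext hpp)
    rw [hbag, hbag]
    refine ReflTransGen.lift (fun b q => b (some q)) (fun a b => ?_) _ _ this
    rintro ⟨t, rfl, rfl⟩
    exact ⟨t, hpre t, hpost t⟩
  · intro p
    obtain ⟨t, ht⟩ := (S.bag p).2
    refine ⟨t, ?_⟩
    rw [hbag, hpre, hpost]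
    rcases ht with ht | ht
    · left; rw [ht]
    · right; rw [ht]

end PetriNet

namespace OpenData

open PetriNet

variable {P T : Type} [Fintype P] {𝒩 : PetriNet P T} (O : OpenData 𝒩)

/-- The bag of a place, or of the deleted place. -/
noncomputable def bag (p : Option P) : P → ℕ := own p + O.res p

/-- The potential. -/
def pot (p : Option P) : ℕ := tot (O.res p)

/-- The tokens of `w` lie on places of maximal potential in the layer before the layer `i`. -/
def Below (i : ℕ) (w : P → ℕ) : Prop := ∀ q, 0 < w q → O.lay (some q) + 1 = i ∧
    ∀ r, O.lay r = O.lay (some q) → O.pot r ≤ O.pot (some q)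

variable {O}

theorem below_res (p : Option P) : O.Below (O.lay p) (O.res p) := O.lower p

theorem below_zero (i : ℕ) : O.Below i 0 := fun _ h => absurd h (lt_irrefl 0)

theorem Below.add {i : ℕ} {w w' : P → ℕ} (h : O.Below i w) (h' : O.Below i w') :
    O.Below i (w + w') := fun q hq => by
  rcases Nat.eq_zero_or_pos (w q) with h0 | h0
  · refine h' q ?_
    rwa [Pi.add_apply, h0, zero_add] at hq
  · exact h q h0

theorem Below.mono {i : ℕ} {w w' : P → ℕ} (h : O.Below i w) (hle : w' ≤ w) : O.Below i w' :=
  fun q hq => h q (hq.trans_le (hle q))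

theorem Below.exists_tot_eq {i : ℕ} {w : P → ℕ} (h : O.Below i w) {n : ℕ} (hn : n ≤ tot w) :
    ∃ w', O.Below i w' ∧ tot w' = n := by
  rcases Nat.eq_zero_or_pos n with rfl | hn0
  · exact ⟨0, below_zero i, tot_zero⟩
  · obtain ⟨q, hq⟩ := exists_pos_of_tot (hn0.trans_le hn)
    refine ⟨n • own (some q), fun x hx => ?_, ?_⟩
    · have : 0 < own (some q) x := by
        rw [Pi.smul_apply, smul_eq_mul] at hx
        exact Nat.pos_of_mul_pos_left hx
      cases own_pos this
      exact h q hq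
    · have := tot_own q
      unfold tot at this ⊢
      simp only [Pi.smul_apply, smul_eq_mul]
      rw [← Finset.mul_sum, this, mul_one]

theorem Below.eq_zero {w : P → ℕ} (h : O.Below 0 w) : w = 0 := by
  funext q
  by_contra hne
  have := (h q (Nat.pos_of_ne_zero hne)).1
  omega

theorem reach_bag {p p' : Option P} (h : O.lay p = O.lay p') :
    O.bag p' ∈ 𝒩.ReachSet (O.bag p) := by
  refine ReflTransGen.mono (fun a b => ?_) _ _ (O.path p p' h)
  rintro ⟨t, rfl, rfl⟩
  exact ⟨t, fires_iff.2 ⟨0, (add_zero _).symm, (add_zero _).symm⟩⟩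

theorem reversible (O : OpenData 𝒩) : 𝒩.Reversible := by
  intro t
  obtain ⟨p, p', h, e, e'⟩ := O.trans t
  rw [e, e']
  exact reach_bag h.symm

/-! ### Stocks of tokens that make a layer freely movable. -/

variable (O)

/-- With the help of the tokens in `c`, the tokens in layer `i` can be moved freely. -/
structure Good (i : ℕ) (c : P → ℕ) : Prop where
  supp : ∀ q, 0 < c q → O.lay (some q) < i
  -- Passing from the bag of `p` to that of `p'` consumes `pot p` tokens in the layer below and
  -- returns `pot p'`. This is the only balance required; the stock `c` covers temporary shortages.
  move : ∀ p p', O.lay p = i → O.lay p' = i → ∀ w w', O.Below i w → O.Below i w' →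
    tot w' + O.pot p' = tot w + O.pot p → c + own p' + w ∈ 𝒩.ReachSet (c + own p + w')

variable {O}

theorem good_zero : O.Good 0 0 := by
  refine ⟨fun q h => absurd h (lt_irrefl 0), fun p p' hp hp' w w' hw hw' _ => ?_⟩
  have e : ∀ p, O.lay p = 0 → O.bag p = own p := fun p hp => by
    have := below_res (O := O) p
    rw [hp] at this
    rw [bag, this.eq_zero, add_zero]
  have := reach_bag (hp.trans hp'.symm)
  rw [e p hp, e p' hp'] at this
  rwa [hw.eq_zero, hw'.eq_zero, zero_add, zero_add, add_zero, add_zero]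

/-- Places of maximal potential in one layer have equal potentials, so exchanging one for another
has no net cost below. Tokens are moved one at a time. -/
theorem Good.redistribute {i : ℕ} {c : P → ℕ} (hc : O.Good i c) {w w' : P → ℕ}
    (hw : O.Below (i + 1) w) (hw' : O.Below (i + 1) w') (h : tot w = tot w') :
    c + w' ∈ 𝒩.ReachSet (c + w) := by
  induction hn : tot w generalizing w w' with
  | zero =>
    rw [tot_eq_zero.1 hn, tot_eq_zero.1 (h.symm.trans hn)]
    exact mem_reachSet_self _
  | succ n ih =>
    obtain ⟨q, hq⟩ := exists_pos_of_tot (w := w) (by omega)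
    obtain ⟨q', hq'⟩ := exists_pos_of_tot (w := w') (by omega)
    obtain ⟨v, rfl⟩ := exists_add_of_le (own_le hq)
    obtain ⟨v', rfl⟩ := exists_add_of_le (own_le hq')
    obtain ⟨l1, m1⟩ := hw q hq
    obtain ⟨l2, m2⟩ := hw' q' hq'
    have hp : O.pot (some q') = O.pot (some q) := le_antisymm (m1 _ (by omega)) (m2 _ (by omega))
    have r1 := hc.move (some q) (some q') (by omega) (by omega) 0 0 (below_zero _) (below_zero _)
      (by rw [hp])
    rw [add_zero, add_zero] at r1
    have r2 := ih (hw.mono le_add_self) (hw'.mono le_add_self) (by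
      rw [tot_add, tot_add, tot_own, tot_own] at h; omega) (by
      rw [tot_add, tot_own] at hn; omega)
    rw [← add_assoc, ← add_assoc]
    refine reach_trans (reach_add r1 v) ?_
    rw [add_right_comm c _ v, add_right_comm c _ v']
    exact reach_add r2 _

/-- The stock `ζ` is as large as any potential in layer `i + 1`. So `ζ + w'` can be rearranged to
contain `res p`, the bag of `p` is turned into that of `p'`, and the returned tokens are rearranged
to restore `ζ`. -/
theorem Good.succ {i : ℕ} {c ζ : P → ℕ} (hc : O.Good i c) (hζ : O.Below (i + 1) ζ)
    (hpot : ∀ p, O.lay p = i + 1 → O.pot p ≤ tot ζ) : O.Good (i + 1) (c + ζ) := by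
  refine ⟨fun q hq => ?_, fun p p' hp hp' w w' hw hw' h => ?_⟩
  · rcases Nat.eq_zero_or_pos (c q) with h0 | h0
    · have := (hζ q (by rwa [Pi.add_apply, h0, zero_add] at hq)).1
      omega
    · have := hc.supp q h0
      omega
  · have hρ := below_res (O := O) p
    have hρ' := below_res (O := O) p'
    rw [hp] at hρ
    rw [hp'] at hρ'
    have hb := hζ.add hw'
    have hle := hpot p hp
    obtain ⟨ξ, hξ, tξ⟩ := hb.exists_tot_eq (n := tot (ζ + w') - O.pot p) (Nat.sub_le _ _)
    rw [tot_add] at tξ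
    have r1 := hc.redistribute hb (hρ.add hξ) (by
      rw [tot_add, tot_add]
      change _ = O.pot p + tot ξ
      omega)
    have r2 := hc.redistribute (hρ'.add hξ) (hζ.add hw) (by
      rw [tot_add, tot_add]
      change O.pot p' + tot ξ = _
      omega)
    have r3 := reach_bag (O := O) (hp.trans hp'.symm)
    have e1 : c + ζ + own p + w' = c + (ζ + w') + own p := by abel
    have e2 : c + (O.res p + ξ) + own p = O.bag p + (c + ξ) := by rw [bag]; abel
    have e3 : O.bag p' + (c + ξ) = c + (O.res p' + ξ) + own p' := by rw [bag]; abel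
    have e4 : c + (ζ + w) + own p' = c + ζ + own p' + w := by abel
    rw [e1, ← e4]
    refine reach_trans (reach_add r1 _) ?_
    rw [e2]
    refine reach_trans (reach_add r3 _) ?_
    rw [e3]
    exact reach_add r2 _

theorem exists_max (O : OpenData 𝒩) {i : ℕ} (hi : i ≤ O.lay none) :
    ∃ z, O.lay z = i ∧ ∀ r, O.lay r = i → O.pot r ≤ O.pot z := by
  classical
  obtain ⟨p, hp⟩ := O.surj i hi
  obtain ⟨z, hz, hmax⟩ := Finset.exists_max_image (Finset.univ.filter fun p => O.lay p = i) O.pot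
    ⟨p, by simp [hp]⟩
  exact ⟨z, by simpa using hz, fun r hr => hmax r (by simp [hr])⟩

/-! ### Building the stock from liveness. -/

variable (O)

/-- The part of a marking in the layer `i`. -/
noncomputable def inLay (i : ℕ) (m : P → ℕ) : P → ℕ := part (fun q => O.lay (some q) = i) m

/-- `y` agrees with `m` above the layer `i`; in layer `i` it has the same number of tokens, all of
them on places of maximal potential. -/
structure Sim (i : ℕ) (m y : P → ℕ) : Prop where
  above : ∀ q, i < O.lay (some q) → y q = m q
  below : O.Below (i + 1) (O.inLay i y)
  count : tot (O.inLay i y) = tot (O.inLay i m)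

variable {O}

theorem inLay_of {i : ℕ} {m : P → ℕ} {q : P} (h : O.lay (some q) = i) : O.inLay i m q = m q :=
  if_pos h

theorem inLay_not {i : ℕ} {m : P → ℕ} {q : P} (h : O.lay (some q) ≠ i) : O.inLay i m q = 0 :=
  if_neg h

theorem inLay_add (i : ℕ) (m m' : P → ℕ) : O.inLay i (m + m') = O.inLay i m + O.inLay i m' :=
  part_add _ _ _

theorem inLay_eq_zero {i : ℕ} {m : P → ℕ} (h : ∀ q, 0 < m q → O.lay (some q) ≠ i) :
    O.inLay i m = 0 := by
  funext q
  by_cases hq : O.lay (some q) = i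
  · rw [inLay_of hq]
    by_contra hne
    exact h q (Nat.pos_of_ne_zero hne) hq
  · exact inLay_not hq

theorem inLay_own {i : ℕ} {q : P} (h : O.lay (some q) = i) :
    O.inLay i (own (some q)) = own (some q) := by
  funext x
  by_cases hx : O.lay (some x) = i
  · exact inLay_of hx
  · rw [inLay_not hx, own_ne]
    intro h'
    cases h'
    exact hx h

theorem inLay_own_ne {i : ℕ} {p : Option P} (h : O.lay p ≠ i) : O.inLay i (own p) = 0 :=
  inLay_eq_zero fun q hq => by rwa [← own_pos hq]

theorem Below.inLay {i : ℕ} {w : P → ℕ} (h : O.Below (i + 1) w) : O.inLay i w = w := by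
  funext q
  by_cases hq : O.lay (some q) = i
  · exact inLay_of hq
  · rw [inLay_not hq]
    by_contra hne
    have := (h q (Nat.pos_of_ne_zero (Ne.symm hne))).1
    omega

theorem Below.inLay_ne {i j : ℕ} {w : P → ℕ} (h : O.Below j w) (hj : j ≠ i + 1) :
    O.inLay i w = 0 := inLay_eq_zero fun q hq hl => hj (by rw [← hl]; exact (h q hq).1.symm)

/-- Each token of layer `i` is moved to a place of maximal potential. This cannot fail for lack of
resources, since the potential does not decrease; the surplus falls into the layer below, which
`Sim` ignores. -/
theorem Good.exists_sim {i : ℕ} {c : P → ℕ} (hc : O.Good i c) (hi : i < O.lay none)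
    (u : P → ℕ) : ∃ y, c + y ∈ 𝒩.ReachSet (c + u) ∧ O.Sim i u y := by
  induction u using token_induction with
  | h0 =>
    refine ⟨0, mem_reachSet_self _, fun _ _ => rfl, ?_, rfl⟩
    rw [inLay_eq_zero (m := 0) fun q hq => absurd hq (lt_irrefl 0)]
    exact below_zero _
  | h1 q u ih =>
    obtain ⟨y, hy, s1, s2, s3⟩ := ih
    have r := reach_add hy (own (some q))
    rw [add_assoc c u, add_comm u, add_assoc c y] at r
    by_cases hq : O.lay (some q) = i
    · obtain ⟨z, hz, hmax⟩ := O.exists_max hi.le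
      obtain ⟨x, rfl⟩ : ∃ x, z = some x := by
        cases z with
        | none => omega
        | some x => exact ⟨x, rfl⟩
      have hρ := below_res (O := O) (some x)
      rw [hz] at hρ
      have hle := hmax _ hq
      obtain ⟨w, hw, tw⟩ := hρ.exists_tot_eq (n := O.pot (some x) - O.pot (some q))
        (Nat.sub_le _ _)
      have mv := reach_add (hc.move (some q) (some x) hq hz w 0 hw (below_zero _)
        (by rw [tot_zero]; omega)) y
      have hwz : O.inLay i w = 0 := hw.inLay_ne (by omega)
      refine ⟨own (some x) + w + y, reach_trans r ?_, fun v hv => ?_, ?_, ?_⟩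
      · rw [add_zero, add_right_comm c, add_assoc c y] at mv
        rwa [← add_assoc c (own (some x) + w) y, ← add_assoc c (own (some x)) w]
      · have h1 : own (some x) v = 0 := own_ne fun h => by rw [← h] at hv; omega
        have h2 : own (some q) v = 0 := own_ne fun h => by rw [← h] at hv; omega
        have h3 : w v = 0 := by
          by_contra hne
          have := (hw v (Nat.pos_of_ne_zero hne)).1
          omega
        simp only [Pi.add_apply, h1, h2, h3, s1 v hv]
      · rw [inLay_add, inLay_add, hwz, inLay_own hz, add_zero]
        refine Below.add (fun v hv => ?_) s2
        cases own_pos hv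
        exact ⟨by omega, fun r hr => hmax r (by omega)⟩
      · rw [inLay_add, inLay_add, hwz, inLay_own hz, add_zero, inLay_add, inLay_own hq, tot_add,
          tot_add, tot_own, tot_own, s3]
    · refine ⟨y + own (some q), r, fun v hv => ?_, ?_, ?_⟩
      · simp only [Pi.add_apply, s1 v hv]
        exact add_comm _ _
      · rw [inLay_add, inLay_own_ne hq, add_zero]
        exact s2
      · rw [inLay_add, inLay_own_ne hq, add_zero, inLay_add, inLay_own_ne hq, zero_add, s3]

theorem below_inLay_bag {i : ℕ} {p : Option P} (h : i < O.lay p) :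
    O.Below (i + 1) (O.inLay i (O.bag p)) := by
  rw [bag, inLay_add, inLay_own_ne h.ne', zero_add]
  by_cases hi : O.lay p = i + 1
  · have := below_res (O := O) p
    rw [hi] at this
    rwa [this.inLay]
  · rw [(below_res p).inLay_ne hi]
    exact below_zero _

/-- The tokens below the bag of a place above layer `i` can be made available. -/
theorem Good.gather {i : ℕ} {c y m : P → ℕ} (hc : O.Good i c) (hs : O.Sim i m y)
    {w : P → ℕ} (hw : w ≤ m) (hb : O.Below (i + 1) (O.inLay i w))
    (hlow : ∀ q, 0 < w q → i ≤ O.lay (some q)) :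
    ∃ v, c + (w + v) ∈ 𝒩.ReachSet (c + y) ∧ (∀ q, i < O.lay (some q) → w q + v q = m q) ∧
      O.Below (i + 1) (O.inLay i v) ∧
      tot (O.inLay i w) + tot (O.inLay i v) = tot (O.inLay i m) := by
  have hle : tot (O.inLay i w) ≤ tot (O.inLay i y) := by
    rw [hs.count]
    exact tot_mono (part_mono _ hw)
  obtain ⟨ξ, hξ, tξ⟩ := hs.below.exists_tot_eq (n := tot (O.inLay i y) - tot (O.inLay i w))
    (Nat.sub_le _ _)
  have r := hc.redistribute hs.below (hb.add hξ) (by rw [tot_add]; omega)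
  let S : P → Prop := fun q => O.lay (some q) = i
  let yo := part (fun q => ¬ S q) y
  let wo := part (fun q => ¬ S q) w
  have hy : O.inLay i y + yo = y := part_add_part_not _ _
  have hw' : O.inLay i w + wo = w := part_add_part_not _ _
  have hwo : wo ≤ yo := by
    intro q
    by_cases hq : S q
    · exact (part_not (S := fun q => ¬ S q) (not_not.2 hq)).trans_le (Nat.zero_le _)
    · rcases Nat.eq_zero_or_pos (w q) with h0 | h0
      · have : wo q = w q := part_of (S := fun q => ¬ S q) hq
        exact (this.trans h0).trans_le (Nat.zero_le _)
      · have hq' : i < O.lay (some q) := lt_of_le_of_ne (hlow q h0) fun h => hq h.symm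
        have e1 : wo q = w q := part_of (S := fun q => ¬ S q) hq
        have e2 : yo q = y q := part_of (S := fun q => ¬ S q) hq
        rw [e1, e2, hs.above q hq']
        exact hw q
  obtain ⟨d, hd⟩ := exists_add_of_le hwo
  have hξz : ∀ q, i < O.lay (some q) → ξ q = 0 := fun q hq => by
    by_contra hne
    have := (hξ q (Nat.pos_of_ne_zero hne)).1
    omega
  have hdz : O.inLay i d = 0 := inLay_eq_zero fun q hq hl => by
    have h1 : yo q = 0 := part_not (not_not.2 hl)
    have h2 : yo q = wo q + d q := congrFun hd q
    omega
  refine ⟨ξ + d, ?_, fun q hq => ?_, ?_, ?_⟩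
  · have := reach_add r yo
    rw [add_assoc c, hy] at this
    have e : c + (O.inLay i w + ξ) + yo = c + (w + (ξ + d)) := by
      rw [hd]
      nth_rewrite 2 [← hw']
      abel
    rwa [e] at this
  · have e1 : wo q = w q := part_of (S := fun q => ¬ S q) hq.ne'
    have e2 : yo q = y q := part_of (S := fun q => ¬ S q) hq.ne'
    have h2 : yo q = wo q + d q := congrFun hd q
    have := hs.above q hq
    simp only [Pi.add_apply, hξz q hq]
    omega
  · rw [inLay_add, hdz, add_zero, hξ.inLay]
    exact hξ
  · rw [inLay_add, hdz, add_zero, hξ.inLay, ← hs.count]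
    omega

theorem bag_pos_lay {p : Option P} {q : P} (h : 0 < O.bag p q) :
    O.lay (some q) ≤ O.lay p ∧ O.lay p ≤ O.lay (some q) + 1 := by
  rcases Nat.eq_zero_or_pos (own p q) with h0 | h0
  · have h1 : 0 < O.res p q := by
      have : O.bag p q = own p q + O.res p q := rfl
      omega
    have := (below_res p q h1).1
    omega
  · rw [own_pos h0]
    omega

/-- A run is imitated without spending `c`. Before a firing above layer `i` its bag is gathered from
the interchangeable tokens. A firing in layer `i` or below changes neither the tokens above nor the
number of tokens in layer `i`, and is skipped. -/
theorem Good.sim_reach {i : ℕ} {c u : P → ℕ} (hc : O.Good i c) (hi : i < O.lay none)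
    {m : P → ℕ} (hm : m ∈ 𝒩.ReachSet (c + u)) :
    ∃ y, c + y ∈ 𝒩.ReachSet (c + u) ∧ O.Sim i m y := by
  induction hm with
  | refl =>
    obtain ⟨y, hy, s1, s2, s3⟩ := hc.exists_sim hi u
    have hcz : O.inLay i c = 0 := inLay_eq_zero fun q hq => (hc.supp q hq).ne
    refine ⟨y, hy, fun q hq => ?_, s2, ?_⟩
    · have : c q = 0 := by
        by_contra hne
        have := hc.supp q (Nat.pos_of_ne_zero hne)
        omega
      rw [s1 q hq, Pi.add_apply, this, zero_add]
    · rw [inLay_add, hcz, zero_add, s3]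
  | tail _ e ih =>
    obtain ⟨t, ht⟩ := e
    obtain ⟨g, rfl, rfl⟩ := fires_iff.1 ht
    obtain ⟨p, p', hl, e1, e2⟩ := O.trans t
    obtain ⟨y, hy, hs⟩ := ih
    change 𝒩.pre t = O.bag p at e1
    change 𝒩.post t = O.bag p' at e2
    rw [e1] at hs
    rw [e2]
    rcases Nat.lt_or_ge i (O.lay p) with hj | hj
    · obtain ⟨v, r, h1, h2, h3⟩ := hc.gather hs (w := O.bag p) le_self_add (below_inLay_bag hj)
        fun q hq => by have := bag_pos_lay hq; omega
      refine ⟨O.bag p' + v, reach_trans (reach_trans hy r) ?_, fun q hq => ?_, ?_, ?_⟩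
      · rw [add_left_comm, add_left_comm c]
        exact reach_add (reach_bag hl) _
      · have := h1 q hq
        simp only [Pi.add_apply] at this ⊢
        omega
      · rw [inLay_add]
        exact (below_inLay_bag (hl ▸ hj)).add h2
      · rw [inLay_add, tot_add, inLay_add, tot_add]
        rw [inLay_add, tot_add] at h3
        omega
    · have key : ∀ p, O.lay p ≤ i → (∀ q, i < O.lay (some q) → O.bag p q = 0) ∧
          tot (O.inLay i (O.bag p)) = if O.lay p = i then 1 else 0 := by
        intro p hp
        constructor
        · intro q hq
          by_contra hne
          have := bag_pos_lay (Nat.pos_of_ne_zero hne)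
          omega
        · rw [bag, inLay_add, (below_res p).inLay_ne (by omega), add_zero]
          split_ifs with h
          · cases p with
            | none => omega
            | some q => rw [inLay_own h, tot_own]
          · rw [inLay_own_ne h, tot_zero]
      obtain ⟨k1, k2⟩ := key p hj
      obtain ⟨k1', k2'⟩ := key p' (hl ▸ hj)
      refine ⟨y, hy, fun q hq => ?_, hs.below, ?_⟩
      · rw [hs.above q hq, Pi.add_apply, Pi.add_apply, k1 q hq, k1' q hq]
      · rw [hs.count, inLay_add, inLay_add, tot_add, tot_add, k2, k2', hl]

theorem exists_le_of_live {m₀ : P → ℕ} (hlive : 𝒩.Live m₀) (p : Option P) {m : P → ℕ}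
    (hm : m ∈ 𝒩.ReachSet m₀) : ∃ m' ∈ 𝒩.ReachSet m, O.bag p ≤ m' := by
  obtain ⟨t, ht⟩ := O.used p
  obtain ⟨m', hm', hen⟩ := hlive t m hm
  rcases ht with ht | ht
  · exact ⟨m', hm', fun q => by rw [bag, ← ht]; exact hen q⟩
  · obtain ⟨u, rfl⟩ := exists_add_of_le (show 𝒩.pre t ≤ m' from hen)
    refine ⟨𝒩.post t + u, mem_of_mem_pre hm', ?_⟩
    rw [bag, ← ht]
    exact le_self_add

/-- Liveness marks the bag of a place `z` of maximal potential in the next layer. Imitating the run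
that leads there keeps the old stock `c` and leaves `res z` beside it, which is the required
addition to the stock. -/
theorem exists_good {m₀ : P → ℕ} (hlive : 𝒩.Live m₀) {i : ℕ} (hi : i ≤ O.lay none) :
    ∃ c u, O.Good i c ∧ c + u ∈ 𝒩.ReachSet m₀ := by
  induction i with
  | zero => exact ⟨0, m₀, good_zero, by rw [zero_add]; exact mem_reachSet_self _⟩
  | succ i ih =>
    obtain ⟨c, u, hc, hu⟩ := ih (by omega)
    obtain ⟨z, hz, hmax⟩ := O.exists_max hi
    obtain ⟨m, hm, hle⟩ := exists_le_of_live (O := O) hlive z hu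
    obtain ⟨y, hy, hs⟩ := hc.sim_reach (by omega) hm
    have hρ := below_res (O := O) z
    rw [hz] at hρ
    obtain ⟨v, r, -⟩ := hc.gather hs (w := O.res z) (le_trans le_add_self hle)
      (by rw [hρ.inLay]; exact hρ) fun q hq => by have := (hρ q hq).1; omega
    refine ⟨c + O.res z, v, hc.succ hρ hmax, ?_⟩
    rw [add_assoc]
    exact reach_trans hu (reach_trans hy r)

/-- Tokens in the top layer together with tokens below can be absorbed if they balance. -/
theorem Good.absorb {c : P → ℕ} (hc : O.Good (O.lay none) c) {a b b' : P → ℕ}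
    (ha : ∀ q, 0 < a q → O.lay (some q) = O.lay none) (hb : O.Below (O.lay none) b)
    (hb' : O.Below (O.lay none) b')
    (h : tot b + tot a * O.pot none = tot b' + ∑ q, a q * O.pot (some q)) :
    c + b' ∈ 𝒩.ReachSet (c + (a + b)) := by
  induction hn : tot a generalizing a b with
  | zero =>
    rw [tot_eq_zero.1 hn] at h ⊢
    have := hc.move none none rfl rfl b' b hb' hb (by simp [tot_zero] at h; omega)
    rw [own_none, add_zero] at this
    rwa [zero_add]
  | succ n ih =>
    -- If every token of `a` had a potential above `tot b + pot none`, the right side of the balance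
    -- would be too large. So some token can be exchanged for the deleted place at once, leaving a
    -- non-negative remainder below.
    have hq : ∃ q, 0 < a q ∧ O.pot (some q) ≤ tot b + O.pot none := by
      by_contra hcon
      push Not at hcon
      have h1 : ∑ q, a q * (tot b + O.pot none + 1) ≤ ∑ q, a q * O.pot (some q) :=
        Finset.sum_le_sum fun q _ => by
          rcases Nat.eq_zero_or_pos (a q) with h0 | h0
          · rw [h0]; simp
          · exact Nat.mul_le_mul_left _ (hcon q h0)
      rw [← Finset.sum_mul] at h1
      change tot a * _ ≤ _ at h1
      rw [mul_add, mul_add, hn] at h1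
      rw [hn] at h
      have : tot b ≤ (n + 1) * tot b := Nat.le_mul_of_pos_left _ (Nat.succ_pos n)
      omega
    obtain ⟨q, hq, hpq⟩ := hq
    obtain ⟨d, rfl⟩ := exists_add_of_le (own_le hq)
    obtain ⟨b₁, hb₁, tb₁⟩ := (hb.add (below_res none)).exists_tot_eq
      (n := tot b + O.pot none - O.pot (some q)) (by
        rw [tot_add]; change _ ≤ tot b + O.pot none; omega)
    have hl := ha q hq
    have mv := hc.move (some q) none hl rfl b₁ b hb₁ hb (by omega)
    rw [tot_add, tot_own] at hn
    have r := ih (a := d) (b := b₁) (fun x hx => ha x (hx.trans_le le_add_self)) hb₁ (by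
      rw [tot_add, tot_own] at h
      have e : ∑ x, (own (some q) + d) x * O.pot (some x)
          = O.pot (some q) + ∑ x, d x * O.pot (some x) := by
        simp only [Pi.add_apply, add_mul, Finset.sum_add_distrib]
        congr 1
        rw [Finset.sum_eq_single q]
        · rw [own_some_self, one_mul]
        · intro x _ hx
          rw [own_ne fun h => hx (Option.some.inj h).symm, zero_mul]
        · simp
      rw [e, add_mul, one_mul] at h
      omega) (by omega)
    refine reach_trans ?_ r
    have := reach_add mv d
    rw [own_none, add_zero] at this
    have e1 : c + own (some q) + b + d = c + (own (some q) + d + b) := by abel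
    have e2 : c + b₁ + d = c + (d + b₁) := by abel
    rwa [e1, e2] at this

end OpenData

/-! ### Product form and the criterion for ergodicity -/

/-- The value of a linear functional. -/
def dot {P : Type} [Fintype P] (ξ : P → ℝ) (m : P → ℕ) : ℝ := ∑ q, ξ q * m q

section Dot

variable {P : Type} [Fintype P]

theorem dot_add (ξ : P → ℝ) (m m' : P → ℕ) : dot ξ (m + m') = dot ξ m + dot ξ m' := by
  simp [dot, mul_add, Finset.sum_add_distrib]

theorem dot_zero (ξ : P → ℝ) : dot ξ 0 = 0 := by simp [dot]

theorem dot_nsmul (ξ : P → ℝ) (j : ℕ) (m : P → ℕ) : dot ξ (j • m) = j * dot ξ m := by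
  simp only [dot, Pi.smul_apply, smul_eq_mul, Finset.mul_sum, Nat.cast_mul]
  exact Finset.sum_congr rfl fun q _ => by ring

theorem add_dot (ξ η : P → ℝ) (m : P → ℕ) : dot (fun q => ξ q + η q) m = dot ξ m + dot η m := by
  simp [dot, add_mul, Finset.sum_add_distrib]

theorem mul_dot (c : ℝ) (ξ : P → ℝ) (m : P → ℕ) : dot (fun q => c * ξ q) m = c * dot ξ m := by
  simp [dot, mul_assoc, Finset.mul_sum]

theorem dot_own (ξ : P → ℝ) (q : P) : dot ξ (own (some q)) = ξ q := by
  unfold dot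
  rw [Finset.sum_eq_single q]
  · rw [own_some_self]; simp
  · intro x _ hx
    rw [own_ne fun h => hx (Option.some.inj h).symm]; simp
  · simp

theorem dot_const_on {ξ : P → ℝ} {m : P → ℕ} {c : ℝ} (h : ∀ q, 0 < m q → ξ q = c) :
    dot ξ m = c * tot m := by
  unfold dot tot
  rw [Nat.cast_sum, Finset.mul_sum]
  refine Finset.sum_congr rfl fun q _ => ?_
  rcases Nat.eq_zero_or_pos (m q) with h0 | h0
  · simp [h0]
  · rw [h q h0]

/-- Geometric series in several variables. -/
theorem summable_exp_dot {ξ : P → ℝ} (h : ∀ q, ξ q < 0) :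
    Summable (fun m : P → ℕ => Real.exp (dot ξ m)) := by
  classical
  have hx : ∀ q, Real.exp (ξ q) < 1 := fun q => by rw [Real.exp_lt_one_iff]; exact h q
  have key : ∀ m : P → ℕ, Real.exp (dot ξ m) = ∏ q, Real.exp (ξ q) ^ m q := fun m => by
    rw [dot, Real.exp_sum]
    exact Finset.prod_congr rfl fun q _ => by rw [mul_comm, Real.exp_nat_mul]
  refine summable_of_sum_le (c := ∏ q, (1 - Real.exp (ξ q))⁻¹) (fun m => (Real.exp_pos _).le)
    fun u => ?_
  let M := u.sup (fun m => tot m) + 1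
  have hsub : u ⊆ Fintype.piFinset fun _ : P => Finset.range M := by
    intro m hm
    rw [Fintype.mem_piFinset]
    intro q
    have h1 : tot m ≤ u.sup (fun m => tot m) := Finset.le_sup (f := fun m => tot m) hm
    have h2 : m q ≤ tot m := Finset.single_le_sum (fun _ _ => Nat.zero_le _) (Finset.mem_univ q)
    simp only [Finset.mem_range, M]
    omega
  refine (Finset.sum_le_sum_of_subset_of_nonneg hsub fun m _ _ => (Real.exp_pos _).le).trans ?_
  simp only [key]
  rw [← Finset.prod_univ_sum (fun _ : P => Finset.range M) fun q n => Real.exp (ξ q) ^ n]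
  refine Finset.prod_le_prod (fun q _ => Finset.sum_nonneg fun n _ => by positivity) fun q _ => ?_
  rw [← tsum_geometric_of_lt_one (Real.exp_pos _).le (hx q)]
  exact (summable_geometric_of_lt_one (Real.exp_pos _).le (hx q)).sum_le_tsum _
    fun n _ => by positivity

end Dot

namespace PetriNet

variable {P T : Type} [Fintype P] (𝒩 : PetriNet P T)

/-- Along every transition, the functional `ξ` changes as prescribed by the function `g`. -/
def Valid (g : (P → ℕ) → ℝ) (ξ : P → ℝ) : Prop :=
  ∀ t, dot ξ (𝒩.pre t) - g (𝒩.pre t) = dot ξ (𝒩.post t) - g (𝒩.post t)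

open scoped Classical in
/-- The measure `exp g` on bags satisfies the balance equations in every marking. -/
def BagBalance [Fintype T] (rate : T → ℝ) (g : (P → ℕ) → ℝ) : Prop :=
  ∀ m, ∑ t, rate t * (if 𝒩.post t ≤ m then Real.exp (g (𝒩.pre t) - g (𝒩.post t)) else 0) =
    𝒩.exitRate rate m

variable {𝒩}

/-- By validity, the measure of `pre t + u` relative to that of `post t + u` is the quotient of the
bag weights, whatever `u` is. So global balance in `m` is `exp (dot ξ m)` times bag balance in `m`.
-/
theorem BagBalance.balanced [Fintype T] {rate : T → ℝ} {g : (P → ℕ) → ℝ} {ξ : P → ℝ}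
    (hg : 𝒩.BagBalance rate g) (hξ : 𝒩.Valid g ξ) :
    𝒩.Balanced rate (fun m => Real.exp (dot ξ m)) := by
  intro m
  rw [← hg m, Finset.mul_sum]
  refine Finset.sum_congr rfl fun t _ => ?_
  split_ifs with h
  · obtain ⟨u, rfl⟩ := exists_add_of_le h
    rw [add_tsub_cancel_left, mul_left_comm, ← Real.exp_add]
    change rate t * Real.exp (dot ξ (u + 𝒩.pre t)) = _
    rw [dot_add, dot_add]
    congr 2
    linarith [hξ t]
  · ring

end PetriNet

namespace OpenData

open PetriNet

variable {P T : Type} [Fintype P] {𝒩 : PetriNet P T} (O : OpenData 𝒩)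

/-! ### Place invariants and the existence of valid functionals. -/

/-- The maximal potential of a place in the layer `i`. -/
noncomputable def maxPot (i : ℕ) : ℕ := by
  classical exact (Finset.univ.filter fun p => O.lay p = i).sup O.pot

/-- The invariant that counts the tokens in the bounded part of the net. -/
noncomputable def lowerInv (q : P) : ℝ :=
  (if O.lay (some q) + 2 ≤ O.lay none then 1 else 0) +
    if O.lay (some q) + 1 ≤ O.lay none then
      ((O.maxPot (O.lay (some q)) - O.pot (some q) : ℕ) : ℝ) else 0

/-- The invariant that couples the two uppermost layers. -/
noncomputable def topInv (q : P) : ℝ :=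
  if O.lay (some q) + 1 = O.lay none then 1
  else if O.lay (some q) = O.lay none then (O.pot none : ℝ) - O.pot (some q) else 0

/-- The places of maximal potential in the layer below the top. -/
def IsSupply (u : P) : Prop := O.lay (some u) + 1 = O.lay none ∧
  ∀ r, O.lay r = O.lay (some u) → O.pot r ≤ O.pot (some u)

variable {O}

theorem pot_le_maxPot (p : Option P) : O.pot p ≤ O.maxPot (O.lay p) := by
  classical exact Finset.le_sup (f := O.pot) (by simp)

theorem maxPot_eq {p : Option P} (h : ∀ r, O.lay r = O.lay p → O.pot r ≤ O.pot p) :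
    O.maxPot (O.lay p) = O.pot p := by
  classical
  exact le_antisymm (Finset.sup_le fun r hr => h r (by simpa using hr)) (pot_le_maxPot p)

/-- The value depends on the layer only: what a place lacks to the maximal potential is made up by
its `pot p` resources, each of weight one as long as `p` lies below the top. -/
theorem dot_lowerInv_bag (p : Option P) : dot O.lowerInv (O.bag p) =
    if O.lay p + 1 ≤ O.lay none then
      (if O.lay p + 2 ≤ O.lay none then 1 else 0) + (O.maxPot (O.lay p) : ℝ) else 0 := by
  have hres : dot O.lowerInv (O.res p) = (if O.lay p + 1 ≤ O.lay none then 1 else 0) * O.pot p := by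
    refine dot_const_on fun q hq => ?_
    obtain ⟨h1, h2⟩ := below_res p q hq
    unfold lowerInv
    rw [maxPot_eq h2, Nat.sub_self, Nat.cast_zero, ite_self, add_zero, ← h1]
  rw [bag, dot_add, hres]
  cases p with
  | none => rw [own_none, dot_zero]; simp
  | some q =>
    rw [dot_own, lowerInv, Nat.cast_sub (pot_le_maxPot _)]
    split_ifs <;> first | omega | ring

/-- In the top layer the summand `- pot p` of a place is compensated by its `pot p` resources of
weight one. What remains is `pot none`, also for the stripped bag of the deleted place. -/
theorem dot_topInv_bag (p : Option P) : dot O.topInv (O.bag p) =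
    if O.lay p + 1 = O.lay none then 1 else if O.lay p = O.lay none then (O.pot none : ℝ) else 0 := by
  have hres : dot O.topInv (O.res p) = (if O.lay p = O.lay none then 1 else 0) * O.pot p := by
    refine dot_const_on fun q hq => ?_
    obtain ⟨h1, h2⟩ := below_res p q hq
    have := O.top p
    unfold topInv
    rw [h1]
    split_ifs <;> first | rfl | omega
  rw [bag, dot_add, hres]
  cases p with
  | none => rw [own_none, dot_zero]; simp
  | some q =>
    rw [dot_own, topInv]
    split_ifs <;> first | omega | ring

theorem valid_add {g : (P → ℕ) → ℝ} {ξ η : P → ℝ} (hξ : 𝒩.Valid g ξ)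
    (hη : ∀ t, dot η (𝒩.pre t) = dot η (𝒩.post t)) : 𝒩.Valid g (fun q => ξ q + η q) := by
  intro t
  rw [add_dot, add_dot, hη t]
  linarith [hξ t]

theorem dot_lowerInv_trans (t : T) : dot O.lowerInv (𝒩.pre t) = dot O.lowerInv (𝒩.post t) := by
  obtain ⟨p, p', h, e1, e2⟩ := O.trans t
  rw [e1, e2]
  exact (dot_lowerInv_bag p).trans (by rw [h]; exact (dot_lowerInv_bag p').symm)

theorem dot_topInv_trans (t : T) : dot O.topInv (𝒩.pre t) = dot O.topInv (𝒩.post t) := by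
  obtain ⟨p, p', h, e1, e2⟩ := O.trans t
  rw [e1, e2]
  exact (dot_topInv_bag p).trans (by rw [h]; exact (dot_topInv_bag p').symm)

/-- The system is triangular with ones on the diagonal: the resources of a place lie in the layer
below, so the layers are solved one after the other. -/
theorem exists_solution (O : OpenData 𝒩) (f : P → ℝ) (i : ℕ) :
    ∃ ξ : P → ℝ, ∀ q, O.lay (some q) < i → dot ξ (O.bag (some q)) = f q := by
  classical
  induction i with
  | zero => exact ⟨0, fun q h => by omega⟩
  | succ i ih =>
    obtain ⟨ξ, hξ⟩ := ih
    let ξ' : P → ℝ := fun q => if O.lay (some q) = i then f q - dot ξ (O.res (some q)) else ξ q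
    have hres : ∀ q, O.lay (some q) ≤ i → dot ξ' (O.res (some q)) = dot ξ (O.res (some q)) := by
      intro q hq
      refine Finset.sum_congr rfl fun x _ => ?_
      rcases Nat.eq_zero_or_pos (O.res (some q) x) with h0 | h0
      · rw [h0]; simp
      · have := (below_res _ x h0).1
        simp only [ξ']
        rw [if_neg (by omega)]
    refine ⟨ξ', fun q hq => ?_⟩
    rw [bag, dot_add, dot_own, hres q (by omega)]
    by_cases hqi : O.lay (some q) = i
    · simp only [ξ', if_pos hqi]
      ring
    · have := hξ q (by omega)
      rw [bag, dot_add, dot_own] at this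
      simp only [ξ', if_neg hqi]
      exact this

/-- The triangular system fits `ξ` to the bags of all remaining places; the bag of the deleted place
is one equation too many. Validity only concerns differences within a layer, and adding a constant
`κ` on the top layer shifts all top bags except the stripped one, which makes the constants agree.
-/
theorem exists_valid (O : OpenData 𝒩) (g : (P → ℕ) → ℝ) : ∃ ξ, 𝒩.Valid g ξ := by
  classical
  obtain ⟨ξ, hξ⟩ := O.exists_solution (fun q => g (O.bag (some q))) (O.lay none + 1)
  let κ := dot ξ (O.res none) - g (O.bag none)
  let η : P → ℝ := fun q => if O.lay (some q) = O.lay none then κ else 0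
  have hη : ∀ p, dot η (O.res p) = 0 := by
    intro p
    rw [dot_const_on (c := 0), zero_mul]
    intro q hq
    have := (below_res p q hq).1
    have := O.top p
    exact if_neg (by omega)
  have key : ∀ p, dot (fun q => ξ q + η q) (O.bag p) - g (O.bag p) =
      if O.lay p = O.lay none then κ else 0 := by
    intro p
    cases p with
    | none =>
      rw [if_pos rfl, add_dot, bag, own_none, zero_add, hη, add_zero]
      simp only [κ, bag, own_none, zero_add]
    | some q =>
      rw [add_dot, hξ q (Nat.lt_succ_of_le (O.top _)), bag, dot_add, hη, dot_own]
      simp only [η]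
      ring
  refine ⟨fun q => ξ q + η q, fun t => ?_⟩
  obtain ⟨p, p', h, e1, e2⟩ := O.trans t
  rw [e1, e2]
  exact (key p).trans (by rw [h]; exact (key p').symm)

theorem lowerInv_nonneg (q : P) : 0 ≤ O.lowerInv q := by
  unfold lowerInv
  split_ifs <;> positivity

/-! ### Necessity and sufficiency of the inequalities on the extreme rays. -/

/-- If an invariant direction has a constant weight, this weight is negative in an ergodic net. -/
theorem neg_of_ergodic [Fintype T] (O : OpenData 𝒩) {rate : T → ℝ} (hrate : ∀ t, 0 < rate t)
    {m₀ : P → ℕ} (hlive : 𝒩.Live m₀) {g : (P → ℕ) → ℝ} (hg : 𝒩.BagBalance rate g)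
    (he : 𝒩.Ergodic rate m₀) {r : P → ℕ} (hr : r ≠ 0) {l : ℝ}
    (hl : ∀ ξ, 𝒩.Valid g ξ → dot ξ r = l) : l < 0 := by
  obtain ⟨ξ, hξ⟩ := O.exists_valid g
  -- Adding an invariant to `ξ` keeps it valid, so the constant weight makes `r` orthogonal to every
  -- invariant.
  have hY : dot O.lowerInv r = 0 := by
    have h1 := hl _ (valid_add hξ (dot_lowerInv_trans (O := O)))
    rw [add_dot, hl ξ hξ] at h1
    linarith
  have hD : dot O.topInv r = 0 := by
    have h1 := hl _ (valid_add hξ (dot_topInv_trans (O := O)))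
    rw [add_dot, hl ξ hξ] at h1
    linarith
  have hY' : ∀ q, 0 < r q → O.lowerInv q = 0 := by
    intro q hq
    have := (Finset.sum_eq_zero_iff_of_nonneg fun q _ =>
      mul_nonneg (lowerInv_nonneg q) (Nat.cast_nonneg (r q))).1 hY q (Finset.mem_univ q)
    exact (mul_eq_zero.1 this).resolve_right (by exact_mod_cast hq.ne')
  let S : P → Prop := fun q => O.lay (some q) = O.lay none
  let a := part S r
  let b := part (fun q => ¬ S q) r
  have hab : a + b = r := part_add_part_not S r
  have ha : ∀ q, 0 < a q → O.lay (some q) = O.lay none := fun q hq => by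
    by_contra h
    exact hq.ne' (part_not (S := S) h)
  have hb : ∀ q, 0 < b q → O.IsSupply q := by
    intro q hq
    have hS : ¬ S q := fun h => hq.ne' (part_not (S := fun q => ¬ S q) (not_not.2 h))
    have hr : 0 < r q := by
      have e : b q = r q := part_of (S := fun q => ¬ S q) hS
      omega
    have h0 := hY' q hr
    have htop := O.top (some q)
    have hlt : O.lay (some q) + 1 ≤ O.lay none := lt_of_le_of_ne htop hS
    unfold lowerInv at h0
    rw [if_pos hlt] at h0
    have hn : ¬ O.lay (some q) + 2 ≤ O.lay none := fun h => by
      rw [if_pos h] at h0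
      have : (0 : ℝ) ≤ ((O.maxPot (O.lay (some q)) - O.pot (some q) : ℕ) : ℝ) := Nat.cast_nonneg _
      linarith
    rw [if_neg hn, zero_add, Nat.cast_eq_zero] at h0
    refine ⟨by omega, fun p hp => ?_⟩
    have := pot_le_maxPot (O := O) p
    rw [hp] at this
    omega
  have hsum : tot b + tot a * O.pot none = tot (0 : P → ℕ) + ∑ q, a q * O.pot (some q) := by
    have e1 : dot O.topInv b = tot b := by
      rw [dot_const_on (c := 1), one_mul]
      intro q hq
      exact if_pos (hb q hq).1
    have e2 : dot O.topInv a = tot a * O.pot none - ∑ q, (a q : ℝ) * O.pot (some q) := by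
      unfold tot
      rw [Nat.cast_sum, Finset.sum_mul, ← Finset.sum_sub_distrib]
      refine Finset.sum_congr rfl fun q _ => ?_
      rcases Nat.eq_zero_or_pos (a q) with h0 | h0
      · rw [h0]; simp
      · have := ha q h0
        rw [topInv, if_neg (by omega), if_pos this]
        ring
    rw [← hab, dot_add, e1, e2] at hD
    have : (tot b : ℝ) + tot a * O.pot none = ∑ q, (a q : ℝ) * O.pot (some q) := by linarith
    rw [tot_zero, zero_add]
    exact_mod_cast this
  obtain ⟨c, u, hc, hu⟩ := exists_good (O := O) hlive le_rfl
  -- The direction `r` can be absorbed next to `c`, hence by reversibility also produced from `c`,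
  -- and this arbitrarily often.
  have hstep := O.reversible.symm (hc.absorb ha hb (below_zero _) hsum)
  rw [hab, add_zero] at hstep
  have hreach : ∀ j : ℕ, c + u + j • r ∈ 𝒩.ReachSet m₀ := by
    intro j
    induction j with
    | zero => rwa [zero_smul, add_zero]
    | succ j ih =>
      have := reach_add hstep (u + j • r)
      rw [← add_assoc] at this
      refine reach_trans ih ?_
      have e : c + u + (j + 1) • r = c + r + (u + j • r) := by rw [succ_nsmul]; abel
      rwa [e]
  have hs := ((hg.balanced hξ).ergodic_iff O.reversible hrate fun m => Real.exp_pos _).1 he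
  obtain ⟨q, hq⟩ : ∃ q, r q ≠ 0 := by
    by_contra hcon
    push Not at hcon
    exact hr (funext hcon)
  have hinj : Function.Injective fun j : ℕ => c + u + j • r := by
    intro i j hij
    have := congrFun (add_left_cancel hij) q
    simp only [Pi.smul_apply, smul_eq_mul] at this
    exact Nat.eq_of_mul_eq_mul_right (Nat.pos_of_ne_zero hq) this
  have hs' := hs.comp_injective hinj
  have e : ((𝒩.ReachSet m₀).indicator fun m => Real.exp (dot ξ m)) ∘ (fun j : ℕ => c + u + j • r) =
      fun j : ℕ => Real.exp (dot ξ (c + u)) * Real.exp l ^ j := by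
    funext j
    rw [Function.comp_apply, Set.indicator_of_mem (hreach j), dot_add, dot_nsmul, hl ξ hξ,
      Real.exp_add, Real.exp_nat_mul]
  rw [e] at hs'
  have hgeo := (summable_mul_left_iff (Real.exp_pos (dot ξ (c + u))).ne').1 hs'
  have := summable_geometric_iff_norm_lt_one.1 hgeo
  rwa [Real.norm_of_nonneg (Real.exp_pos _).le, Real.exp_lt_one_iff] at this

/-- The hypotheses are the result of eliminating `τ` from the inequalities `ξ + τ * topInv < 0` on
the top layer and the supply: each lower bound for `τ` lies below each upper bound. A large multiple
of `lowerInv` then makes the remaining values negative as well. -/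
theorem ergodic_of_neg [Fintype T] (O : OpenData 𝒩) {rate : T → ℝ} (hrate : ∀ t, 0 < rate t)
    {m₀ : P → ℕ} {g : (P → ℕ) → ℝ} (hg : 𝒩.BagBalance rate g) {ξ : P → ℝ} (hξ : 𝒩.Valid g ξ)
    (h1 : ∀ p u, O.lay (some p) = O.lay none → O.pot none ≤ O.pot (some p) →
      (O.IsSupply u ∨ ∀ v, ¬ O.IsSupply v) →
      ξ p + ((O.pot (some p) : ℝ) - O.pot none) * ξ u < 0)
    (h2 : ∀ p p' u, O.lay (some p) = O.lay none → O.lay (some p') = O.lay none → O.IsSupply u →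
      O.pot none < O.pot (some p) → O.pot (some p') < O.pot none →
      ((O.pot none : ℝ) - O.pot (some p')) * ξ p + ((O.pot (some p) : ℝ) - O.pot none) * ξ p' < 0) :
    𝒩.Ergodic rate m₀ := by
  classical
  have hsup : ∀ p, O.lay p = O.lay none → 0 < O.pot p → ∃ u, O.IsSupply u := by
    intro p hp h0
    obtain ⟨u, hu⟩ := exists_pos_of_tot h0
    have := below_res p u hu
    rw [hp] at this
    exact ⟨u, this⟩
  let lo : Finset ℝ := (Finset.univ.filter fun p => O.lay (some p) = O.lay none ∧
    O.pot none < O.pot (some p)).image fun p => ξ p / ((O.pot (some p) : ℝ) - O.pot none)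
  let hi1 : Finset ℝ := (Finset.univ.filter fun u => O.IsSupply u).image fun u => -ξ u
  let hi2 : Finset ℝ := (Finset.univ.filter fun p => O.lay (some p) = O.lay none ∧
    O.pot (some p) < O.pot none).image fun p => -ξ p / ((O.pot none : ℝ) - O.pot (some p))
  -- Top places of potential above `pot none` bound `τ` from below; supply places and top places of
  -- smaller potential bound it from above.
  obtain ⟨τ, hτ1, hτ2⟩ : ∃ τ, (∀ x ∈ lo, x < τ) ∧ ∀ y ∈ hi1 ∪ hi2, τ < y := by
    refine Order.exists_between_finsets lo (hi1 ∪ hi2) fun x hx y hy => ?_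
    obtain ⟨p, hp, rfl⟩ := Finset.mem_image.1 hx
    obtain ⟨hp1, hp2⟩ := (Finset.mem_filter.1 hp).2
    have hd : (0 : ℝ) < (O.pot (some p) : ℝ) - O.pot none := by
      rw [sub_pos]; exact_mod_cast hp2
    rw [div_lt_iff₀ hd]
    rcases Finset.mem_union.1 hy with hy | hy
    · obtain ⟨u, hu, rfl⟩ := Finset.mem_image.1 hy
      have := h1 p u hp1 hp2.le (.inl (Finset.mem_filter.1 hu).2)
      linarith
    · obtain ⟨p', hp', rfl⟩ := Finset.mem_image.1 hy
      obtain ⟨hq1, hq2⟩ := (Finset.mem_filter.1 hp').2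
      obtain ⟨u, hu⟩ := hsup none rfl (by omega)
      have hd' : (0 : ℝ) < (O.pot none : ℝ) - O.pot (some p') := by
        rw [sub_pos]; exact_mod_cast hq2
      have := h2 p p' u hp1 hq1 hu hp2 hq2
      rw [div_mul_eq_mul_div, lt_div_iff₀ hd']
      linarith
  have htop : ∀ p, O.lay (some p) = O.lay none → ξ p + τ * O.topInv p < 0 := by
    intro p hp
    rw [topInv, if_neg (by omega), if_pos hp]
    rcases lt_trichotomy (O.pot none) (O.pot (some p)) with h | h | h
    · have hd : (0 : ℝ) < (O.pot (some p) : ℝ) - O.pot none := by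
        rw [sub_pos]; exact_mod_cast h
      have := hτ1 _ (Finset.mem_image_of_mem _ (Finset.mem_filter.2 ⟨Finset.mem_univ p, hp, h⟩))
      rw [div_lt_iff₀ hd] at this
      linarith
    · rw [h, sub_self, mul_zero, add_zero]
      by_cases hu : ∃ u, O.IsSupply u
      · obtain ⟨u, hu⟩ := hu
        have := h1 p u hp h.le (.inl hu)
        rwa [h, sub_self, zero_mul, add_zero] at this
      · push Not at hu
        -- Without supply the second place is a dummy, since its coefficient vanishes; any place,
        -- here `p` itself, can be used.
        have := h1 p p hp h.le (.inr hu)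
        rwa [h, sub_self, zero_mul, add_zero] at this
    · have hd : (0 : ℝ) < (O.pot none : ℝ) - O.pot (some p) := by
        rw [sub_pos]; exact_mod_cast h
      have := hτ2 _ (Finset.mem_union_right _
        (Finset.mem_image_of_mem _ (Finset.mem_filter.2 ⟨Finset.mem_univ p, hp, h⟩)))
      rw [lt_div_iff₀ hd] at this
      linarith
  have hsupply : ∀ u, O.IsSupply u → ξ u + τ * O.topInv u < 0 := by
    intro u hu
    have := hτ2 _ (Finset.mem_union_left _
      (Finset.mem_image_of_mem _ (Finset.mem_filter.2 ⟨Finset.mem_univ u, hu⟩)))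
    rw [topInv, if_pos hu.1]
    linarith
  let η : P → ℝ := fun q => ξ q + τ * O.topInv q
  -- This exceeds every value of `η`, while `lowerInv` is at least `1` outside the top layer and the
  -- supply.
  let K := 1 + ∑ q, |η q|
  let ζ : P → ℝ := fun q => η q + -K * O.lowerInv q
  have hK : ∀ q, η q < K := fun q => by
    have : |η q| ≤ ∑ q, |η q| :=
      Finset.single_le_sum (f := fun q => |η q|) (fun _ _ => abs_nonneg _) (Finset.mem_univ q)
    have := le_abs_self (η q)
    simp only [K]
    linarith
  have hK0 : 0 < K := by
    have : 0 ≤ ∑ q, |η q| := Finset.sum_nonneg fun _ _ => abs_nonneg _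
    simp only [K]
    linarith
  have hζ : ∀ q, ζ q < 0 := by
    intro q
    have hlow := O.top (some q)
    by_cases hq : O.lay (some q) = O.lay none
    · have e : O.lowerInv q = 0 := by
        rw [lowerInv, if_neg (by omega), if_neg (by omega), add_zero]
      simp only [ζ]
      rw [e, mul_zero, add_zero]
      exact htop q hq
    · by_cases hs : O.IsSupply q
      · have e : O.lowerInv q = 0 := by
          rw [lowerInv, if_neg (by have := hs.1; omega), maxPot_eq hs.2]
          simp
        simp only [ζ]
        rw [e, mul_zero, add_zero]
        exact hsupply q hs
      · have hone : 1 ≤ O.lowerInv q := by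
          rw [lowerInv, if_pos (show O.lay (some q) + 1 ≤ O.lay none by omega)]
          have hnn : (0 : ℝ) ≤ ((O.maxPot (O.lay (some q)) - O.pot (some q) : ℕ) : ℝ) :=
            Nat.cast_nonneg _
          split_ifs with h
          · linarith
          · rw [zero_add]
            have hne : O.maxPot (O.lay (some q)) ≠ O.pot (some q) := fun he =>
              hs ⟨by omega, fun r hr => by
                rw [← he, ← hr]; exact pot_le_maxPot r⟩
            have := pot_le_maxPot (O := O) (some q)
            have h1 : 1 ≤ O.maxPot (O.lay (some q)) - O.pot (some q) := by omega
            exact_mod_cast h1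
        have := hK q
        simp only [ζ]
        nlinarith
  have hval : 𝒩.Valid g ζ := by
    refine valid_add (η := fun q => -K * O.lowerInv q)
      (valid_add (η := fun q => τ * O.topInv q) hξ fun t => ?_) fun t => ?_
    · rw [mul_dot, mul_dot, dot_topInv_trans]
    · rw [mul_dot, mul_dot, dot_lowerInv_trans]
  refine ((hg.balanced hval).ergodic_iff O.reversible hrate fun m => Real.exp_pos _).2 ?_
  exact (summable_exp_dot hζ).indicator _

end OpenData

/-! ### The traffic equations on half-edges -/

namespace MarkedSPN

open Finset Relation PetriNet Elimination

variable {n k : ℕ} (I : MarkedSPN n k)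

/-- The number of tokens that the bag of the half-edge `h` has on the place `q`; the half-edges
`t` and `k + t` are the two ends of the transition `t`. -/
noncomputable def half (h q : ℕ) : ℕ :=
  if h < k then I.initState.nmem 0 h q else I.initState.nmem 1 (h - k) q

/-- The bag of a half-edge. -/
noncomputable def bagAt (h : ℕ) : Fin n → ℕ := fun q => I.half h q

/-- Two half-edges have the same bag. -/
def Same (h h' : ℕ) : Prop := ∀ q < n, I.half h q = I.half h' q

/-- The half-edge is the first one with its bag. -/
def IsRep (h : ℕ) : Prop := ∀ h' < h, ¬ I.Same h' h

/-- The first half-edge with the bag `b`. -/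
noncomputable def repr (b : Fin n → ℕ) : ℕ := sInf {h | I.bagAt h = b}

open scoped Classical in
/-- The rates between representatives of the bags. -/
noncomputable def rates (a b : ℕ) : ℝ :=
  ∑ t ∈ range k, if (I.IsRep a ∧ I.IsRep b) ∧ I.Same t a ∧ I.Same (k + t) b then
    I.initState.rmem 0 0 t else 0

/-- The solution of the traffic equations, with one row for every starting state. -/
noncomputable def solution : ℕ → ℕ → ℝ :=
  backTab (elim (k + k) I.rates) (k + k)

/-- A positive solution of the traffic equations. -/
noncomputable def weight (h : ℕ) : ℝ := ∑ c ∈ range (k + k), I.solution c h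

/-- The logarithm of the weight of a bag. -/
noncomputable def logWeight (b : Fin n → ℕ) : ℝ := Real.log (I.weight (I.repr b))

variable {I}

/-- This allows the index `n` to stand for no place at all in the comparisons with the deleted
place. -/
theorem half_of_le {h q : ℕ} (hq : n ≤ q) : I.half h q = 0 := by
  simp [half, initState, hq.not_gt]

theorem bagAt_pre (t : Fin k) : I.bagAt t = I.net.pre t := by
  funext q
  simp [bagAt, half, initState]

theorem bagAt_post (t : Fin k) : I.bagAt (k + t) = I.net.post t := by
  funext q
  simp [bagAt, half, initState]

theorem same_iff {h h' : ℕ} : I.Same h h' ↔ I.bagAt h = I.bagAt h' := by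
  constructor
  · exact fun H => funext fun q => H q q.2
  · exact fun H q hq => congrFun H ⟨q, hq⟩

theorem bagAt_repr (h : ℕ) : I.bagAt (I.repr (I.bagAt h)) = I.bagAt h :=
  Nat.sInf_mem (s := {x | I.bagAt x = I.bagAt h}) ⟨h, rfl⟩

/-- The left side is what the program can test; the right side is what the proofs use. -/
theorem rep_same_iff {a h : ℕ} : I.IsRep a ∧ I.Same h a ↔ I.repr (I.bagAt h) = a := by
  constructor
  · rintro ⟨h1, h2⟩
    refine le_antisymm (Nat.sInf_le (same_iff.1 h2).symm) ?_
    by_contra hlt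
    exact h1 _ (not_le.1 hlt) (same_iff.2 ((bagAt_repr h).trans (same_iff.1 h2)))
  · rintro rfl
    have := bagAt_repr (I := I) h
    exact ⟨fun h' hlt hs => (Nat.notMem_of_lt_sInf hlt) ((same_iff.1 hs).trans this),
      same_iff.2 this.symm⟩

theorem repr_le (h : ℕ) : I.repr (I.bagAt h) ≤ h := Nat.sInf_le rfl

theorem repr_pre_lt (t : Fin k) : I.repr (I.net.pre t) < k + k := by
  rw [← bagAt_pre]
  exact (repr_le _).trans_lt (by omega)

theorem repr_post_lt (t : Fin k) : I.repr (I.net.post t) < k + k := by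
  rw [← bagAt_post]
  exact (repr_le _).trans_lt (by omega)

open scoped Classical in
theorem rates_eq (a b : ℕ) : I.rates a b =
    ∑ t, if I.repr (I.net.pre t) = a ∧ I.repr (I.net.post t) = b then I.rate t else 0 := by
  rw [rates, ← Fin.sum_univ_eq_sum_range (fun t => if (I.IsRep a ∧ I.IsRep b) ∧ I.Same t a ∧
    I.Same (k + t) b then I.initState.rmem 0 0 t else 0)]
  refine sum_congr rfl fun t _ => ?_
  refine if_congr ?_ (by simp [initState]) rfl
  rw [← bagAt_pre, ← bagAt_post, ← rep_same_iff, ← rep_same_iff]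
  tauto

theorem rates_nonneg (a b : ℕ) : 0 ≤ I.rates a b := by
  rw [rates_eq]
  refine sum_nonneg fun t _ => ?_
  split_ifs
  · exact (I.rate_pos t).le
  · exact le_rfl

theorem rates_eq_zero {a b : ℕ} (h : ¬ (a < k + k ∧ b < k + k)) : I.rates a b = 0 := by
  rw [rates_eq]
  refine sum_eq_zero fun t _ => if_neg ?_
  rintro ⟨rfl, rfl⟩
  exact h ⟨repr_pre_lt t, repr_post_lt t⟩

theorem edge_trans (t : Fin k) :
    Edge (k + k) I.rates (I.repr (I.net.pre t)) (I.repr (I.net.post t)) := by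
  classical
  refine ⟨repr_pre_lt t, repr_post_lt t, ?_⟩
  rw [rates_eq]
  refine sum_pos' (fun t _ => ?_) ⟨t, mem_univ t, ?_⟩
  · split_ifs
    · exact (I.rate_pos _).le
    · exact le_rfl
  · rw [if_pos ⟨rfl, rfl⟩]
    exact I.rate_pos t

theorem path_repr {b b' : Fin n → ℕ} (h : ReflTransGen I.net.BagEdge b b') :
    ReflTransGen (Edge (k + k) I.rates) (I.repr b) (I.repr b') := by
  refine h.lift I.repr fun b b' => ?_
  rintro ⟨t, rfl, rfl⟩
  exact edge_trans t

theorem exists_of_edge {a b : ℕ} (h : Edge (k + k) I.rates a b) :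
    ∃ t, I.repr (I.net.pre t) = a ∧ I.repr (I.net.post t) = b := by
  by_contra hne
  push Not at hne
  refine h.2.2.ne' ?_
  rw [rates_eq]
  exact sum_eq_zero fun t _ => if_neg fun ht => hne t ht.1 ht.2

/-- Stripping the deleted token can make bags of different layers coincide, so components may merge.
This does no harm, as paths of bags still map to paths of representatives. -/
theorem weakRev (O : OpenData I.net) : WeakRev (k + k) I.rates := by
  intro a b h
  obtain ⟨t, rfl, rfl⟩ := exists_of_edge h
  obtain ⟨p, p', hl, e1, e2⟩ := O.trans t
  rw [e1, e2]
  exact path_repr (O.path p' p hl.symm)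

theorem solves (O : OpenData I.net) : Solves (k + k) I.rates I.solution :=
  Solves.backTab rates_nonneg (weakRev O)

theorem weight_pos (O : OpenData I.net) {h : ℕ} (hh : h < k + k) : 0 < I.weight h :=
  (solves O).sum_pos hh

/-- Both sides of bag balance are sums over transitions of functions of the two bags; this rewrites
them as sums over pairs of representatives, where stationarity applies. -/
theorem sum_rates_mul (f : ℕ → ℕ → ℝ) :
    ∑ a ∈ range (k + k), ∑ b ∈ range (k + k), I.rates a b * f a b =
      ∑ t, I.rate t * f (I.repr (I.net.pre t)) (I.repr (I.net.post t)) := by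
  classical
  simp only [rates_eq, sum_mul, ite_mul, zero_mul]
  rw [sum_congr rfl fun a _ => sum_comm, sum_comm]
  refine sum_congr rfl fun t _ => ?_
  rw [sum_eq_single_of_mem _ (mem_range.2 (repr_pre_lt t)), sum_eq_single_of_mem _
    (mem_range.2 (repr_post_lt t)), if_pos ⟨rfl, rfl⟩]
  · exact fun b _ hb => if_neg fun h => hb h.2.symm
  · exact fun a _ ha => sum_eq_zero fun b _ => if_neg fun h => ha h.1.symm

theorem bagAt_repr_pre (t : Fin k) : I.bagAt (I.repr (I.net.pre t)) = I.net.pre t := by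
  rw [← bagAt_pre, bagAt_repr]

theorem bagAt_repr_post (t : Fin k) : I.bagAt (I.repr (I.net.post t)) = I.net.post t := by
  rw [← bagAt_post, bagAt_repr]

/-- Group the incoming side by the target bag `b` and the outgoing side by the source bag `b`.
Whether `b` fits into `m` is a common factor of each group, so the traffic equation at `b` equates
the two groups. -/
theorem bagBalance (O : OpenData I.net) : I.net.BagBalance I.rate I.logWeight := by
  classical
  intro m
  have hst := (solves O).sum_stationary
  have h1 : ∀ t, I.rate t * (if I.net.post t ≤ m then
      Real.exp (I.logWeight (I.net.pre t) - I.logWeight (I.net.post t)) else 0) =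
      I.rate t * (fun a b => I.weight a * ((if I.bagAt b ≤ m then 1 else 0) / I.weight b))
        (I.repr (I.net.pre t)) (I.repr (I.net.post t)) := by
    intro t
    simp only [bagAt_repr_post]
    split_ifs
    · rw [Real.exp_sub, logWeight, logWeight, Real.exp_log (weight_pos O (repr_pre_lt t)),
        Real.exp_log (weight_pos O (repr_post_lt t))]
      ring
    · simp
  have h2 : ∀ t, I.rate t * (if I.net.pre t ≤ m then (1 : ℝ) else 0) =
      I.rate t * (fun a _ => if I.bagAt a ≤ m then (1 : ℝ) else 0)
        (I.repr (I.net.pre t)) (I.repr (I.net.post t)) := by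
    intro t
    simp only [bagAt_repr_pre]
  rw [exitRate, sum_congr rfl fun t _ => h1 t, sum_congr rfl fun t _ => h2 t]
  refine (sum_rates_mul fun a b => I.weight a * ((if I.bagAt b ≤ m then 1 else 0) /
    I.weight b)).symm.trans (Eq.trans ?_ (sum_rates_mul fun a _ => if I.bagAt a ≤ m then 1 else 0))
  rw [sum_comm]
  refine sum_congr rfl fun b hb => ?_
  have hw := (weight_pos O (mem_range.1 hb)).ne'
  have hs := hst b (mem_range.1 hb)
  change I.weight b * _ = ∑ a ∈ range (k + k), I.weight a * I.rates a b at hs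
  calc ∑ a ∈ range (k + k), I.rates a b *
        (I.weight a * ((if I.bagAt b ≤ m then 1 else 0) / I.weight b)) =
      (∑ a ∈ range (k + k), I.weight a * I.rates a b) *
        ((if I.bagAt b ≤ m then 1 else 0) / I.weight b) := by
        rw [sum_mul]
        exact sum_congr rfl fun a _ => by ring
    _ = _ := by
        rw [← hs, ← sum_mul]
        field_simp

/-- The weights of connected bags are related by every valid functional. -/
theorem Valid.dot_sub_log (O : OpenData I.net) {ξ : Fin n → ℝ} (hξ : I.net.Valid I.logWeight ξ)
    {c h h' : ℕ} (h1 : 0 < I.solution c h) (h2 : 0 < I.solution c h') :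
    dot ξ (I.bagAt h) - Real.log (I.weight h) = dot ξ (I.bagAt h') - Real.log (I.weight h') := by
  have hp := (solves O).path_of_pos (weakRev O) h1 h2
  induction hp with
  | refl => rfl
  | tail hab e ih =>
    have := (solves O).pos_of_path rates_nonneg hab h1
    rw [ih this]
    obtain ⟨t, rfl, rfl⟩ := exists_of_edge e
    rw [bagAt_repr_pre, bagAt_repr_post]
    exact hξ t

end MarkedSPN

/-! ### Certified ratios and the ergodicity test -/

namespace MarkedSPN

open Finset Relation PetriNet Elimination

variable {n k : ℕ} (I : MarkedSPN n k)

/-- The number of tokens of the bag of a half-edge. -/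
noncomputable def tokens (h : ℕ) : ℕ := ∑ q ∈ range n, I.half h q

/-- All tokens of the bag of `h` outside of `z` can be compared with `u`. -/
def Covered (G : ℕ → ℕ → ℝ) (h z u : ℕ) : Prop := ∀ q < n, q ≠ z ∧ 0 < I.half h q → 0 < G q u

/-- The product of the ratios of the tokens outside of `z` and `u`. -/
noncomputable def monomial (G : ℕ → ℕ → ℝ) (h z u : ℕ) : ℝ :=
  ∏ q ∈ range n, if q = z then 1 else G q u ^ I.half h q

/-- The bags of `h` and `h'` are connected, and all their tokens but those on `z` and `z'`
respectively can be compared with `u`. -/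
def Witness (G : ℕ → ℕ → ℝ) (c h h' z z' u : ℕ) : Prop :=
  (0 < I.solution c h ∧ 0 < I.solution c h') ∧ I.half h z = 1 ∧ I.Covered G h z u ∧
    I.Covered G h' z' u

/-- The ratio that is certified by a witness. -/
noncomputable def ratio (G : ℕ → ℕ → ℝ) (h h' z z' u : ℕ) : ℝ :=
  I.weight h / I.weight h' * I.monomial G h' z' u / I.monomial G h z u

/-- The sum of `f` over all witnesses for the comparison of `z` and `z'`. -/
noncomputable def witnessSum (G : ℕ → ℕ → ℝ) (z z' : ℕ) (f : ℕ → ℕ → ℕ → ℝ) : ℝ :=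
  ∑ c ∈ range (k + k), ∑ h ∈ range (k + k), ∑ h' ∈ range (k + k), ∑ u ∈ range n,
    open scoped Classical in
    if I.Witness G c h h' z z' u ∧ I.half h' z' = 1 ∧ I.tokens h = I.tokens h' then f h h' u else 0

/-- One round of comparisons between places: the certified ratios are averaged. -/
noncomputable def compareStep (G : ℕ → ℕ → ℝ) (z z' : ℕ) : ℝ :=
  -- Without a witness this is `0 / 0 = 0`, which marks the pair as not certified.
  I.witnessSum G z z' (fun h h' u => I.ratio G h h' z z' u) / I.witnessSum G z z' fun _ _ _ => 1

/-- The ratios between places that are certified after a number of rounds. -/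
noncomputable def compare : ℕ → ℕ → ℕ → ℝ
  | 0 => fun _ _ => 0
  | m + 1 => updTab n (I.compareStep (compare m)) (compare m)

/-- A place of the top layer with at least as many resources as the deleted place has. -/
def SinglesPass (G : ℕ → ℕ → ℝ) : Prop :=
  ∀ u < n, ∀ c < k + k, ∀ h' < k + k, ∀ p < n, ∀ h < k + k,
    -- The index `n` exempts no place of `h'`, which is in the role of the stripped bag. For the
    -- genuine bags, with `1 + pot p` and `pot none` tokens, the inequality says `pot none ≤ pot p`.
    I.Witness G c h h' p n u ∧ I.tokens h' < I.tokens h → I.ratio G h h' p n u < 1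

/-- Two places of the top layer, with more and with less resources than the deleted place has. -/
def PairsPass (G : ℕ → ℕ → ℝ) : Prop :=
  ∀ u < n, ∀ c < k + k, ∀ h' < k + k, ∀ p < n, ∀ h < k + k, ∀ r < n, ∀ j < k + k,
    ((I.Witness G c h h' p n u ∧ I.tokens h' + 1 < I.tokens h) ∧
      I.Witness G c j h' r n u ∧ I.tokens j < I.tokens h' + 1) →
    -- The exponents are chosen so that the powers of `exp (ξ u)` in the two ratios cancel.
    I.ratio G h h' p n u ^ (I.tokens h' + 1 - I.tokens j) *
      I.ratio G j h' r n u ^ (I.tokens h - (I.tokens h' + 1)) < 1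

/-- The functional `ξ` on the places is valid for the weights of the bags. -/
def Admissible (ξ : ℕ → ℝ) : Prop := I.net.Valid I.logWeight fun q => ξ q

/-- The positive entries of `G` are the exponentials of differences of every valid functional. -/
structure Sound (G : ℕ → ℕ → ℝ) : Prop where
  nonneg : ∀ z u, 0 ≤ G z u
  log_eq : ∀ z < n, ∀ u < n, 0 < G z u → ∀ ξ, I.Admissible ξ → Real.log (G z u) = ξ z - ξ u

variable {I}

theorem dot_bagAt (ξ : ℕ → ℝ) (h : ℕ) :
    dot (fun q : Fin n => ξ q) (I.bagAt h) = ∑ q ∈ range n, ξ q * I.half h q :=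
  Fin.sum_univ_eq_sum_range (fun q => ξ q * (I.half h q : ℝ)) n

theorem tot_bagAt (h : ℕ) : tot (I.bagAt h) = I.tokens h :=
  Fin.sum_univ_eq_sum_range (fun q => I.half h q) n

theorem exists_admissible (O : OpenData I.net) : ∃ ξ, I.Admissible ξ := by
  obtain ⟨ξ, hξ⟩ := O.exists_valid I.logWeight
  refine ⟨fun q => if h : q < n then ξ ⟨q, h⟩ else 0, ?_⟩
  unfold Admissible
  simpa using hξ

theorem Covered.monomial_pos {G : ℕ → ℕ → ℝ} {h z u : ℕ} (hc : I.Covered G h z u) :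
    0 < I.monomial G h z u := by
  refine prod_pos fun q hq => ?_
  split_ifs with hz
  · exact one_pos
  · rcases Nat.eq_zero_or_pos (I.half h q) with h0 | h0
    · rw [h0, pow_zero]
      exact one_pos
    · exact pow_pos (hc q (mem_range.1 hq) ⟨hz, h0⟩) _

theorem Covered.log_monomial {G : ℕ → ℕ → ℝ} (hG : I.Sound G) {h z u : ℕ} (hu : u < n)
    (hc : I.Covered G h z u) {ξ : ℕ → ℝ} (hξ : I.Admissible ξ) :
    Real.log (I.monomial G h z u) = dot (fun q : Fin n => ξ q) (I.bagAt h) - ξ z * I.half h z -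
      ξ u * ((I.tokens h : ℝ) - I.half h z) := by
  have h1 : ∀ q ∈ range n, Real.log (if q = z then 1 else G q u ^ I.half h q) =
      (ξ q - ξ u) * I.half h q - if q = z then (ξ z - ξ u) * I.half h z else 0 := by
    intro q hq
    split_ifs with hz
    · rw [hz, sub_self, Real.log_one]
    · rw [sub_zero, Real.log_pow]
      rcases Nat.eq_zero_or_pos (I.half h q) with h0 | h0
      · simp [h0]
      · rw [hG.log_eq q (mem_range.1 hq) u hu (hc q (mem_range.1 hq) ⟨hz, h0⟩) ξ hξ, mul_comm]
  have h2 : (∑ q ∈ range n, if q = z then (ξ z - ξ u) * (I.half h z : ℝ) else 0) =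
      (ξ z - ξ u) * I.half h z := by
    rw [sum_ite_eq']
    split_ifs with hz
    · rfl
    · rw [half_of_le (by simpa using hz)]
      simp
  rw [monomial, Real.log_prod (fun q hq => ?_), sum_congr rfl h1, sum_sub_distrib, h2, dot_bagAt,
    tokens, Nat.cast_sum]
  · simp only [sub_mul, sum_sub_distrib, ← mul_sum]
    ring
  · split_ifs with hz
    · exact one_ne_zero
    · rcases Nat.eq_zero_or_pos (I.half h q) with h0 | h0
      · simp [h0]
      · exact (pow_pos (hc q (mem_range.1 hq) ⟨hz, h0⟩) _).ne'

theorem Witness.ratio_pos {G : ℕ → ℕ → ℝ} (O : OpenData I.net) {c h h' z z' u : ℕ}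
    (hh : h < k + k) (hh' : h' < k + k) (hw : I.Witness G c h h' z z' u) :
    0 < I.ratio G h h' z z' u :=
  div_pos (mul_pos (div_pos (weight_pos O hh) (weight_pos O hh')) hw.2.2.2.monomial_pos)
    hw.2.2.1.monomial_pos

/-- Connected bags have weights with quotient `exp (ξ · (b - b'))` for their bags `b` and `b'`. The
two monomials replace each token outside of `z` and `z'` by one on `u`, so only the difference of
the token numbers remains as the coefficient of `ξ u`. -/
theorem Witness.log_ratio {G : ℕ → ℕ → ℝ} (hG : I.Sound G) (O : OpenData I.net)
    {c h h' z z' u : ℕ} (hu : u < n) (hh : h < k + k) (hh' : h' < k + k)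
    (hw : I.Witness G c h h' z z' u) {ξ : ℕ → ℝ} (hξ : I.Admissible ξ) :
    Real.log (I.ratio G h h' z z' u) = ξ z - ξ z' * I.half h' z' +
      ξ u * ((I.tokens h : ℝ) - 1 - (I.tokens h' - I.half h' z')) := by
  have w1 := (weight_pos O hh).ne'
  have w2 := (weight_pos O hh').ne'
  have m1 := hw.2.2.1.monomial_pos.ne'
  have m2 := hw.2.2.2.monomial_pos.ne'
  have hd := Valid.dot_sub_log O hξ hw.1.1 hw.1.2
  rw [ratio, Real.log_div (mul_ne_zero (div_ne_zero w1 w2) m2) m1,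
    Real.log_mul (div_ne_zero w1 w2) m2, Real.log_div w1 w2, hw.2.2.1.log_monomial hG hu hξ,
    hw.2.2.2.log_monomial hG hu hξ, hw.2.1]
  push_cast
  linarith

/-- Equal token numbers cancel `u`, so every witness certifies the same value `exp (ξ z - ξ z')`.
Averaging therefore returns this value, and no witness has to be selected. -/
theorem compareStep_eq {G : ℕ → ℕ → ℝ} (hG : I.Sound G) (O : OpenData I.net) {ξ : ℕ → ℝ}
    (hξ : I.Admissible ξ) (z z' : ℕ) :
    I.witnessSum G z z' (fun h h' u => I.ratio G h h' z z' u) =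
      I.witnessSum G z z' (fun _ _ _ => 1) * Real.exp (ξ z - ξ z') := by
  simp only [witnessSum, sum_mul]
  refine sum_congr rfl fun c _ => sum_congr rfl fun h hh => sum_congr rfl fun h' hh' =>
    sum_congr rfl fun u hu => ?_
  split_ifs with hw
  · rw [one_mul, ← Real.exp_log (hw.1.ratio_pos O (mem_range.1 hh) (mem_range.1 hh')),
      hw.1.log_ratio hG O (mem_range.1 hu) (mem_range.1 hh) (mem_range.1 hh') hξ, hw.2.1, hw.2.2]
    simp
  · rw [zero_mul]

theorem witnessSum_nonneg (G : ℕ → ℕ → ℝ) (z z' : ℕ) : 0 ≤ I.witnessSum G z z' fun _ _ _ => 1 := by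
  refine sum_nonneg fun c _ => sum_nonneg fun h _ => sum_nonneg fun h' _ => sum_nonneg fun u _ => ?_
  split_ifs
  · exact zero_le_one
  · exact le_rfl

theorem witnessSum_pos {G : ℕ → ℕ → ℝ} {z z' c h h' u : ℕ} (hc : c < k + k) (hh : h < k + k)
    (hh' : h' < k + k) (hu : u < n) (hw : I.Witness G c h h' z z' u) (h1 : I.half h' z' = 1)
    (ht : I.tokens h = I.tokens h') : 0 < I.witnessSum G z z' fun _ _ _ => 1 := by
  classical
  have aux : ∀ (p : Prop) [Decidable p], (0 : ℝ) ≤ if p then 1 else 0 := fun p _ => by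
    split_ifs
    · exact zero_le_one
    · exact le_rfl
  refine sum_pos' (fun c _ => sum_nonneg fun h _ => sum_nonneg fun h' _ => sum_nonneg fun u _ =>
    aux _) ⟨c, mem_range.2 hc, ?_⟩
  refine sum_pos' (fun h _ => sum_nonneg fun h' _ => sum_nonneg fun u _ =>
    aux _) ⟨h, mem_range.2 hh, ?_⟩
  refine sum_pos' (fun h' _ => sum_nonneg fun u _ => aux _) ⟨h', mem_range.2 hh', ?_⟩
  refine sum_pos' (fun u _ => aux _) ⟨u, mem_range.2 hu, ?_⟩
  rw [if_pos ⟨hw, h1, ht⟩]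
  exact one_pos

theorem sound_compare (O : OpenData I.net) (m : ℕ) : I.Sound (I.compare m) := by
  induction m with
  | zero => exact ⟨fun _ _ => le_rfl, fun _ _ _ _ h => absurd h (lt_irrefl _)⟩
  | succ m ih =>
    constructor
    · intro z u
      obtain ⟨ξ, hξ⟩ := exists_admissible O
      simp only [compare, updTab]
      split_ifs
      · rw [compareStep, compareStep_eq ih O hξ]
        exact div_nonneg (mul_nonneg (witnessSum_nonneg _ _ _) (Real.exp_pos _).le)
          (witnessSum_nonneg _ _ _)
      · exact ih.nonneg z u
    · intro z hz u hu h ξ hξ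
      simp only [compare, updTab, if_pos (And.intro hz hu)] at h ⊢
      rw [compareStep, compareStep_eq ih O hξ] at h ⊢
      have : I.witnessSum (I.compare m) z u (fun _ _ _ => 1) ≠ 0 := by
        intro h0
        simp [h0] at h
      rw [mul_div_cancel_left₀ _ this, Real.log_exp]

theorem compare_succ_pos (O : OpenData I.net) {m z z' c h h' u : ℕ} (hz : z < n) (hz' : z' < n)
    (hc : c < k + k) (hh : h < k + k) (hh' : h' < k + k) (hu : u < n)
    (hw : I.Witness (I.compare m) c h h' z z' u) (h1 : I.half h' z' = 1)
    (ht : I.tokens h = I.tokens h') : 0 < I.compare (m + 1) z z' := by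
  obtain ⟨ξ, hξ⟩ := exists_admissible O
  simp only [compare, updTab, if_pos (And.intro hz hz')]
  rw [compareStep, compareStep_eq (sound_compare O m) O hξ, mul_div_assoc]
  have := witnessSum_pos hc hh hh' hu hw h1 ht
  exact mul_pos this (div_pos (Real.exp_pos _) this)

/-! ### Completeness of the comparisons -/

/-- Every bag occurs, connected bags share a row of the solution. -/
theorem exists_half (O : OpenData I.net) (p : Option (Fin n)) :
    I.repr (O.bag p) < k + k ∧ I.bagAt (I.repr (O.bag p)) = O.bag p := by
  obtain ⟨t, h | h⟩ := O.used p
  · have h' : O.bag p = I.net.pre t := h.symm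
    rw [h']
    exact ⟨repr_pre_lt t, bagAt_repr_pre t⟩
  · have h' : O.bag p = I.net.post t := h.symm
    rw [h']
    exact ⟨repr_post_lt t, bagAt_repr_post t⟩

theorem exists_row (O : OpenData I.net) (p : Option (Fin n)) :
    ∃ c < k + k, ∀ p', O.lay p' = O.lay p → 0 < I.solution c (I.repr (O.bag p')) := by
  obtain ⟨c, hc, h⟩ := (solves O).exists_pos _ (exists_half O p).1
  exact ⟨c, hc, fun p' hp => (solves O).pos_of_path rates_nonneg
    (path_repr (O.path p p' hp.symm)) h⟩

theorem half_repr (O : OpenData I.net) (p : Option (Fin n)) (q : Fin n) :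
    I.half (I.repr (O.bag p)) q = O.bag p q := congrFun (exists_half O p).2 q

theorem tokens_repr_some (O : OpenData I.net) (p : Fin n) :
    I.tokens (I.repr (O.bag (some p))) = 1 + O.pot (some p) := by
  rw [← tot_bagAt, (exists_half O _).2, OpenData.bag, tot_add, tot_own, OpenData.pot]

theorem tokens_repr_none (O : OpenData I.net) : I.tokens (I.repr (O.bag none)) = O.pot none := by
  rw [← tot_bagAt, (exists_half O _).2, OpenData.bag, own_none, zero_add, OpenData.pot]

theorem bag_self (O : OpenData I.net) (p : Fin n) : O.bag (some p) p = 1 := by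
  rw [OpenData.bag, Pi.add_apply, own_some_self]
  have : ¬ 0 < O.res (some p) p := fun h => by
    have := (O.lower _ _ h).1
    omega
  omega

/-- A bag is covered if its resources are. -/
theorem covered_of_res (O : OpenData I.net) {G : ℕ → ℕ → ℝ} {p : Option (Fin n)} {u : Fin n}
    {z : ℕ} (hz : ∀ q, p = some q → z = q) (h : ∀ q : Fin n, 0 < O.res p q → 0 < G q u) :
    I.Covered G (I.repr (O.bag p)) z u := by
  rintro q hq ⟨hqz, hpos⟩
  have := half_repr O p ⟨q, hq⟩
  simp only at this
  rw [this, OpenData.bag, Pi.add_apply, own_ne (fun e => hqz (hz _ e).symm), zero_add] at hpos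
  exact h ⟨q, hq⟩ hpos

/-- All resources of `z` and `z'` lie on places of maximal potential one layer below. By induction
they are comparable with any fixed one of them after one round less, and the two bags have equally
many tokens. So the bags of `z` and `z'` form a witness. -/
theorem compare_pos (O : OpenData I.net) {i m : ℕ} (hm : i < m) {z z' : Fin n}
    (hz : O.lay (some z) = i) (hz' : O.lay (some z') = i)
    (hmax : ∀ r, O.lay r = i → O.pot r ≤ O.pot (some z))
    (hmax' : ∀ r, O.lay r = i → O.pot r ≤ O.pot (some z')) : 0 < I.compare m z z' := by
  induction i generalizing m z z' with
  | zero =>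
    obtain ⟨m, rfl⟩ := Nat.exists_eq_succ_of_ne_zero (by omega : m ≠ 0)
    obtain ⟨c, hc, hrow⟩ := exists_row O (some z)
    have hres : ∀ p : Option (Fin n), O.lay p = 0 → ∀ q, ¬ 0 < O.res p q := fun p hp q hq => by
      have := (O.lower _ _ hq).1
      omega
    refine compare_succ_pos O z.2 z'.2 hc (exists_half O (some z)).1 (exists_half O (some z')).1
      z.2 ⟨⟨hrow _ rfl, hrow _ (hz'.trans hz.symm)⟩, ?_, ?_, ?_⟩ ?_ ?_
    · rw [half_repr, bag_self]
    · exact covered_of_res O (fun q e => by cases e; rfl) fun q hq => absurd hq (hres _ hz q)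
    · exact covered_of_res O (fun q e => by cases e; rfl) fun q hq => absurd hq (hres _ hz' q)
    · rw [half_repr, bag_self]
    · rw [tokens_repr_some, tokens_repr_some, le_antisymm (hmax' _ hz) (hmax _ hz')]
  | succ i ih =>
    obtain ⟨m, rfl⟩ := Nat.exists_eq_succ_of_ne_zero (by omega : m ≠ 0)
    obtain ⟨c, hc, hrow⟩ := exists_row O (some z)
    have hpot : O.pot (some z) = O.pot (some z') := le_antisymm (hmax' _ hz) (hmax _ hz')
    -- The reference place is a resource of `z`. If there are no resources, nothing has to be
    -- covered and any place serves.
    obtain ⟨u, hu⟩ : ∃ u, 0 < O.pot (some z) → 0 < O.res (some z) u := by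
      by_cases h0 : 0 < O.pot (some z)
      · obtain ⟨u, hu⟩ := exists_pos_of_tot h0
        exact ⟨u, fun _ => hu⟩
      · exact ⟨z, fun h => absurd h h0⟩
    have hcov : ∀ p : Option (Fin n), O.lay p = i + 1 → O.pot p = O.pot (some z) →
        ∀ q : Fin n, 0 < O.res p q → 0 < I.compare m q u := by
      intro p hp hpp q hq
      have hq0 : 0 < O.pot p := by
        by_contra h0
        have h0 : tot (O.res p) = 0 := Nat.eq_zero_of_not_pos h0
        rw [tot_eq_zero.1 h0] at hq
        exact absurd hq (lt_irrefl _)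
      have l1 := OpenData.below_res p q hq
      have l2 := OpenData.below_res _ u (hu (hpp ▸ hq0))
      have e1 : O.lay (some q) = i := by omega
      have e2 : O.lay (some u) = i := by omega
      exact ih (by omega) e1 e2 (e1 ▸ l1.2) (e2 ▸ l2.2)
    refine compare_succ_pos O z.2 z'.2 hc (exists_half O (some z)).1 (exists_half O (some z')).1
      u.2 ⟨⟨hrow _ rfl, hrow _ (hz'.trans hz.symm)⟩, ?_, ?_, ?_⟩ ?_ ?_
    · rw [half_repr, bag_self]
    · exact covered_of_res O (fun q e => by cases e; rfl) (hcov _ hz rfl)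
    · exact covered_of_res O (fun q e => by cases e; rfl) (hcov _ hz' hpot.symm)
    · rw [half_repr, bag_self]
    · rw [tokens_repr_some, tokens_repr_some, hpot]

/-- There are `n + 1` places including the deleted one and every layer is inhabited. Hence the
supply has an index below `n`, and `n` rounds of comparisons suffice. -/
theorem top_le (O : OpenData I.net) : O.lay none ≤ n := by
  choose f hf using fun i : Fin (O.lay none + 1) => O.surj i (Nat.lt_succ_iff.1 i.2)
  have hinj : Function.Injective f := fun i j h => Fin.ext (by rw [← hf i, ← hf j, h])
  have := Fintype.card_le_of_injective f hinj
  simp at this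
  omega

/-- The resources of the top layer can be compared with the supply. -/
theorem covered_top (O : OpenData I.net) {p : Option (Fin n)} (hp : O.lay p = O.lay none)
    {u : Fin n} (hu : O.IsSupply u ∨ ∀ v, ¬ O.IsSupply v) {z : ℕ} (hz : ∀ q, p = some q → z = q) :
    I.Covered (I.compare n) (I.repr (O.bag p)) z u := by
  refine covered_of_res O hz fun q hq => ?_
  have l := OpenData.below_res p q hq
  rw [hp] at l
  rcases hu with hu | hu
  · have e : O.lay (some q) = O.lay (some u) := by
      have := hu.1
      omega
    refine compare_pos O (i := O.lay (some u)) ?_ e rfl (e ▸ l.2) hu.2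
    have := top_le O
    have := hu.1
    omega
  · exact absurd l (hu q)

theorem witness_top (O : OpenData I.net) {p : Fin n} (hp : O.lay (some p) = O.lay none)
    {u : Fin n} (hu : O.IsSupply u ∨ ∀ v, ¬ O.IsSupply v) {c : ℕ}
    (hrow : ∀ p', O.lay p' = O.lay none → 0 < I.solution c (I.repr (O.bag p'))) :
    I.Witness (I.compare n) c (I.repr (O.bag (some p))) (I.repr (O.bag none)) p n u :=
  ⟨⟨hrow _ hp, hrow _ rfl⟩, by rw [half_repr, bag_self],
    covered_top O hp hu (fun q e => by cases e; rfl), covered_top O rfl hu (fun q e => by cases e)⟩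

/-! ### Correctness of the test -/

theorem Witness.log_ratio_none {G : ℕ → ℕ → ℝ} (hG : I.Sound G) (O : OpenData I.net)
    {c h h' z u : ℕ} (hu : u < n) (hh : h < k + k) (hh' : h' < k + k)
    (hw : I.Witness G c h h' z n u) {ξ : ℕ → ℝ} (hξ : I.Admissible ξ) :
    Real.log (I.ratio G h h' z n u) = ξ z + ((I.tokens h : ℝ) - 1 - I.tokens h') * ξ u := by
  rw [hw.log_ratio hG O hu hh hh' hξ, half_of_le le_rfl]
  push_cast
  ring

/-- Only genuine witnesses are used, those comparing bags of top places with the stripped bag. The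
logarithms of the tested quantities are then the weights of the extreme rays in `ergodic_of_neg`. -/
theorem ergodic_of_pass (O : OpenData I.net) (h1 : I.SinglesPass (I.compare n))
    (h2 : I.PairsPass (I.compare n)) : I.net.Ergodic I.rate I.init := by
  obtain ⟨ξ, hξ⟩ := exists_admissible O
  have hS := sound_compare O n
  obtain ⟨c, hc, hrow⟩ := exists_row O none
  have hnone := (exists_half O none).1
  have hlog : ∀ (p u : Fin n), O.lay (some p) = O.lay none →
      (O.IsSupply u ∨ ∀ v, ¬ O.IsSupply v) →
      Real.log (I.ratio (I.compare n) (I.repr (O.bag (some p))) (I.repr (O.bag none)) p n u) =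
        ξ p + ((O.pot (some p) : ℝ) - O.pot none) * ξ u := by
    intro p u hp hu
    rw [(witness_top O hp hu hrow).log_ratio_none hS O u.2 (exists_half O _).1 hnone hξ,
      tokens_repr_some, tokens_repr_none]
    push_cast
    ring
  refine OpenData.ergodic_of_neg O I.rate_pos (bagBalance O) hξ ?_ ?_
  · intro p u hp hpot hu
    have hw := witness_top O hp hu hrow
    have := h1 u u.2 c hc _ hnone p p.2 _ (exists_half O (some p)).1 ⟨hw, by
      rw [tokens_repr_some, tokens_repr_none]; omega⟩
    rw [← hlog p u hp hu]
    exact Real.log_neg (hw.ratio_pos O (exists_half O _).1 hnone) this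
  · intro p p' u hp hp' hu hlt hlt'
    have hw := witness_top O hp (.inl hu) hrow
    have hw' := witness_top O hp' (.inl hu) hrow
    have := h2 u u.2 c hc _ hnone p p.2 _ (exists_half O (some p)).1 p' p'.2 _
      (exists_half O (some p')).1 ⟨⟨hw, by rw [tokens_repr_some, tokens_repr_none]; omega⟩, hw', by
        rw [tokens_repr_some, tokens_repr_none]; omega⟩
    have r1 := hw.ratio_pos O (exists_half O _).1 hnone
    have r2 := hw'.ratio_pos O (exists_half O _).1 hnone
    have h3 := Real.log_neg (mul_pos (pow_pos r1 _) (pow_pos r2 _)) this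
    rw [Real.log_mul (pow_pos r1 _).ne' (pow_pos r2 _).ne', Real.log_pow, Real.log_pow,
      hlog p u hp (.inl hu), hlog p' u hp' (.inl hu), tokens_repr_some, tokens_repr_some,
      tokens_repr_none, Nat.cast_sub (by omega), Nat.cast_sub (by omega)] at h3
    push_cast at h3
    linarith

theorem admissible_extend {ξ : Fin n → ℝ} (hξ : I.net.Valid I.logWeight ξ) :
    I.Admissible fun q => if h : q < n then ξ ⟨q, h⟩ else 0 := by
  unfold Admissible
  simpa using hξ

theorem ratio_lt_one (O : OpenData I.net) (hlive : I.net.Live I.init)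
    (he : I.net.Ergodic I.rate I.init) {x : ℝ} (hx : 0 < x) {r : Fin n → ℕ} (hr : r ≠ 0)
    (hl : ∀ ξ, I.Admissible ξ → Real.log x = dot (fun q : Fin n => ξ q) r) : x < 1 := by
  have : Real.log x < 0 := OpenData.neg_of_ergodic O I.rate_pos hlive (bagBalance O) he hr
    fun ξ hξ => by
      have := hl _ (admissible_extend hξ)
      simpa using this.symm
  exact (Real.log_neg_iff hx).1 this

/-- Accidental witnesses, which do not come from the top layer, must pass as well. They do: the
logarithm of each tested quantity is `ξ · r` for every admissible `ξ`, with one and the same `r ≥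
0`, `r ≠ 0`, and nothing else is required by `neg_of_ergodic`. -/
theorem pass_of_ergodic (O : OpenData I.net) (hlive : I.net.Live I.init)
    (he : I.net.Ergodic I.rate I.init) :
    I.SinglesPass (I.compare n) ∧ I.PairsPass (I.compare n) := by
  have hS := sound_compare O n
  constructor
  · rintro u hu c hc h' hh' p hp h hh ⟨hw, hlt⟩
    refine ratio_lt_one O hlive he (hw.ratio_pos O hh hh')
      (r := own (some ⟨p, hp⟩) + (I.tokens h - 1 - I.tokens h') • own (some ⟨u, hu⟩)) ?_ ?_
    · intro h0
      have := congrFun h0 ⟨p, hp⟩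
      simp [own_some_self] at this
    · intro ξ hξ
      rw [hw.log_ratio_none hS O hu hh hh' hξ, dot_add, dot_nsmul, dot_own, dot_own,
        Nat.cast_sub (by omega), Nat.cast_sub (by omega)]
      push_cast
      ring
  · rintro u hu c hc h' hh' p hp h hh r hr j hj ⟨⟨hw, hlt⟩, hw', hlt'⟩
    have r1 := hw.ratio_pos O hh hh'
    have r2 := hw'.ratio_pos O hj hh'
    refine ratio_lt_one O hlive he (mul_pos (pow_pos r1 _) (pow_pos r2 _))
      -- The contributions of `u` cancel, so only `p` and `r` occur in the direction.
      (r := (I.tokens h' + 1 - I.tokens j) • own (some ⟨p, hp⟩) +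
        (I.tokens h - (I.tokens h' + 1)) • own (some ⟨r, hr⟩)) ?_ ?_
    · intro h0
      have := congrFun h0 ⟨p, hp⟩
      simp only [Pi.add_apply, Pi.smul_apply, own_some_self, smul_eq_mul, mul_one,
        Pi.zero_apply] at this
      omega
    · intro ξ hξ
      rw [Real.log_mul (pow_pos r1 _).ne' (pow_pos r2 _).ne', Real.log_pow, Real.log_pow,
        hw.log_ratio_none hS O hu hh hh' hξ, hw'.log_ratio_none hS O hu hj hh' hξ, dot_add,
        dot_nsmul, dot_nsmul, dot_own, dot_own, Nat.cast_sub (by omega), Nat.cast_sub (by omega)]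
      push_cast
      ring

theorem ergodic_iff_pass (O : OpenData I.net) (hlive : I.net.Live I.init) :
    I.net.Ergodic I.rate I.init ↔ I.SinglesPass (I.compare n) ∧ I.PairsPass (I.compare n) :=
  ⟨pass_of_ergodic O hlive, fun h => ergodic_of_pass O h.1 h.2⟩

end MarkedSPN

/-! ### Programs that update tables -/

namespace RealRAM

open Elimination

/-- A loop whose test becomes false after exactly `N` rounds. -/
theorem Run.count {b : Test} {c : Prog} {T N : ℕ} {P : ℕ → State → Prop}
    (hb : ∀ j s, P j s → (b.Holds s ↔ j < N))
    (step : ∀ j < N, ∀ s, P j s → Run c s T (P (j + 1))) {s : State} (h0 : P 0 s) :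
    Run (.loop b c) s (N * (b.cost + T) + b.cost) (P N) := by
  refine (Run.loop (Inv := fun d s => d ≤ N ∧ P (N - d) s) (b := b) (c := c) (T := T) ?_ N s
    ⟨le_rfl, by simpa using h0⟩).mono le_rfl ?_
  · rintro d s ⟨hd, hP⟩ hs
    have hlt := (hb _ _ hP).1 hs
    refine (step _ hlt s hP).mono le_rfl fun s' hs' => ⟨d - 1, by omega, by omega, ?_⟩
    rwa [show N - (d - 1) = N - d + 1 by omega]
  · rintro s ⟨⟨d, -, hd, hP⟩, hs⟩
    rw [hb _ _ hP] at hs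
    rwa [show N - d = N by omega] at hP

/-- Does the expression read the bank `a` for real numbers? -/
def Ex.reads (a : ℕ) : {κ : Kind} → Ex κ → Bool
  | _, .lit _ _ => false
  | _, .var _ => false
  | _, .getN _ i j => i.reads a || j.reads a
  | _, .getR b i j => b == a || i.reads a || j.reads a
  | _, .bin _ e f => e.reads a || f.reads a
  | _, .ltN e f => e.reads a || f.reads a
  | _, .ltR e f => e.reads a || f.reads a
  | _, .ite c e f => c.reads a || e.reads a || f.reads a
  | _, .big _ _ _ _ f => f.reads a
  | _, .pow r e => r.reads a || e.reads a

/-- While a bank is being filled, an expression that does not read it keeps its values. -/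
theorem Ex.eval_update {κ : Kind} (e : Ex κ) {a : ℕ} (h : e.reads a = false)
    (nm : ℕ → ℕ → ℕ → ℕ) (rm : ℕ → ℕ → ℕ → ℝ) (A : ℕ → ℕ → ℝ) (ν : Fin 40 → ℕ) :
    e.eval nm (Function.update rm a A) ν = e.eval nm rm ν := by
  induction e generalizing ν with
  | lit κ c => rfl
  | var x => rfl
  | getN b i j hi hj =>
    simp only [Ex.reads, Bool.or_eq_false_iff] at h
    simp only [Ex.eval, hi h.1, hj h.2]
  | getR b i j hi hj =>
    simp only [Ex.reads, Bool.or_eq_false_iff, beq_eq_false_iff_ne] at h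
    simp only [Ex.eval, hi h.1.2, hj h.2, Function.update_of_ne h.1.1]
  | bin o e f he hf =>
    simp only [Ex.reads, Bool.or_eq_false_iff] at h
    simp only [Ex.eval, he h.1, hf h.2]
  | ltN e f he hf =>
    simp only [Ex.reads, Bool.or_eq_false_iff] at h
    simp only [Ex.eval, he h.1, hf h.2]
  | ltR e f he hf =>
    simp only [Ex.reads, Bool.or_eq_false_iff] at h
    simp only [Ex.eval, he h.1, hf h.2]
  | ite c e f hc he hf =>
    simp only [Ex.reads, Bool.or_eq_false_iff] at h
    simp only [Ex.eval, hc h.1.1, he h.1.2, hf h.2]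
  | big o z x y f hf => simp only [Ex.eval, hf h]
  | pow r e hr he =>
    simp only [Ex.reads, Bool.or_eq_false_iff] at h
    simp only [Ex.eval, hr h.1, he h.2]

/-- Fill the bank `a` with the values of `e`, where the variables `3` and `4` run over the numbers
below the variable `y`. -/
def fill (a : ℕ) (e : Ex .real) (y : Fin 40) : Prog :=
  .seq (.nset 3 (.lit 0)) (.loop (.nlt (.var 3) (.var y)) (.seq (.nset 4 (.lit 0))
    (.seq (.loop (.nlt (.var 4) (.var y)) (.seq (e.comp 40)
      (.seq (.rput a (.var 3) (.var 4) (.var 40)) (.nset 4 (.add (.var 4) (.lit 1))))))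
      (.nset 3 (.add (.var 3) (.lit 1))))))

theorem ne_three {x : Fin 40} (h : x ≠ 3) : (x : ℕ) ≠ 3 := fun hx => h (Fin.ext hx)

theorem ne_four {x : Fin 40} (h : x ≠ 4) : (x : ℕ) ≠ 4 := fun hx => h (Fin.ext hx)

/-- The state `s'` after the cells before `(i, j)` have been filled with `f`. -/
structure Filling (a : ℕ) (f : ℕ → ℕ → ℝ) (N : ℕ) (s : State) (i j : ℕ) (s' : State) : Prop where
  nmem : s'.nmem = s.nmem
  nvar : ∀ x : Fin 40, x ≠ 3 → x ≠ 4 → s'.nvar x = s.nvar x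
  row : s'.nvar 3 = i
  col : s'.nvar 4 = j
  rmem : s'.rmem = Function.update s.rmem a fun x y =>
    if (x < i ∧ y < N) ∨ (x = i ∧ y < j) then f x y else s.rmem a x y

theorem Filling.env {a : ℕ} {f : ℕ → ℕ → ℝ} {N : ℕ} {s s' : State} {i j : ℕ}
    (h : Filling a f N s i j s') :
    s'.env = Function.update (Function.update s.env 3 i) 4 j := by
  funext x
  by_cases h4 : x = 4
  · subst h4
    rw [Function.update_self]
    exact h.col
  · rw [Function.update_of_ne h4]
    by_cases h3 : x = 3
    · subst h3
      rw [Function.update_self]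
      exact h.row
    · rw [Function.update_of_ne h3]
      exact h.nvar x h3 h4

theorem Filling.ok {a : ℕ} {f : ℕ → ℕ → ℝ} {N : ℕ} {s s' : State} {i j n k : ℕ}
    {I : MarkedSPN n k} (h : Filling a f N s i j s') (hs : Ok I s) (hi : i ≤ 2 * I.size)
    (hj : j ≤ 2 * I.size) : Ok I s' := by
  refine ⟨h.nmem.trans hs.nmem, fun x => ?_⟩
  rw [h.env]
  by_cases h4 : x = 4
  · subst h4
    rwa [Function.update_self]
  · rw [Function.update_of_ne h4]
    by_cases h3 : x = 3
    · subst h3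
      rwa [Function.update_self]
    · rw [Function.update_of_ne h3]
      exact hs.env x

theorem Filling.write {a : ℕ} {f : ℕ → ℕ → ℝ} {N : ℕ} {s s' : State} {i j : ℕ}
    (h : Filling a f N s i j s') {v : ℝ} (hv : v = f i j) :
    Filling a f N s i (j + 1) { s' with
      rmem := RealRAM.write s'.rmem a i j v
      nvar := Function.update s'.nvar 4 (j + 1) } := by
  refine ⟨h.nmem, fun x h3 h4 => ?_, ?_, Function.update_self 4 (j + 1) s'.nvar, ?_⟩
  · simp only [Function.update_of_ne (ne_four h4)]
    exact h.nvar x h3 h4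
  · simp only [Function.update_of_ne (show (3 : ℕ) ≠ 4 by decide)]
    exact h.row
  · funext b x y
    simp only [RealRAM.write, h.rmem]
    by_cases hb : b = a
    · subst hb
      simp only [Function.update_self]
      by_cases hxy : x = i ∧ y = j
      · obtain ⟨rfl, rfl⟩ := hxy
        simp [hv]
      · rw [if_neg fun h => hxy h.2]
        exact if_congr (by omega) rfl rfl
    · simp [hb]

/-- What filling a table achieves. -/
structure Filled (a : ℕ) (f : ℕ → ℕ → ℝ) (N : ℕ) {n k : ℕ} (I : MarkedSPN n k) (s s' : State) :
    Prop where
  ok : Ok I s'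
  nvar : ∀ x : Fin 40, x ≠ 3 → x ≠ 4 → s'.nvar x = s.nvar x
  rmem : s'.rmem = Function.update s.rmem a (updTab N f (s.rmem a))

theorem run_fill (a : ℕ) (e : Ex .real) (y : Fin 40) (h3 : y ≠ 3) (h4 : y ≠ 4)
    (ha : e.reads a = false) : ∃ T : Polynomial ℕ, ∀ (n k : ℕ) (I : MarkedSPN n k) (s : State),
      Ok I s → Run (fill a e y) s (T.eval I.size)
        (Filled a (fun i j => e.eval s.nmem s.rmem (Function.update (Function.update s.env 3 i) 4 j))
          (s.nvar y) I s) := by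
  obtain ⟨T, hT⟩ := e.compiles 40 le_rfl
  let B : Polynomial ℕ := T + (3 + 1 + (3 + 1))
  let C : Polynomial ℕ := (1 + 1) + ((2 * Polynomial.X * (3 + B) + 3) + (3 + 1))
  refine ⟨(1 + 1) + (2 * Polynomial.X * (3 + C) + 3), fun n k I s hs => ?_⟩
  have hN : s.nvar y ≤ 2 * I.size := hs.env y
  set N := s.nvar y with hNdef
  set f := fun i j => e.eval s.nmem s.rmem (Function.update (Function.update s.env 3 i) 4 j) with hf
  have hcell : ∀ i < N, ∀ j < N, ∀ s', Filling a f N s i j s' →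
      Run (.seq (e.comp 40) (.seq (.rput a (.var 3) (.var 4) (.var 40))
        (.nset 4 (.add (.var 4) (.lit 1))))) s' (B.eval I.size) (Filling a f N s i (j + 1)) := by
    intro i hi j hj s' h
    have hok := h.ok hs (by omega) (by omega)
    refine (Run.seq (T' := 3 + 1 + (3 + 1)) (hT n k I s' hok) fun s'' hp =>
      Run.seq (T := 3 + 1) (T' := 3 + 1) (Run.rput (Q := fun s₁ => s₁ = { s'' with
        rmem := RealRAM.write s''.rmem a i j (f i j) }) ?_) ?_).mono
        (by simp [B]) fun _ h => h
    · have e3 : s''.nvar 3 = i := (hp.1.nvar 3 (by decide)).trans h.row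
      have e4 : s''.nvar 4 = j := (hp.1.nvar 4 (by decide)).trans h.col
      have ev : s''.rvar 40 = f i j := by
        have := hp.2
        simp only [State.out] at this
        rw [this, h.env, h.rmem, h.nmem, Ex.eval_update e ha]
      simp only [NExpr.eval, RExpr.eval, e3, e4, ev]
    · rintro s₁ rfl
      refine Run.nset ?_
      have h' : Filling a f N s i j s'' := by
        refine ⟨hp.1.nmem.trans h.nmem, fun x hx3 hx4 => ?_, ?_, ?_, hp.1.rmem.trans h.rmem⟩
        · exact (hp.1.nvar x x.2).trans (h.nvar x hx3 hx4)
        · exact (hp.1.nvar 3 (by decide)).trans h.row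
        · exact (hp.1.nvar 4 (by decide)).trans h.col
      have := h'.write (v := f i j) rfl
      simpa only [NExpr.eval, h'.col] using this
  -- Between two rows the variable `4` contains a leftover, so the invariant describes the state
  -- after this variable has been reset.
  let P : ℕ → State → Prop := fun i s' => s'.nvar 4 ≤ 2 * I.size ∧
    Filling a f N s i 0 { s' with nvar := Function.update s'.nvar 4 0 }
  have hPrun : ∀ i < N, ∀ s', P i s' → Run (.seq (.nset 4 (.lit 0))
    (.seq (.loop (.nlt (.var 4) (.var y)) (.seq (e.comp 40)
      (.seq (.rput a (.var 3) (.var 4) (.var 40)) (.nset 4 (.add (.var 4) (.lit 1))))))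
      (.nset 3 (.add (.var 3) (.lit 1))))) s' (C.eval I.size) (P (i + 1)) := by
    rintro i hi s' ⟨-, h⟩
    refine (Run.seq (T := 1 + 1) (T' := (N * (3 + B.eval I.size) + 3) + (3 + 1))
      (Run.nset (Q := Filling a f N s i 0) h) fun s₁ h₁ => ?_).mono ?_ fun _ h => h
    · refine Run.seq (Run.count (P := fun j s' => j ≤ N ∧ Filling a f N s i j s')
        (b := .nlt (.var 4) (.var y)) ?_ ?_ ⟨Nat.zero_le _, h₁⟩) ?_
      · rintro j s₂ ⟨-, h₂⟩
        simp only [Test.Holds, NExpr.eval, h₂.nvar y h3 h4, h₂.col, hNdef]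
      · rintro j hj s₂ ⟨-, h₂⟩
        exact (hcell i hi j hj s₂ h₂).mono le_rfl fun _ h => ⟨hj, h⟩
      · rintro s₂ ⟨-, h₂⟩
        refine Run.nset ⟨?_, ?_⟩
        · simp only [Function.update_of_ne (show (4 : ℕ) ≠ 3 by decide), h₂.col]
          exact hN
        · refine ⟨h₂.nmem, fun x hx3 hx4 => ?_, ?_, ?_, ?_⟩
          · simp only [Function.update_of_ne (ne_four hx4), Function.update_of_ne (ne_three hx3)]
            exact h₂.nvar x hx3 hx4
          · simp [NExpr.eval, h₂.row]
          · simp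
          · simp only [h₂.rmem]
            congr 1
            funext x y
            exact if_congr (by omega) rfl rfl
    · simp only [C, Polynomial.eval_add, Polynomial.eval_mul, Polynomial.eval_ofNat,
        Polynomial.eval_X, Polynomial.eval_one]
      gcongr
  refine (Run.seq (T := 1 + 1) (T' := N * (3 + C.eval I.size) + 3)
    (Run.nset (Q := P 0) ⟨?_, ?_⟩) fun s₁ h₁ => (Run.count (P := fun i s' => i ≤ N ∧ P i s')
      (b := .nlt (.var 3) (.var y)) ?_ ?_ ⟨Nat.zero_le _, h₁⟩)).mono ?_ ?_
  · simp only [Function.update_of_ne (show (4 : ℕ) ≠ 3 by decide)]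
    exact hs.env 4
  · refine ⟨rfl, fun x hx3 hx4 => ?_, ?_, ?_, ?_⟩
    · simp only [Function.update_of_ne (ne_four hx4), Function.update_of_ne (ne_three hx3)]
    · simp [NExpr.eval]
    · simp
    · simp
  · rintro i s₂ ⟨-, -, h₂⟩
    have e3 : s₂.nvar 3 = i := by
      have := h₂.row
      simpa only [Function.update_of_ne (show (3 : ℕ) ≠ 4 by decide)] using this
    have ey : s₂.nvar y = N := by
      have := h₂.nvar y h3 h4
      simpa only [Function.update_of_ne (ne_four h4)] using this
    simp only [Test.Holds, NExpr.eval, e3, ey]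
  · rintro i hi s₂ ⟨-, h₂⟩
    exact (hPrun i hi s₂ h₂).mono le_rfl fun _ h => ⟨hi, h⟩
  · simp only [Polynomial.eval_add, Polynomial.eval_mul, Polynomial.eval_ofNat,
      Polynomial.eval_X, Polynomial.eval_one]
    gcongr
  · rintro s₂ ⟨-, h4', h₂⟩
    have hnv : ∀ x : Fin 40, x ≠ 3 → x ≠ 4 → s₂.nvar x = s.nvar x := fun x hx3 hx4 => by
      have := h₂.nvar x hx3 hx4
      simpa only [Function.update_of_ne (ne_four hx4)] using this
    have e3 : s₂.nvar 3 = N := by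
      have := h₂.row
      simpa only [Function.update_of_ne (show (3 : ℕ) ≠ 4 by decide)] using this
    refine ⟨⟨h₂.nmem.trans hs.nmem, fun x => ?_⟩, hnv, h₂.rmem.trans ?_⟩
    · by_cases hx4 : x = 4
      · subst hx4
        exact h4'
      · by_cases hx3 : x = 3
        · subst hx3
          exact e3.trans_le hN
        · exact (hnv x hx3 hx4).trans_le (hs.env x)
    · congr 1
      funext x y
      exact if_congr (by omega) rfl rfl

/-- Replace the part of the bank `a` that is indexed by numbers below the variable `y` by the
values of `e`. -/
def tabulate (a : ℕ) (e : Ex .real) (y : Fin 40) : Prog :=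
  -- The values may depend on the old content of the bank `a`, so they are collected in the buffer
  -- bank `4` before they are copied.
  .seq (fill 4 e y) (fill a (.getR 4 (.var 3) (.var 4)) y)

/-- What replacing a table achieves. -/
structure Tabulated (a : ℕ) (f : ℕ → ℕ → ℝ) (N : ℕ) {n k : ℕ} (I : MarkedSPN n k) (s s' : State) :
    Prop where
  ok : Ok I s'
  nvar : ∀ x : Fin 40, x ≠ 3 → x ≠ 4 → s'.nvar x = s.nvar x
  rmem : ∀ b, b ≠ 4 → s'.rmem b = if b = a then updTab N f (s.rmem a) else s.rmem b

theorem run_tabulate (a : ℕ) (e : Ex .real) (y : Fin 40) (h3 : y ≠ 3) (h4 : y ≠ 4) (ha : a ≠ 4)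
    (he : e.reads 4 = false) : ∃ T : Polynomial ℕ, ∀ (n k : ℕ) (I : MarkedSPN n k) (s : State),
      Ok I s → Run (tabulate a e y) s (T.eval I.size)
        (Tabulated a (fun i j => e.eval s.nmem s.rmem
          (Function.update (Function.update s.env 3 i) 4 j)) (s.nvar y) I s) := by
  obtain ⟨T, hT⟩ := run_fill 4 e y h3 h4 he
  obtain ⟨T', hT'⟩ := run_fill a (.getR 4 (.var 3) (.var 4)) y h3 h4
    (by simp [Ex.reads, ha.symm])
  refine ⟨T + T', fun n k I s hs => ?_⟩
  rw [Polynomial.eval_add]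
  refine Run.seq (hT n k I s hs) fun s₁ h₁ => (hT' n k I s₁ h₁.ok).mono le_rfl fun s₂ h₂ => ?_
  refine ⟨h₂.ok, fun x hx3 hx4 => (h₂.nvar x hx3 hx4).trans (h₁.nvar x hx3 hx4), fun b hb => ?_⟩
  rw [h₂.rmem]
  by_cases hba : b = a
  · subst hba
    rw [Function.update_self, if_pos rfl, h₁.rmem, Function.update_of_ne hb, h₁.nvar y h3 h4]
    funext i j
    simp only [updTab]
    split_ifs with h
    · simp [Ex.eval, updTab, h]
    · rfl
  · rw [Function.update_of_ne hba, if_neg hba, h₁.rmem, Function.update_of_ne hb]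

end RealRAM

/-! ### The tables of the algorithm as expressions -/

namespace RealRAM

open Finset

/-! ### Logical connectives, sums and products as expressions. -/

namespace Ex

/-- The expression, read as a truth value, holds. -/
def Holds (nm : ℕ → ℕ → ℕ → ℕ) (rm : ℕ → ℕ → ℕ → ℝ) (e : Ex .nat) (ν : Fin 40 → ℕ) : Prop :=
  0 < (e.eval nm rm ν : ℕ)

def neg (e : Ex .nat) : Ex .nat := .ite e (.lit .nat 0) (.lit .nat 1)
def and (e f : Ex .nat) : Ex .nat := .ite e f (.lit .nat 0)
def imp (e f : Ex .nat) : Ex .nat := .ite e f (.lit .nat 1)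
def eqN (e f : Ex .nat) : Ex .nat := and (neg (.ltN e f)) (neg (.ltN f e))
-- A universal statement is tested by counting its counterexamples.
def all (x y : Fin 40) (e : Ex .nat) : Ex .nat := neg (.big .addN 0 x y (neg e))
def sum (x y : Fin 40) (e : Ex .real) : Ex .real := .big .addR 0 x y e
def pos (e : Ex .real) : Ex .nat := .ltR (.lit .real 0) e

variable {nm : ℕ → ℕ → ℕ → ℕ} {rm : ℕ → ℕ → ℕ → ℝ} {ν : Fin 40 → ℕ}

theorem fold_addR (z : ℝ) (f : ℕ → ℝ) (m : ℕ) :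
    Op.fold .addR z f m = z + ∑ i ∈ range m, f i := by
  induction m with
  | zero => simp [Op.fold]
  | succ m ih => rw [Op.fold, ih, sum_range_succ, ← add_assoc]; rfl

theorem fold_mulR (z : ℝ) (f : ℕ → ℝ) (m : ℕ) :
    Op.fold .mulR z f m = z * ∏ i ∈ range m, f i := by
  induction m with
  | zero => simp [Op.fold]
  | succ m ih => rw [Op.fold, ih, prod_range_succ, ← mul_assoc]; rfl

theorem fold_addN (z : ℕ) (f : ℕ → ℕ) (m : ℕ) :
    Op.fold .addN z f m = z + ∑ i ∈ range m, f i := by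
  induction m with
  | zero => simp [Op.fold]
  | succ m ih => rw [Op.fold, ih, sum_range_succ, ← add_assoc]; rfl

open scoped Classical in
@[simp] theorem eval_ite {κ : Kind} (c : Ex .nat) (e f : Ex κ) :
    (Ex.ite c e f).eval nm rm ν =
      if c.Holds nm rm ν then e.eval nm rm ν else f.eval nm rm ν := by
  simp only [Ex.eval, Holds]
  congr

@[simp] theorem eval_lit_nat (c : ℕ) : (Ex.lit .nat c).eval nm rm ν = c := rfl

@[simp] theorem eval_lit_real (c : ℕ) : (Ex.lit .real c).eval nm rm ν = (c : ℝ) := rfl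

@[simp] theorem eval_var (x : Fin 40) : (Ex.var x).eval nm rm ν = ν x := rfl

@[simp] theorem eval_getR (a : ℕ) (i j : Ex .nat) :
    (Ex.getR a i j).eval nm rm ν = rm a (i.eval nm rm ν) (j.eval nm rm ν) := rfl

@[simp] theorem eval_addN (e f : Ex .nat) :
    (Ex.bin .addN e f).eval nm rm ν = e.eval nm rm ν + f.eval nm rm ν := rfl

@[simp] theorem eval_subN (e f : Ex .nat) :
    (Ex.bin .subN e f).eval nm rm ν = e.eval nm rm ν - f.eval nm rm ν := rfl

@[simp] theorem eval_addR (e f : Ex .real) :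
    (Ex.bin .addR e f).eval nm rm ν = e.eval nm rm ν + f.eval nm rm ν := rfl

@[simp] theorem eval_mulR (e f : Ex .real) :
    (Ex.bin .mulR e f).eval nm rm ν = e.eval nm rm ν * f.eval nm rm ν := rfl

@[simp] theorem eval_divR (e f : Ex .real) :
    (Ex.bin .divR e f).eval nm rm ν = e.eval nm rm ν / f.eval nm rm ν := rfl

@[simp] theorem eval_pow (r : Ex .real) (e : Ex .nat) :
    (Ex.pow r e).eval nm rm ν = r.eval nm rm ν ^ e.eval nm rm ν := rfl

@[simp] theorem eval_sum (x y : Fin 40) (e : Ex .real) : (sum x y e).eval nm rm ν =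
    ∑ i ∈ range (ν y), e.eval nm rm (Function.update ν x i) := by
  simp only [sum, Ex.eval, fold_addR, Kind.lit, Nat.cast_zero, zero_add]

@[simp] theorem eval_prod (x y : Fin 40) (e : Ex .real) : (big .mulR 1 x y e).eval nm rm ν =
    ∏ i ∈ range (ν y), e.eval nm rm (Function.update ν x i) := by
  simp only [Ex.eval, fold_mulR, Kind.lit, Nat.cast_one, one_mul]

@[simp] theorem eval_sumN (x y : Fin 40) (e : Ex .nat) : (big .addN 0 x y e).eval nm rm ν =
    ∑ i ∈ range (ν y), e.eval nm rm (Function.update ν x i) := by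
  simp only [Ex.eval, fold_addN, Kind.lit, zero_add]

@[simp] theorem holds_ltN (e f : Ex .nat) :
    (Ex.ltN e f).Holds nm rm ν ↔ e.eval nm rm ν < f.eval nm rm ν := by
  simp only [Holds, Ex.eval, truth]
  split_ifs with h <;> simp [h]

@[simp] theorem holds_pos (e : Ex .real) : (pos e).Holds nm rm ν ↔ 0 < e.eval nm rm ν := by
  simp only [Holds, pos, Ex.eval, truth, Kind.lit, Nat.cast_zero]
  split_ifs with h <;> simp [h]

@[simp] theorem holds_ltR_one (e : Ex .real) :
    (Ex.ltR e (.lit .real 1)).Holds nm rm ν ↔ e.eval nm rm ν < 1 := by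
  simp only [Holds, Ex.eval, truth, Kind.lit, Nat.cast_one]
  split_ifs with h <;> simp [h]

@[simp] theorem holds_neg (e : Ex .nat) : (neg e).Holds nm rm ν ↔ ¬ e.Holds nm rm ν := by
  rw [Holds, neg, eval_ite]
  split_ifs with h <;> simp [h]

@[simp] theorem holds_and (e f : Ex .nat) :
    (and e f).Holds nm rm ν ↔ e.Holds nm rm ν ∧ f.Holds nm rm ν := by
  rw [Holds, and, eval_ite]
  split_ifs with h
  · exact ⟨fun h' => ⟨h, h'⟩, And.right⟩
  · simp [h]

@[simp] theorem holds_imp (e f : Ex .nat) :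
    (imp e f).Holds nm rm ν ↔ (e.Holds nm rm ν → f.Holds nm rm ν) := by
  rw [Holds, imp, eval_ite]
  split_ifs with h
  · exact ⟨fun h' _ => h', fun g => g h⟩
  · simp [h]

@[simp] theorem holds_eqN (e f : Ex .nat) :
    (eqN e f).Holds nm rm ν ↔ e.eval nm rm ν = f.eval nm rm ν := by
  simp only [eqN, holds_and, holds_neg, holds_ltN]
  exact ⟨fun h => Nat.le_antisymm (Nat.le_of_not_lt h.2) (Nat.le_of_not_lt h.1),
    fun h => ⟨h.not_lt, h.not_gt⟩⟩

@[simp] theorem holds_all (x y : Fin 40) (e : Ex .nat) : (all x y e).Holds nm rm ν ↔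
    ∀ i < ν y, e.Holds nm rm (Function.update ν x i) := by
  rw [all, holds_neg, Holds, eval_sumN, Nat.pos_iff_ne_zero, not_not, sum_eq_zero_iff]
  refine forall_congr' fun i => ?_
  rw [mem_range, ← Nat.le_zero, ← not_lt]
  exact imp_congr_right fun _ => (not_congr (holds_neg e)).trans not_not

end Ex

/-! Variables `0`, `1`, `2` contain the numbers of places, of transitions and of half-edges. The
banks `1`, `2`, `3` contain the rates, the solution and the comparisons. -/

open Ex

/-- The named variables contain the dimensions of the input. -/
structure Dims {n k : ℕ} (_ : MarkedSPN n k) (ν : Fin 40 → ℕ) : Prop where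
  places : ν 0 = n
  trans : ν 1 = k
  halves : ν 2 = k + k

def halfEx (h q : Ex .nat) : Ex .nat :=
  .ite (.ltN h (.var 1)) (.getN 0 h q) (.getN 1 (.bin .subN h (.var 1)) q)

/-- The variables `20` and `21` are reserved for binding inside auxiliary expressions; arguments
that avoid them cannot be captured. -/
def sameEx (h h' : Ex .nat) : Ex .nat :=
  all 20 0 (eqN (halfEx h (.var 20)) (halfEx h' (.var 20)))

def repEx (a : Fin 40) : Ex .nat := all 21 a (neg (sameEx (.var 21) (.var a)))

def ratesEx : Ex .real :=
  sum 6 1 (.ite (and (and (repEx 3) (repEx 4)) (and (sameEx (.var 6) (.var 3))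
    (sameEx (.bin .addN (.var 1) (.var 6)) (.var 4)))) (.getR 0 (.lit .nat 0) (.var 6))
    (.lit .real 0))

def outSumEx : Ex .real := sum 6 5 (.getR 1 (.var 5) (.var 6))

def elimEx : Ex .real :=
  .bin .addR (.getR 1 (.var 3) (.var 4))
    (.bin .divR (.bin .mulR (.getR 1 (.var 3) (.var 5)) (.getR 1 (.var 5) (.var 4))) outSumEx)

def backEx : Ex .real :=
  .ite (eqN (.var 4) (.var 5))
    (.ite (pos outSumEx)
      (.bin .divR (sum 6 5 (.bin .mulR (.getR 2 (.var 3) (.var 6)) (.getR 1 (.var 6) (.var 5))))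
        outSumEx)
      (.ite (eqN (.var 3) (.var 5)) (.lit .real 1) (.lit .real 0)))
    (.getR 2 (.var 3) (.var 4))

def tokensEx (h : Fin 40) : Ex .nat := .big .addN 0 20 0 (halfEx (.var h) (.var 20))

def weightEx (h : Fin 40) : Ex .real := sum 20 2 (.getR 2 (.var 20) (.var h))

def coveredEx (h z u : Fin 40) : Ex .nat :=
  all 20 0 (imp (and (neg (eqN (.var 20) (.var z)))
    (.ltN (.lit .nat 0) (halfEx (.var h) (.var 20)))) (pos (.getR 3 (.var 20) (.var u))))

def monomialEx (h z u : Fin 40) : Ex .real :=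
  .big .mulR 1 20 0 (.ite (eqN (.var 20) (.var z)) (.lit .real 1)
    (.pow (.getR 3 (.var 20) (.var u)) (halfEx (.var h) (.var 20))))

def witnessEx (c h h' z z' u : Fin 40) : Ex .nat :=
  and (and (pos (.getR 2 (.var c) (.var h))) (pos (.getR 2 (.var c) (.var h'))))
    (and (eqN (halfEx (.var h) (.var z)) (.lit .nat 1)) (and (coveredEx h z u) (coveredEx h' z' u)))

def ratioEx (h h' z z' u : Fin 40) : Ex .real :=
  .bin .divR (.bin .mulR (.bin .divR (weightEx h) (weightEx h')) (monomialEx h' z' u))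
    (monomialEx h z u)

def witnessSumEx (e : Ex .real) : Ex .real :=
  sum 6 2 (sum 7 2 (sum 8 2 (sum 9 0 (.ite (and (witnessEx 6 7 8 3 4 9)
    (and (eqN (halfEx (.var 8) (.var 4)) (.lit .nat 1)) (eqN (tokensEx 7) (tokensEx 8))))
    e (.lit .real 0)))))

def compareEx : Ex .real :=
  .bin .divR (witnessSumEx (ratioEx 7 8 3 4 9)) (witnessSumEx (.lit .real 1))

def singlesEx : Ex .nat :=
  all 6 0 (all 7 2 (all 8 2 (all 9 0 (all 10 2 (imp
    -- The variable `0` contains `n`, which as an index denotes no place.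
    (and (witnessEx 7 10 8 9 0 6) (.ltN (tokensEx 8) (tokensEx 10)))
    (.ltR (ratioEx 10 8 9 0 6) (.lit .real 1)))))))

def pairsEx : Ex .nat :=
  all 6 0 (all 7 2 (all 8 2 (all 9 0 (all 10 2 (all 11 0 (all 12 2 (imp
    (and (and (witnessEx 7 10 8 9 0 6)
        (.ltN (.bin .addN (tokensEx 8) (.lit .nat 1)) (tokensEx 10)))
      (and (witnessEx 7 12 8 11 0 6)
        (.ltN (tokensEx 12) (.bin .addN (tokensEx 8) (.lit .nat 1)))))
    (.ltR (.bin .mulR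
      (.pow (ratioEx 10 8 9 0 6)
        (.bin .subN (.bin .addN (tokensEx 8) (.lit .nat 1)) (tokensEx 12)))
      (.pow (ratioEx 12 8 11 0 6)
        (.bin .subN (tokensEx 10) (.bin .addN (tokensEx 8) (.lit .nat 1))))) (.lit .real 1)))))))))

section Eval

variable {n k : ℕ} {I : MarkedSPN n k} {nm : ℕ → ℕ → ℕ → ℕ} {rm : ℕ → ℕ → ℕ → ℝ}
  {ν : Fin 40 → ℕ}

theorem Dims.update (hν : Dims I ν) {x : Fin 40} (hx : 2 < x) (i : ℕ) :
    Dims I (Function.update ν x i) :=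
  ⟨by rw [Function.update_of_ne (by omega)]; exact hν.places,
    by rw [Function.update_of_ne (by omega)]; exact hν.trans,
    by rw [Function.update_of_ne (by omega)]; exact hν.halves⟩

theorem eval_halfEx (hν : Dims I ν) (h q : Ex .nat) :
    (halfEx h q).eval I.initState.nmem rm ν =
      I.half (h.eval I.initState.nmem rm ν) (q.eval I.initState.nmem rm ν) := by
  rw [halfEx, eval_ite, MarkedSPN.half]
  simp only [holds_ltN, eval_var, hν.trans]
  split_ifs
  · rfl
  · simp only [Ex.eval, Op.app, hν.trans]

theorem holds_sameEx (hν : Dims I ν) (h h' : Ex .nat)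
    (hh : ∀ i, h.eval I.initState.nmem rm (Function.update ν 20 i) = h.eval I.initState.nmem rm ν)
    (hh' : ∀ i, h'.eval I.initState.nmem rm (Function.update ν 20 i) =
      h'.eval I.initState.nmem rm ν) :
    (sameEx h h').Holds I.initState.nmem rm ν ↔
      I.Same (h.eval I.initState.nmem rm ν) (h'.eval I.initState.nmem rm ν) := by
  simp only [sameEx, holds_all, holds_eqN, eval_halfEx (hν.update (x := 20) (by decide) _), hh, hh',
    eval_var, Function.update_self, hν.places]
  rfl

theorem holds_repEx (hν : Dims I ν) {a : Fin 40} (h0 : a ≠ 20) (h1 : a ≠ 21) :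
    (repEx a).Holds I.initState.nmem rm ν ↔ I.IsRep (ν a) := by
  simp only [repEx, holds_all, holds_neg]
  refine forall_congr' fun i => imp_congr_right fun _ => not_congr ?_
  rw [holds_sameEx (hν.update (by decide) _)]
  · simp [h1]
  · simp
  · simp [h0]

theorem eval_tokensEx (hν : Dims I ν) {h : Fin 40} (h0 : h ≠ 20) :
    (tokensEx h).eval I.initState.nmem rm ν = I.tokens (ν h) := by
  simp only [tokensEx, eval_sumN, eval_halfEx (hν.update (x := 20) (by decide) _), eval_var,
    Function.update_self, Function.update_of_ne h0, hν.places]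
  rfl

theorem eval_weightEx (hν : Dims I ν) (hV : rm 2 = I.solution) {h : Fin 40} (h0 : h ≠ 20) :
    (weightEx h).eval I.initState.nmem rm ν = I.weight (ν h) := by
  simp only [weightEx, eval_sum, eval_getR, eval_var,
    Function.update_self, Function.update_of_ne h0, hν.halves, hV]
  rfl

theorem holds_coveredEx (hν : Dims I ν) {h z u : Fin 40} (h0 : h ≠ 20) (z0 : z ≠ 20)
    (u0 : u ≠ 20) : (coveredEx h z u).Holds I.initState.nmem rm ν ↔
      I.Covered (rm 3) (ν h) (ν z) (ν u) := by
  simp only [coveredEx, holds_all, holds_imp, holds_and, holds_neg, holds_eqN, holds_ltN, holds_pos,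
    eval_getR, eval_halfEx (hν.update (x := 20) (by decide) _), eval_var, eval_lit_nat,
    Function.update_self, Function.update_of_ne h0, Function.update_of_ne z0,
    Function.update_of_ne u0, hν.places]
  rfl

theorem eval_monomialEx (hν : Dims I ν) {h z u : Fin 40} (h0 : h ≠ 20) (z0 : z ≠ 20)
    (u0 : u ≠ 20) : (monomialEx h z u).eval I.initState.nmem rm ν =
      I.monomial (rm 3) (ν h) (ν z) (ν u) := by
  simp only [monomialEx, eval_prod, eval_ite, holds_eqN, eval_pow,
    eval_getR, eval_halfEx (hν.update (x := 20) (by decide) _), eval_var, eval_lit_real,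
    Function.update_self, Function.update_of_ne h0, Function.update_of_ne z0,
    Function.update_of_ne u0, hν.places, Nat.cast_one]
  refine prod_congr rfl fun q _ => ?_
  congr

theorem holds_witnessEx (hν : Dims I ν) (hV : rm 2 = I.solution) {c h h' z z' u : Fin 40}
    (h0 : h ≠ 20) (h0' : h' ≠ 20) (z0 : z ≠ 20) (z0' : z' ≠ 20) (u0 : u ≠ 20) :
    (witnessEx c h h' z z' u).Holds I.initState.nmem rm ν ↔
      I.Witness (rm 3) (ν c) (ν h) (ν h') (ν z) (ν z') (ν u) := by
  simp only [witnessEx, holds_and, holds_pos, eval_getR, eval_var, holds_eqN, eval_halfEx hν,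
    eval_lit_nat, holds_coveredEx hν h0 z0 u0, holds_coveredEx hν h0' z0' u0, hV]
  rfl

theorem eval_ratioEx (hν : Dims I ν) (hV : rm 2 = I.solution) {h h' z z' u : Fin 40}
    (h0 : h ≠ 20) (h0' : h' ≠ 20) (z0 : z ≠ 20) (z0' : z' ≠ 20) (u0 : u ≠ 20) :
    (ratioEx h h' z z' u).eval I.initState.nmem rm ν =
      I.ratio (rm 3) (ν h) (ν h') (ν z) (ν z') (ν u) := by
  simp only [ratioEx, eval_divR, eval_mulR, eval_weightEx hν hV h0, eval_weightEx hν hV h0',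
    eval_monomialEx hν h0 z0 u0, eval_monomialEx hν h0' z0' u0]
  rfl

theorem eval_ratesEx (hν : Dims I ν) (h0 : rm 0 = I.initState.rmem 0) :
    ratesEx.eval I.initState.nmem rm ν = I.rates (ν 3) (ν 4) := by
  classical
  have hν' := fun i => hν.update (x := 6) (by decide) i
  simp only [ratesEx, eval_sum, eval_ite, hν.trans, MarkedSPN.rates]
  refine sum_congr rfl fun t _ => if_congr ?_ (by simp [h0]) (by simp)
  rw [holds_and, holds_and, holds_and, holds_repEx (hν' t) (by decide) (by decide),
    holds_repEx (hν' t) (by decide) (by decide), holds_sameEx (hν' t) _ _ (by simp) (by simp),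
    holds_sameEx (hν' t) _ _ (by simp) (by simp)]
  simp [hν.trans]

theorem eval_outSumEx : outSumEx.eval nm rm ν = Elimination.outSum (rm 1) (ν 5) := by
  simp [outSumEx, Elimination.outSum]

theorem eval_elimEx : elimEx.eval nm rm ν = rm 1 (ν 3) (ν 4) +
    rm 1 (ν 3) (ν 5) * rm 1 (ν 5) (ν 4) / Elimination.outSum (rm 1) (ν 5) := by
  simp [elimEx, eval_outSumEx]

theorem eval_backEx : backEx.eval nm rm ν =
    Elimination.backStep (rm 1) (ν 5) (rm 2) (ν 3) (ν 4) := by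
  simp [backEx, eval_outSumEx, Elimination.backStep]

theorem eval_witnessSumEx (hν : Dims I ν) (hV : rm 2 = I.solution) (e : Ex .real)
    (f : ℕ → ℕ → ℕ → ℝ) (hf : ∀ c h h' u, e.eval I.initState.nmem rm (Function.update
      (Function.update (Function.update (Function.update ν 6 c) 7 h) 8 h') 9 u) = f h h' u) :
    (witnessSumEx e).eval I.initState.nmem rm ν = I.witnessSum (rm 3) (ν 3) (ν 4) f := by
  classical
  have hd := fun c h h' u => (((hν.update (x := 6) (by decide) c).update (x := 7) (by decide)
    h).update (x := 8) (by decide) h').update (x := 9) (by decide) u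
  simp only [witnessSumEx, eval_sum, eval_ite, hf]
  simp only [Function.update_of_ne (show (2 : Fin 40) ≠ 6 by decide),
    Function.update_of_ne (show (2 : Fin 40) ≠ 7 by decide),
    Function.update_of_ne (show (0 : Fin 40) ≠ 6 by decide),
    Function.update_of_ne (show (0 : Fin 40) ≠ 7 by decide),
    Function.update_of_ne (show (0 : Fin 40) ≠ 8 by decide), hν.halves, hν.places,
    MarkedSPN.witnessSum]
  refine sum_congr rfl fun c _ => sum_congr rfl fun h _ => sum_congr rfl fun h' _ =>
    sum_congr rfl fun u _ => if_congr ?_ rfl (by simp)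
  rw [holds_and, holds_and, holds_witnessEx (hd c h h' u) hV (by decide) (by decide) (by decide)
    (by decide) (by decide), holds_eqN, holds_eqN, eval_halfEx (hd c h h' u),
    eval_tokensEx (hd c h h' u) (by decide), eval_tokensEx (hd c h h' u) (by decide)]
  simp

theorem eval_compareEx (hν : Dims I ν) (hV : rm 2 = I.solution) :
    compareEx.eval I.initState.nmem rm ν = I.compareStep (rm 3) (ν 3) (ν 4) := by
  rw [compareEx, eval_divR, eval_witnessSumEx hν hV _
    (fun h h' u => I.ratio (rm 3) h h' (ν 3) (ν 4) u) fun c h h' u => ?_,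
    eval_witnessSumEx hν hV _ (fun _ _ _ => 1) (by simp)]
  · rfl
  · rw [eval_ratioEx ((((hν.update (x := 6) (by decide) c).update (x := 7) (by decide)
      h).update (x := 8) (by decide) h').update (x := 9) (by decide) u) hV (by decide) (by decide)
      (by decide) (by decide) (by decide)]
    simp

theorem holds_singlesEx (hν : Dims I ν) (hV : rm 2 = I.solution) :
    singlesEx.Holds I.initState.nmem rm ν ↔ I.SinglesPass (rm 3) := by
  simp only [singlesEx, holds_all, MarkedSPN.SinglesPass]
  simp only [Function.update_apply, Fin.reduceEq, if_false, hν.places, hν.halves]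
  refine forall₂_congr fun u _ => forall₂_congr fun c _ => forall₂_congr fun h' _ =>
    forall₂_congr fun p _ => forall₂_congr fun h _ => ?_
  have hd := ((((hν.update (x := 6) (by decide) u).update (x := 7) (by decide) c).update (x := 8)
    (by decide) h').update (x := 9) (by decide) p).update (x := 10) (by decide) h
  rw [holds_imp, holds_and, holds_ltN, holds_ltR_one, holds_witnessEx hd hV (by decide) (by decide)
    (by decide) (by decide) (by decide), eval_ratioEx hd hV (by decide) (by decide) (by decide)
    (by decide) (by decide), eval_tokensEx hd (by decide), eval_tokensEx hd (by decide)]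
  simp only [Function.update_apply, Fin.reduceEq, if_false, if_true, hν.places]

theorem holds_pairsEx (hν : Dims I ν) (hV : rm 2 = I.solution) :
    pairsEx.Holds I.initState.nmem rm ν ↔ I.PairsPass (rm 3) := by
  simp only [pairsEx, holds_all, MarkedSPN.PairsPass]
  simp only [Function.update_apply, Fin.reduceEq, if_false, hν.places, hν.halves]
  refine forall₂_congr fun u _ => forall₂_congr fun c _ => forall₂_congr fun h' _ =>
    forall₂_congr fun p _ => forall₂_congr fun h _ => forall₂_congr fun r _ =>
    forall₂_congr fun j _ => ?_
  have hd := ((((((hν.update (x := 6) (by decide) u).update (x := 7) (by decide) c).update (x := 8)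
    (by decide) h').update (x := 9) (by decide) p).update (x := 10) (by decide) h).update (x := 11)
    (by decide) r).update (x := 12) (by decide) j
  rw [holds_imp, holds_and, holds_and, holds_and, holds_ltN, holds_ltN, holds_ltR_one,
    holds_witnessEx hd hV (by decide) (by decide) (by decide) (by decide) (by decide),
    holds_witnessEx hd hV (by decide) (by decide) (by decide) (by decide) (by decide),
    eval_mulR, eval_pow, eval_pow, eval_subN, eval_subN, eval_addN, eval_lit_nat,
    eval_ratioEx hd hV (by decide) (by decide) (by decide) (by decide) (by decide),
    eval_ratioEx hd hV (by decide) (by decide) (by decide) (by decide) (by decide),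
    eval_tokensEx hd (by decide), eval_tokensEx hd (by decide), eval_tokensEx hd (by decide)]
  simp only [Function.update_apply, Fin.reduceEq, if_false, if_true, hν.places]

end Eval

end RealRAM

/-! ### The program -/

namespace RealRAM

open Elimination Ex

/-- Properties of states, depending on the input. -/
abbrev Assertion := ∀ n k : ℕ, MarkedSPN n k → State → Prop

/-- From states with the property `A` the program arrives in polynomial time at states with the
property `B`. -/
def Leads (A : Assertion) (c : Prog) (B : Assertion) : Prop :=
  ∃ T : Polynomial ℕ, ∀ (n k : ℕ) (I : MarkedSPN n k) (s : State), A n k I s →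
    Run c s (T.eval I.size) (B n k I)

theorem Leads.seq {A B C : Assertion} {c d : Prog} (h : Leads A c B) (h' : Leads B d C) :
    Leads A (.seq c d) C := by
  obtain ⟨T, hT⟩ := h
  obtain ⟨T', hT'⟩ := h'
  refine ⟨T + T', fun n k I s hs => ?_⟩
  rw [Polynomial.eval_add]
  exact (hT n k I s hs).seq fun s' hs' => hT' n k I s' hs'

theorem Leads.nset {A B : Assertion} {x : ℕ} {e : NExpr}
    (h : ∀ n k (I : MarkedSPN n k) s, A n k I s →
      B n k I { s with nvar := Function.update s.nvar x (e.eval s) }) :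
    Leads A (.nset x e) B :=
  ⟨Polynomial.C (e.cost + 1), fun n k I s hs => by
    rw [Polynomial.eval_C]
    exact Run.nset (h n k I s hs)⟩

theorem Leads.count {b : Test} {c : Prog} {N : ∀ n k : ℕ, MarkedSPN n k → ℕ}
    {P : ℕ → Assertion} (hN : ∀ n k (I : MarkedSPN n k), N n k I ≤ 2 * I.size)
    (hb : ∀ j n k (I : MarkedSPN n k) s, P j n k I s → (b.Holds s ↔ j < N n k I))
    (step : ∃ T : Polynomial ℕ, ∀ (n k : ℕ) (I : MarkedSPN n k), ∀ j < N n k I, ∀ s,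
      P j n k I s → Run c s (T.eval I.size) (P (j + 1) n k I)) :
    Leads (P 0) (.loop b c) fun n k I => P (N n k I) n k I := by
  obtain ⟨T, hT⟩ := step
  refine ⟨2 * Polynomial.X * (Polynomial.C b.cost + T) + Polynomial.C b.cost,
    fun n k I s hs => ?_⟩
  refine (Run.count (fun j s h => hb j n k I s h) (hT n k I) hs).mono ?_ fun _ h => h
  simp only [Polynomial.eval_add, Polynomial.eval_mul, Polynomial.eval_ofNat, Polynomial.eval_X,
    Polynomial.eval_C]
  have := hN n k I
  gcongr

/-- The contents of the memory: the dimensions, the counter `v`, and the three tables. -/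
structure Memory {n k : ℕ} (I : MarkedSPN n k) (v : ℕ) (R V G : ℕ → ℕ → ℝ) (s : State) :
    Prop where
  ok : Ok I s
  dims : Dims I s.env
  counter : s.nvar 5 = v
  rates : s.rmem 0 = I.initState.rmem 0
  bank1 : s.rmem 1 = R
  bank2 : s.rmem 2 = V
  bank3 : s.rmem 3 = G

section Memory

variable {n k : ℕ} {I : MarkedSPN n k} {v : ℕ} {R V G : ℕ → ℕ → ℝ} {s s' : State}

theorem size_places : n ≤ 2 * I.size := by
  unfold MarkedSPN.size
  omega

theorem size_halves : k + k ≤ 2 * I.size := by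
  unfold MarkedSPN.size
  omega

theorem Memory.setCounter (h : Memory I v R V G s) {w : ℕ} (hw : w ≤ 2 * I.size) :
    Memory I w R V G { s with nvar := Function.update s.nvar 5 w } := by
  refine ⟨⟨h.ok.nmem, fun x => ?_⟩, ⟨?_, ?_, ?_⟩, Function.update_self 5 w s.nvar, h.rates, h.bank1,
    h.bank2, h.bank3⟩
  · by_cases hx : (x : ℕ) = 5
    · simpa only [State.env, hx, Function.update_self] using hw
    · simpa only [State.env, Function.update_of_ne hx] using h.ok.env x
  · exact h.dims.places
  · exact h.dims.trans
  · exact h.dims.halves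

open scoped Classical in
theorem Memory.tabulated {a N : ℕ} {f : ℕ → ℕ → ℝ} (ha : a ≠ 0) (h : Memory I v R V G s)
    (h' : Tabulated a f N I s s') :
    Memory I v (if a = 1 then updTab N f R else R) (if a = 2 then updTab N f V else V)
      (if a = 3 then updTab N f G else G) s' := by
  refine ⟨h'.ok, ⟨?_, ?_, ?_⟩, ?_, ?_, ?_, ?_, ?_⟩
  · exact (h'.nvar 0 (by decide) (by decide)).trans h.dims.places
  · exact (h'.nvar 1 (by decide) (by decide)).trans h.dims.trans
  · exact (h'.nvar 2 (by decide) (by decide)).trans h.dims.halves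
  · exact (h'.nvar 5 (by decide) (by decide)).trans h.counter
  · rw [h'.rmem 0 (by decide), if_neg ha.symm, h.rates]
  · rw [h'.rmem 1 (by decide)]
    by_cases e : a = 1
    · subst e; rw [if_pos rfl, if_pos rfl, h.bank1]
    · rw [if_neg (Ne.symm e), if_neg e, h.bank1]
  · rw [h'.rmem 2 (by decide)]
    by_cases e : a = 2
    · subst e; rw [if_pos rfl, if_pos rfl, h.bank2]
    · rw [if_neg (Ne.symm e), if_neg e, h.bank2]
  · rw [h'.rmem 3 (by decide)]
    by_cases e : a = 3
    · subst e; rw [if_pos rfl, if_pos rfl, h.bank3]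
    · rw [if_neg (Ne.symm e), if_neg e, h.bank3]

theorem Memory.dims_cell (h : Memory I v R V G s) (i j : ℕ) :
    Dims I (Function.update (Function.update s.env 3 i) 4 j) :=
  (h.dims.update (by decide) i).update (by decide) j

end Memory

theorem updTab_congr {M : ℕ} {f g A : ℕ → ℕ → ℝ} (h : ∀ i j, f i j = g i j) :
    updTab M f A = updTab M g A := by
  rw [show f = g from funext fun i => funext fun j => h i j]

/-! ### The phases of the computation. -/

theorem leads_init : Leads (fun _ _ I s => s = I.initState) (.nset 2 (.add (.var 1) (.var 1)))
    (fun _ _ I => Memory I 0 0 0 0) := by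
  refine Leads.nset fun n k I s hs => ?_
  subst hs
  refine ⟨⟨rfl, fun x => ?_⟩, ⟨?_, ?_, ?_⟩, ?_, rfl, ?_, ?_, ?_⟩
  · by_cases hx : (x : ℕ) = 2
    · simpa [State.env, hx, NExpr.eval, MarkedSPN.initState] using size_halves
    · simp only [State.env, Function.update_of_ne hx, MarkedSPN.initState]
      have := size_places (I := I)
      have := size_halves (I := I)
      split_ifs <;> omega
  · simp [State.env, MarkedSPN.initState]
  · simp [State.env, MarkedSPN.initState]
  · simp [State.env, NExpr.eval, MarkedSPN.initState]
  · simp [MarkedSPN.initState]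
  · funext i j; simp [MarkedSPN.initState]
  · funext i j; simp [MarkedSPN.initState]
  · funext i j; simp [MarkedSPN.initState]

theorem leads_rates : Leads (fun _ _ I => Memory I 0 0 0 0) (tabulate 1 ratesEx 2)
    (fun _ _ I => Memory I 0 I.rates 0 0) := by
  obtain ⟨T, hT⟩ := run_tabulate 1 ratesEx 2 (by decide) (by decide) (by decide) rfl
  refine ⟨T, fun n k I s hs => (hT n k I s hs.ok).mono le_rfl fun s' hs' => ?_⟩
  have := hs.tabulated (by decide) hs'
  rw [if_pos rfl, if_neg (by decide), if_neg (by decide)] at this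
  convert this using 1
  funext i j
  have hN : s.nvar ((2 : Fin 40) : ℕ) = k + k := hs.dims.halves
  rw [updTab, hs.ok.nmem, eval_ratesEx (hs.dims_cell i j) hs.rates, hN]
  split_ifs with h
  · simp
  · exact MarkedSPN.rates_eq_zero h

theorem leads_elim : Leads (fun _ _ I => Memory I 0 I.rates 0 0)
    (.seq (.nset 5 (.var 2)) (.loop (.nlt (.lit 0) (.var 5))
      (.seq (.nset 5 (.sub (.var 5) (.lit 1))) (tabulate 1 elimEx 5))))
    (fun _ k I => Memory I 0 (elim (k + k) I.rates) 0 0) := by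
  -- The current table `R` is described by what eliminating the remaining states will make of it,
  -- matching the recursion of `elim`.
  let P : ℕ → Assertion := fun j n k I s => j ≤ k + k ∧
    ∃ R, elim (k + k - j) R = elim (k + k) I.rates ∧ Memory I (k + k - j) R 0 0 s
  have hloop : Leads (P 0) (.loop (.nlt (.lit 0) (.var 5))
      (.seq (.nset 5 (.sub (.var 5) (.lit 1))) (tabulate 1 elimEx 5)))
      (fun n k I => P (k + k) n k I) := by
    refine Leads.count (N := fun n k I => k + k) (fun n k I => size_halves) ?_ ?_
    · rintro j n k I s ⟨hj, R, -, hs⟩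
      simp only [Test.Holds, NExpr.eval, hs.counter]
      omega
    · obtain ⟨T, hT⟩ := run_tabulate 1 elimEx 5 (by decide) (by decide) (by decide) rfl
      refine ⟨4 + T, ?_⟩
      rintro n k I j hj s ⟨-, R, hR, hs⟩
      rw [Polynomial.eval_add, Polynomial.eval_ofNat]
      refine Run.seq (Run.nset (Q := Memory I (k + k - (j + 1)) R 0 0) ?_) fun s₁ h₁ =>
        (hT n k I s₁ h₁.ok).mono le_rfl fun s₂ h₂ => ⟨hj, elimStep (k + k - (j + 1)) R, ?_, ?_⟩
      · simp only [NExpr.eval, hs.counter, Nat.sub_sub]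
        exact hs.setCounter ((Nat.sub_le _ _).trans size_halves)
      · rw [← hR, show k + k - j = k + k - (j + 1) + 1 by omega]
        rfl
      · have := h₁.tabulated (by decide) h₂
        rw [if_pos rfl, if_neg (by decide), if_neg (by decide)] at this
        convert this using 1
        have hN : s₁.nvar ((5 : Fin 40) : ℕ) = k + k - (j + 1) := h₁.counter
        have h5 : s₁.env 5 = k + k - (j + 1) := h₁.counter
        rw [elimStep, hN]
        refine updTab_congr fun i j => ?_
        rw [eval_elimEx, h₁.bank1]
        simp [h5]
  obtain ⟨T, hT⟩ := Leads.seq (Leads.nset (A := fun n k I => Memory I 0 I.rates 0 0) (x := 5)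
    (e := .var 2) (B := P 0) fun n k I s hs => ⟨Nat.zero_le _, I.rates, rfl, by
      have := hs.setCounter (size_halves (I := I))
      have h2 : s.nvar 2 = k + k := hs.dims.halves
      rwa [NExpr.eval, h2]⟩) hloop
  refine ⟨T, fun n k I s hs => (hT n k I s hs).mono le_rfl ?_⟩
  rintro s' ⟨-, R, hR, hs'⟩
  rw [Nat.sub_self] at hR hs'
  rwa [← hR]

/-- Rows outside the table vanish, so a program that only updates the block below `M` computes the
same table as the unrestricted recursion. -/
theorem backTab_eq_zero {F : ℕ → ℕ → ℝ} {M i c : ℕ} (hi : i ≤ M) (hc : M ≤ c) (j : ℕ) :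
    backTab F i c j = 0 := by
  induction i generalizing j with
  | zero => rfl
  | succ i ih =>
    simp only [backTab, backStep]
    split_ifs with h1 h2 h3
    · rw [Finset.sum_eq_zero fun l _ => by rw [ih (by omega), zero_mul], zero_div]
    · omega
    · rfl
    · exact ih (by omega) j

theorem backTab_succ {F : ℕ → ℕ → ℝ} {M i : ℕ} (hi : i < M) :
    updTab M (backStep F i (backTab F i)) (backTab F i) = backTab F (i + 1) := by
  funext c j
  rw [updTab]
  split_ifs with h
  · rfl
  · by_cases hc : c < M
    · rw [backTab, backStep, if_neg (by omega)]
    · rw [backTab_eq_zero hi.le (not_lt.1 hc), backTab_eq_zero (Nat.succ_le_of_lt hi) (not_lt.1 hc)]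

theorem leads_back : Leads (fun _ k I => Memory I 0 (elim (k + k) I.rates) 0 0)
    (.loop (.nlt (.var 5) (.var 2))
      (.seq (tabulate 2 backEx 2) (.nset 5 (.add (.var 5) (.lit 1)))))
    (fun _ k I => Memory I (k + k) (elim (k + k) I.rates) I.solution 0) := by
  let P : ℕ → Assertion := fun j n k I =>
    Memory I j (elim (k + k) I.rates) (backTab (elim (k + k) I.rates) j) 0
  refine Leads.count (P := P) (N := fun n k I => k + k) (fun n k I => size_halves) ?_ ?_
  · rintro j n k I s hs
    have h2 : s.nvar 2 = k + k := hs.dims.halves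
    simp only [Test.Holds, NExpr.eval, hs.counter, h2]
  · obtain ⟨T, hT⟩ := run_tabulate 2 backEx 2 (by decide) (by decide) (by decide) rfl
    refine ⟨T + 4, ?_⟩
    rintro n k I j hj s hs
    rw [Polynomial.eval_add, Polynomial.eval_ofNat]
    refine Run.seq ((hT n k I s hs.ok).mono le_rfl fun s₁ h₁ => ?_)
      fun s₁ (h₁ : Memory I j (elim (k + k) I.rates) (backTab (elim (k + k) I.rates) (j + 1)) 0 s₁) =>
        Run.nset (e := .add (.var 5) (.lit 1)) ?_
    · have := hs.tabulated (by decide) h₁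
      rw [if_neg (by decide), if_pos rfl, if_neg (by decide)] at this
      convert this using 1
      have hN : s.nvar ((2 : Fin 40) : ℕ) = k + k := hs.dims.halves
      have h5 : s.env 5 = j := hs.counter
      rw [← backTab_succ hj, hN]
      refine updTab_congr fun i l => ?_
      rw [eval_backEx, hs.bank1, hs.bank2]
      simp [h5]
    · simp only [NExpr.eval, h₁.counter]
      exact h₁.setCounter (Nat.succ_le_of_lt hj |>.trans size_halves)

theorem leads_compare : Leads
    (fun _ k I => Memory I (k + k) (elim (k + k) I.rates) I.solution 0)
    (.seq (.nset 5 (.lit 0)) (.loop (.nlt (.var 5) (.var 0))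
      (.seq (tabulate 3 compareEx 0) (.nset 5 (.add (.var 5) (.lit 1))))))
    (fun n k I => Memory I n (elim (k + k) I.rates) I.solution (I.compare n)) := by
  let P : ℕ → Assertion := fun j n k I =>
    Memory I j (elim (k + k) I.rates) I.solution (I.compare j)
  refine Leads.seq (B := P 0) (Leads.nset fun n k I s hs => hs.setCounter (Nat.zero_le _)) ?_
  refine Leads.count (P := P) (N := fun n k I => n) (fun n k I => size_places) ?_ ?_
  · rintro j n k I s hs
    have h2 : s.nvar 0 = n := hs.dims.places
    simp only [Test.Holds, NExpr.eval, hs.counter, h2]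
  · obtain ⟨T, hT⟩ := run_tabulate 3 compareEx 0 (by decide) (by decide) (by decide) rfl
    refine ⟨T + 4, ?_⟩
    rintro n k I j hj s hs
    rw [Polynomial.eval_add, Polynomial.eval_ofNat]
    refine Run.seq ((hT n k I s hs.ok).mono le_rfl fun s₁ h₁ => ?_)
      fun s₁ (h₁ : Memory I j (elim (k + k) I.rates) I.solution (I.compare (j + 1)) s₁) =>
        Run.nset (e := .add (.var 5) (.lit 1)) ?_
    · have := hs.tabulated (by decide) h₁
      rw [if_neg (by decide), if_neg (by decide), if_pos rfl] at this
      convert this using 1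
      have hN : s.nvar ((0 : Fin 40) : ℕ) = n := hs.dims.places
      rw [MarkedSPN.compare, hN]
      refine updTab_congr fun i l => ?_
      rw [hs.ok.nmem, eval_compareEx (hs.dims_cell i l) hs.bank2, hs.bank3]
      simp
    · simp only [NExpr.eval, h₁.counter]
      exact h₁.setCounter (Nat.succ_le_of_lt hj |>.trans size_places)

open scoped Classical in
theorem leads_test : Leads
    (fun n k I => Memory I n (elim (k + k) I.rates) I.solution (I.compare n))
    -- Truth values are specified only up to being positive; the double negation turns them into
    -- exactly `0` or `1`.
    (.seq ((neg (neg (and singlesEx pairsEx))).comp 40) (.nset 0 (.var 40)))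
    (fun n _ I s => s.nvar 0 =
      if I.SinglesPass (I.compare n) ∧ I.PairsPass (I.compare n) then 1 else 0) := by
  obtain ⟨T, hT⟩ := (neg (neg (and singlesEx pairsEx))).compiles 40 le_rfl
  refine ⟨T + 2, fun n k I s hs => ?_⟩
  rw [Polynomial.eval_add, Polynomial.eval_ofNat]
  refine Run.seq (hT n k I s hs.ok) fun s₁ h₁ => Run.nset ?_
  have := h₁.2
  simp only [State.out] at this
  simp only [Function.update_self, NExpr.eval, this]
  rw [neg, eval_ite, eval_lit_nat, eval_lit_nat, hs.ok.nmem]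
  simp only [holds_neg, holds_and, holds_singlesEx hs.dims hs.bank2,
    holds_pairsEx hs.dims hs.bank2, hs.bank3, ite_not]

end RealRAM

open RealRAM in
theorem mainTheorem12 :
    ∃ (c : RealRAM.Prog) (B : Polynomial ℕ), ∀ (n k : ℕ) (I : MarkedSPN n k),
      (∃ N, I.net.IsOpenPi3 N) → I.net.Live I.init →
        ∃ (time : ℕ) (s : RealRAM.State), RealRAM.Exec c I.initState time s ∧
          time ≤ B.eval I.size ∧
          (I.net.Ergodic I.rate I.init → s.nvar 0 = 1) ∧
          (¬ I.net.Ergodic I.rate I.init → s.nvar 0 = 0) := by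
  classical
  obtain ⟨c, T, hT⟩ : ∃ c, Leads (fun _ _ I s => s = I.initState) c (fun n _ I s => s.nvar 0 =
      if I.SinglesPass (I.compare n) ∧ I.PairsPass (I.compare n) then 1 else 0) :=
    ⟨_, leads_init.seq (leads_rates.seq (leads_elim.seq (leads_back.seq
      (leads_compare.seq leads_test))))⟩
  refine ⟨c, T, fun n k I ⟨N, hN⟩ hlive => ?_⟩
  obtain ⟨O⟩ := hN.exists_openData
  obtain ⟨t, s, h1, h2, h3⟩ := hT n k I _ rfl
  refine ⟨t, s, h1, h2, fun he => ?_, fun he => ?_⟩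
  · rw [h3, if_pos ((MarkedSPN.ergodic_iff_pass O hlive).1 he)]
  · rw [h3, if_neg fun h => he ((MarkedSPN.ergodic_iff_pass O hlive).2 h)]
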